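/- **Setting.** For each value of the security parameter $\lambda$ let $(\mathcal F_M,\mathcal C_M,\mathcal R_M)$ be a quantum money scenario: a string $r$ is drawn uniformly and $\mathtt{Bank}(r)$ fills a database $B_M$ of notes, each with a public string, a secret string and a quantum state; $\mathcal C_M$ accepts the identifiers $\mathsf{id}$ of bills in $B_M$, and $\mathcal R_M(\mathsf{id},\rho)$ applies to $\rho$ the verification isometry $\mathtt{Ver}_{\mathsf{id}}$ and measures its output qubit. All parties see the public strings, the verifier also sees the secret strings, and only the input generation algorithm is given the notes, each at most once. The *cloning parameter* $\mu_M(\lambda)$ is an upper bound on the probability with which any (unbounded) adversary that is given the public strings and the notes outputs a valid $\mathsf{id}\in B_M$ and a state $\sigma_{AB}$ of two registers both of which pass $\mathtt{Ver}_{\mathsf{id}}$. A *protocol* $\mathcal K=(I,P_1,P_2,V_1,V_2)$ has an honest input generation algorithm $I$, which prepares the prover's initial state, an honest interactive quantum prover and an honest classical interactive verifier. In the *agree phase* $P_1$ and $V_1$ interact and each outputs an instance or $\bot$; $x$ is *agreed on* if both output $x$ and $\mathcal C_M$ accepts $x$. In the *prove phase* $P_2$ and $V_2$ continue on instance $x$,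 and $V_2$ outputs a bit. $\mathcal K$ has *completeness* $c$ if the honest parties agree on an instance and $V_2$ outputs $1$ with probability at least $c(\lambda)$. $\mathcal K$ is $(c,\delta)$-*secure with knowledge error* $\kappa$ if it has completeness $c$ and there is an extractor such that, for all sufficiently large $\lambda$, all provers $\hat P$, all input generation algorithms $\hat I$ and all $x$ which are agreed on with positive probability: if the success probability $p$ of $\hat P_2$ conditioned on $x$ being agreed on satisfies $p>\kappa$, then the extractor, given $x$, the public strings, the transcript of the agree phase, black-box access to $\hat P_2$ and a sufficient bound on its running time, outputs a state that $\mathcal R_M(x,\cdot)$ accepts with probability at least $1-\delta(p)$, conditioned on $x$ being agreed on. $\mathcal K$ is an *interactive quantum money verification procedure with completeness $c$ and cloning error $s$* if it has completeness $c$ and, for all sufficiently large $\lambda$, all pairs of provers $\hat P_A,\hat P_B$ and all input generation algorithms $\hat I$ win the following game with probability less than $s(\lambda)$: $\hat I$ prepares a joint state $\rho_{AB}$; $\hat P_A$ and $\hat P_B$, holding the two shares and not communicating, each execute $\mathcal K$ with their own copy of the honest verifier; they win if the same instance is agreed on in both executions and both verifiers output $1$. **Proposition.** Let $\delta_0=\frac{2-\sqrt3}{2}$,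 let $\nu>0$, $\kappa>0$ and $\varepsilon>0$ be constants, let $(\mathcal F_M,\mathcal C_M,\mathcal R_M)$ have cloning parameter $\mu_M(\lambda)$, and let $\mathcal K$ be a protocol for it in which $V_1$ uses only the public strings of the database (and its own coins and the messages it receives). Suppose that $\mathcal K$ is $(1-\mathsf{negl}(\lambda),\delta)$-secure with knowledge error $\kappa$ and extraction distance $\delta(p)=(1-p)^\nu$, and that $$\delta_0-(1-\kappa)^\nu>\frac{\mu_M(\lambda)}{2\varepsilon\kappa}$$ for all sufficiently large $\lambda$. Let $n=n(\lambda)$ be polynomially bounded, and $n(\lambda)\ge1$ for all sufficiently large $\lambda$. Consider the product scenario of $n$ independent copies of the database, in which a bill is a tuple of $n$ bills, one from each copy, an identifier is valid iff all its components are, and verification is the tensor product of the $n$ verifications and accepts iff all of them accept. Let $\mathcal K'$ be the protocol for this scenario that consists of $n$ sequential runs of $\mathcal K$, the $i$-th one on the $i$-th copy: each run (agree phase, then prove phase) is finished before the next one begins, the instance of $\mathcal K'$ is the tuple of the instances of the runs (so that the agree phase of $\mathcal K'$ ends with the agree phase of the $n$-th run), and the verifier accepts iff it accepts in every run. Then $\mathcal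 K'$ is an interactive quantum money verification procedure for the product scenario with completeness $1-\mathsf{negl}(\lambda)$ and cloning error $(1+\varepsilon)^n\kappa^n$. -/

import Mathlib

open Matrix Filter

namespace QMoney

/-! ## Generalities

All registers are finite-dimensional; a register is given by the finite type that labels its
standard basis, and an operator is a complex matrix indexed by such types. -/

/-- Squared Euclidean norm of a (possibly subnormalised) state vector. -/
def sqNorm {d : Type} [Fintype d] (v : d → ℂ) : ℝ := ∑ i, Complex.normSq (v i)

/-- Expectation of `f` over a uniformly random element of the finite type `α`. -/
noncomputable def avg {α : Type} [Fintype α] (f : α → ℝ) : ℝ :=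
  (∑ a, f a) / (Fintype.card α : ℝ)

/-- A tensor product of isometries is an isometry (in coordinates). -/
theorem prod_isometry {n : ℕ} {a b : Type} [Fintype a] [DecidableEq b]
    (A : Fin n → Matrix a b ℂ) (hA : ∀ q, (A q)ᴴ * A q = 1) (w w' : Fin n → b) :
    ∑ g : Fin n → a, star (∏ q, A q (g q) (w q)) * ∏ q, A q (g q) (w' q)
      = if w = w' then 1 else 0 := by
  have h1 : ∀ q, ∑ i, star (A q i (w q)) * A q i (w' q) = if w q = w' q then 1 else 0 := by
    intro q
    have := congrFun (congrFun (hA q) (w q)) (w' q)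
    simpa [Matrix.mul_apply, Matrix.one_apply] using this
  calc ∑ g : Fin n → a, star (∏ q, A q (g q) (w q)) * ∏ q, A q (g q) (w' q)
      = ∑ g : Fin n → a, ∏ q, (star (A q (g q) (w q)) * A q (g q) (w' q)) := by
        refine Finset.sum_congr rfl fun g _ => ?_
        rw [Finset.prod_mul_distrib, star_prod]
    _ = ∏ q, ∑ i, star (A q i (w q)) * A q i (w' q) := by
        rw [Finset.prod_univ_sum, Fintype.piFinset_univ]
    _ = if w = w' then 1 else 0 := by
        simp only [h1]
        rw [Finset.prod_ite_zero]
        simp [funext_iff]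

/-- The Kraus operators of a tensor product of `n` channels whose inputs are families of registers
indexed by `ν`. -/
def tensorKraus {n : ℕ} {ι a ν β : Type} (A : Fin n → ι → Matrix a (ν → β) ℂ) (j : Fin n → ι) :
    Matrix (Fin n → a) (Fin n × ν → β) ℂ :=
  Matrix.of fun f g => ∏ q, A q (j q) (f q) (fun i => g (q, i))

theorem tensorKraus_complete {n : ℕ} {ι a ν β : Type} [Fintype ι] [Fintype a] [Fintype ν]
    [DecidableEq ν] [DecidableEq β] (A : Fin n → ι → Matrix a (ν → β) ℂ)
    (hA : ∀ q, ∑ j, (A q j)ᴴ * A q j = 1) :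
    ∑ j, (tensorKraus A j)ᴴ * tensorKraus A j = 1 := by
  ext g g'
  have h := prod_isometry
    (fun (q : Fin n) => Matrix.of fun (z : ι × a) (u : ν → β) => A q z.1 z.2 u)
    (fun q => by
      rw [← hA q]
      ext u u'
      simp [Matrix.mul_apply, Matrix.sum_apply, Fintype.sum_prod_type])
    (fun q i => g (q, i)) (fun q i => g' (q, i))
  have hg : ((fun (q : Fin n) (i : ν) => g (q, i)) = fun q i => g' (q, i)) ↔ g = g' := by
    constructor
    · intro e
      funext ⟨q, i⟩
      exact congrFun (congrFun e q) i
    · rintro rfl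
      rfl
  simp only [hg] at h
  rw [Matrix.one_apply, ← h, Matrix.sum_apply]
  simp only [Matrix.mul_apply, Matrix.conjTranspose_apply, tensorKraus, Matrix.of_apply]
  rw [← (Equiv.arrowProdEquivProdArrow (Fin n) (fun _ => ι) (fun _ => a)).symm.sum_comp,
    Fintype.sum_prod_type]
  rfl

/-! ## Quantum money scenarios -/

/-- A quantum money agree-and-prove scenario at a fixed value of the security parameter.

The setup draws `r` uniformly from `Rand` and runs `Bank` on it, which fills a database of notes.
The record of a note consists of a public string, a secret string and a quantum state of the
register `W`; `none` means that the database has no such record.  A money bill is named by an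
identifier `x : Id` and consists of the notes `slot x k`, `k : Part`.  (In the scenario of a single
pair `(Bank, Ver)` one has `Note = Id` and `Part = Unit`; several parts occur in products of
scenarios.)  `ver x D` is the verification isometry for identifier `x` when the classical content of
the database is `D`; its designated output qubit is the `Bool` factor. -/
structure Scenario where
  Rand : Type
  Id : Type
  Note : Type
  Part : Type
  Pub : Type
  Sec : Type
  W : Type
  G : Type
  [fRand : Fintype Rand]
  [nRand : Nonempty Rand]
  [fId : Fintype Id]
  [dId : DecidableEq Id]
  [fNote : Fintype Note]
  [dNote : DecidableEq Note]
  [fPart : Fintype Part]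
  [dPart : DecidableEq Part]
  [fW : Fintype W]
  [dW : DecidableEq W]
  [fG : Fintype G]
  [dG : DecidableEq G]
  bank : Rand → Note → Option (Pub × Sec)
  money : Rand → Note → W → ℂ
  money_norm : ∀ r ν, sqNorm (money r ν) = 1
  slot : Id → Part → Note
  slot_injective : ∀ x, Function.Injective (slot x)
  ver : Id → (Note → Option (Pub × Sec)) → Matrix (Bool × G) (Part → W) ℂ
  ver_isometry : ∀ x D, (ver x D)ᴴ * ver x D = 1

attribute [instance] Scenario.fRand Scenario.nRand Scenario.fId Scenario.dId Scenario.fNote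
  Scenario.dNote Scenario.fPart Scenario.dPart Scenario.fW Scenario.dW Scenario.fG Scenario.dG

namespace Scenario

variable (M : Scenario)

/-- Everything the setup oracle reveals classically to the verifier role: the table of public and
secret strings. -/
abbrev View : Type := M.Note → Option (M.Pub × M.Sec)

/-- Everything the setup oracle reveals classically to the other roles: the table of public
strings. -/
abbrev PubView : Type := M.Note → Option M.Pub

variable {M} in
/-- The public part of the database. -/
def View.pub (D : M.View) : M.PubView := fun ν => (D ν).map Prod.fst

/-- The register that carries a purported money bill. -/
abbrev Bill : Type := M.Part → M.W

/-- The register that carries, for every note, either that note or the answer `⊥`. -/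
abbrev Supply : Type := M.Note → Option M.W

/-- The agreement relation: `x` is the identifier of a bill in the database. -/
def Valid (r : M.Rand) (x : M.Id) : Prop := ∀ k, (M.bank r (M.slot x k)).isSome

/-- The answer of the setup oracle to `getMoney` for the note `ν`: its quantum state, or `⊥`
(represented by `none`) if the database has no such note. -/
def noteState (r : M.Rand) (ν : M.Note) : Option M.W → ℂ := fun o =>
  if (M.bank r ν).isSome then o.elim 0 (M.money r ν) else if o = none then 1 else 0

/-- The joint state of all the notes in the database.  The oracle hands out each note at most once,
and only to the input generator, so the (unbounded) input generator's access to `getMoney` amounts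
to being handed this product state, of which it may use as much as it likes. -/
def supply (r : M.Rand) : M.Supply → ℂ := fun f => ∏ ν, M.noteState r ν (f ν)

/-- The part of the verification isometry in which the output qubit is `1`: a state `ρ` is accepted
by the proof relation with probability `tr (acc ρ accᴴ)`. -/
def acc (x : M.Id) (D : M.View) : Matrix M.G M.Bill ℂ :=
  Matrix.of fun g w => M.ver x D (true, g) w

/-- An adversary in the no-cloning experiment: a quantum instrument (in Kraus form) that acts on
what the setup hands to the input generator role, and outputs an identifier and a joint state of
two bill registers. -/
structure Cloner where
  ι : Type
  [fι : Fintype ι]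
  kraus : M.PubView → ι → Matrix (M.Bill × M.Bill) M.Supply ℂ
  label : M.PubView → ι → M.Id
  complete : ∀ p, ∑ j, (kraus p j)ᴴ * kraus p j = 1

attribute [instance] Cloner.fι

open Classical in
/-- The probability that the adversary outputs a valid identifier and that both of its bill
registers pass verification for that identifier. -/
noncomputable def cloneProb (C : M.Cloner) : ℝ :=
  avg fun r : M.Rand =>
    let D : M.View := M.bank r
    ∑ j, if M.Valid r (C.label D.pub j) then
        sqNorm ((Matrix.kroneckerMap (· * ·) (M.acc (C.label D.pub j) D)
          (M.acc (C.label D.pub j) D) * C.kraus D.pub j) *ᵥ M.supply r)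
      else 0

/-- `μ` is a cloning parameter of the scenario: no (unbounded) adversary wins the no-cloning
experiment with probability more than `μ`. -/
def HasCloningParameter (μ : ℝ) : Prop := ∀ C : M.Cloner, M.cloneProb C ≤ μ

variable {M} in
/-- The content of the `i`-th of `n` databases. -/
def compView {β : Type} {n : ℕ} (D : Fin n × M.Note → β) (i : Fin n) : M.Note → β :=
  fun ν => D (i, ν)

/-- The product scenario: `n` independent copies of the database; a bill is a tuple of bills, one
from each copy; an identifier is valid iff all of its components are; verification is the tensor
product of the verifications of the components, accepting iff all of them accept. -/
noncomputable def power (n : ℕ) : Scenario where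
  Rand := Fin n → M.Rand
  Id := Fin n → M.Id
  Note := Fin n × M.Note
  Part := Fin n × M.Part
  Pub := M.Pub
  Sec := M.Sec
  W := M.W
  G := Fin n → Bool × M.G
  bank r ν := M.bank (r ν.1) ν.2
  money r ν := M.money (r ν.1) ν.2
  money_norm r ν := M.money_norm _ _
  slot x k := (k.1, M.slot (x k.1) k.2)
  slot_injective := by
    rintro x ⟨i, k⟩ ⟨j, l⟩ h
    obtain ⟨h1, h2⟩ := Prod.mk.inj h
    dsimp only at h1 h2
    subst h1
    rw [M.slot_injective _ h2]
  ver x D := Matrix.of fun bg w =>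
    if bg.1 = decide (∀ q, (bg.2 q).1 = true) then
      ∏ q, M.ver (x q) (compView D q) (bg.2 q) (fun k => w (q, k))
    else 0
  ver_isometry := by
    intro x D
    ext w w'
    have h := prod_isometry (fun q => M.ver (x q) (compView D q))
      (fun q => M.ver_isometry _ _) (fun q k => w (q, k)) (fun q k => w' (q, k))
    have hw : ((fun (q : Fin n) (k : M.Part) => w (q, k)) = fun q k => w' (q, k)) ↔ w = w' := by
      constructor
      · intro e
        funext ⟨q, k⟩
        exact congrFun (congrFun e q) k
      · rintro rfl
        rfl
    rw [Matrix.mul_apply, Fintype.sum_prod_type_right]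
    simp only [Matrix.conjTranspose_apply, Matrix.one_apply, Matrix.of_apply]
    simp only [hw] at h
    rw [← h]
    refine Finset.sum_congr rfl fun g _ => ?_
    rw [Finset.sum_eq_single (decide (∀ q, (g q).1 = true))]
    · simp
    · intro b _ hb
      simp [hb]
    · simp

end Scenario

/-! ## Interactive machines -/

/-- A prover `(P₁, P₂)`: an interactive quantum machine with internal register `S` which in each
round applies a unitary to `S` and the network register `Msg`.  Its unitaries may depend on the
public part of the database.  At the end of the agree phase it outputs an instance (or `⊥`), read
off `S` by the standard-basis measurement `out`; in the prove phase it is given the agreed instance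
and continues on the post-measurement state. -/
structure Prover (M : Scenario) (Msg : Type) [Fintype Msg] [DecidableEq Msg] where
  S : Type
  [fS : Fintype S]
  [dS : DecidableEq S]
  agree : M.PubView → ℕ → Matrix.unitaryGroup (S × Msg) ℂ
  out : S → Option M.Id
  prove : M.PubView → M.Id → ℕ → Matrix.unitaryGroup (S × Msg) ℂ

attribute [instance] Prover.fS Prover.dS

/-- An input generation algorithm that prepares a state of the register `S`: a quantum channel (in
Kraus form) that acts on what the setup hands to the input generator role. -/
structure InputGen (M : Scenario) (S : Type) [Fintype S] where
  ι : Type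
  [fι : Fintype ι]
  kraus : M.PubView → ι → Matrix S M.Supply ℂ
  complete : ∀ p, ∑ j, (kraus p j)ᴴ * kraus p j = 1

attribute [instance] InputGen.fι

/-- The operator on `S` that describes one prover action: the network register contains the
verifier's message `m`, the unitary `U` is applied, and the network register is measured, with
outcome `a`. -/
def respond {S Msg : Type} (U : Matrix (S × Msg) (S × Msg) ℂ) (m a : Msg) : Matrix S S ℂ :=
  Matrix.of fun s' s => U (s', a) (s, m)

/-- The operator on `S` that describes a sequence of rounds in which the verifier sends the message
`ask h` when the prover's messages so far are `h`, and the prover, applying `U i` in round `i`,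
continues `h` by the given list of messages. -/
def interact {S Msg : Type} [Fintype S] [DecidableEq S] (ask : List Msg → Msg)
    (U : ℕ → Matrix (S × Msg) (S × Msg) ℂ) : List Msg → List Msg → Matrix S S ℂ
  | _, [] => 1
  | h, a :: l => interact ask U (h ++ [a]) l * respond (U h.length) (ask h) a

/-- The communication transcript of such an interaction: pairs of a verifier message and the
prover's response. -/
def transcript {Msg : Type} (ask : List Msg → Msg) : List Msg → List Msg → List (Msg × Msg)
  | _, [] => []
  | h, a :: l => (ask h, a) :: transcript ask (h ++ [a]) l

/-- A protocol `(I, P₁, P₂, V₁, V₂)` with a classical honest verifier for the scenario `M`, at a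
fixed value of the security parameter.  The verifier draws private coins and is given by its
next-message function: `ask D c h` is its message when the database is `D`, its coins are `c` and
the prover's messages so far are `h`.  `V₁` is its behaviour during the first `agreeRounds` rounds,
after which it outputs the instance `inst D c h` (or `⊥`); `V₂` is its behaviour in the remaining
`proveRounds` rounds, after which it outputs the bit `verdict D c h`. -/
structure Protocol (M : Scenario) where
  Msg : Type
  Coins : Type
  [fMsg : Fintype Msg]
  [dMsg : DecidableEq Msg]
  [iMsg : Inhabited Msg]
  [fCoins : Fintype Coins]
  [nCoins : Nonempty Coins]
  agreeRounds : ℕ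
  proveRounds : ℕ
  ask : M.View → Coins → List Msg → Msg
  inst : M.View → Coins → List Msg → Option M.Id
  verdict : M.View → Coins → List Msg → Bool
  P : Prover M Msg
  I : InputGen M P.S

attribute [instance] Protocol.fMsg Protocol.dMsg Protocol.iMsg Protocol.fCoins Protocol.nCoins

namespace Protocol

variable {M : Scenario} (K : Protocol M)

/-- `V₁` uses the setup oracle only through its public functions (to check, for instance, that an
identifier is valid). -/
def AgreePhasePublic : Prop :=
  ∀ r r' : M.Rand,
    Scenario.View.pub (M.bank r : M.View) = Scenario.View.pub (M.bank r' : M.View) →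
    ∀ c,
      (∀ h : List K.Msg, h.length < K.agreeRounds →
        K.ask (M.bank r) c h = K.ask (M.bank r') c h) ∧
      (∀ h : List K.Msg, h.length = K.agreeRounds →
        K.inst (M.bank r) c h = K.inst (M.bank r') c h)

/-- The operator on the prover's register that corresponds to the agree phase with prover messages
`a`, followed by the prover outputting the instance `x`. -/
def agreeOp (P : Prover M K.Msg) (D : M.View) (c : K.Coins) (x : M.Id) (a : List K.Msg) :
    Matrix P.S P.S ℂ :=
  Matrix.diagonal (fun s => if P.out s = some x then 1 else 0) *
    interact (K.ask D c) (fun i => (P.agree D.pub i : Matrix (P.S × K.Msg) (P.S × K.Msg) ℂ)) [] a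

/-- The operator on the prover's register that corresponds to the prove phase on instance `x` with
prover messages `b`, when the prover's messages in the agree phase were `a`. -/
def proveOp (P : Prover M K.Msg) (D : M.View) (c : K.Coins) (x : M.Id) (a b : List K.Msg) :
    Matrix P.S P.S ℂ :=
  interact (fun h => K.ask D c (a ++ h))
    (fun i => (P.prove D.pub x i : Matrix (P.S × K.Msg) (P.S × K.Msg) ℂ)) [] b

/-- `V₁` outputs the instance `x`, and `x` satisfies the agreement relation. -/
def Agrees (r : M.Rand) (c : K.Coins) (x : M.Id) (a : List K.Msg) : Prop :=
  K.inst (M.bank r) c a = some x ∧ M.Valid r x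

open Classical in
/-- The probability that the instance `x` is agreed on in the agree phase. -/
noncomputable def agreeProb (P : Prover M K.Msg) (I : InputGen M P.S) (x : M.Id) : ℝ :=
  avg fun r : M.Rand => avg fun c : K.Coins =>
    let D : M.View := M.bank r
    ∑ a : Fin K.agreeRounds → K.Msg,
      if K.Agrees r c x (List.ofFn a) then
        ∑ j, sqNorm ((K.agreeOp P D c x (List.ofFn a) * I.kraus D.pub j) *ᵥ M.supply r)
      else 0

open Classical in
/-- The probability that the instance `x` is agreed on in the agree phase and that the verifier
accepts at the end of the prove phase. -/
noncomputable def successProb (P : Prover M K.Msg) (I : InputGen M P.S) (x : M.Id) : ℝ :=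
  avg fun r : M.Rand => avg fun c : K.Coins =>
    let D : M.View := M.bank r
    ∑ a : Fin K.agreeRounds → K.Msg, ∑ b : Fin K.proveRounds → K.Msg,
      if K.Agrees r c x (List.ofFn a) ∧ K.verdict D c (List.ofFn a ++ List.ofFn b) = true then
        ∑ j, sqNorm ((K.proveOp P D c x (List.ofFn a) (List.ofFn b) *
          K.agreeOp P D c x (List.ofFn a) * I.kraus D.pub j) *ᵥ M.supply r)
      else 0

/-- The probability that the honest parties agree on an instance and that the honest verifier then
accepts. -/
noncomputable def honestProb : ℝ := ∑ x, K.successProb K.P K.I x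

end Protocol

/-! ## Extraction -/

/-- An oracle machine with black-box access to an interactive quantum machine.  It has a private
register `Wit × Anc` (the factor `Wit` holds its output) and access to the network register `Msg`,
which start in standard-basis states.  It applies the unitaries in `steps` to these registers, and
after each of them makes an oracle call, coherently controlled by the private register: depending
on `query`, nothing happens, or the machine's unitary for some round (`true`) or its inverse
(`false`) is applied to the machine's internal register and the network register. -/
structure OracleMachine (Msg : Type) [Fintype Msg] [DecidableEq Msg] (R : ℕ)
    (Wit : Type) [Fintype Wit] [DecidableEq Wit] where
  Anc : Type
  [fAnc : Fintype Anc]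
  [dAnc : DecidableEq Anc]
  start : Wit × Anc
  query : Wit × Anc → Option (Fin R × Bool)
  steps : List (Matrix.unitaryGroup ((Wit × Anc) × Msg) ℂ)

attribute [instance] OracleMachine.fAnc OracleMachine.dAnc

namespace OracleMachine

variable {Msg : Type} [Fintype Msg] [DecidableEq Msg] {R : ℕ}
  {Wit : Type} [Fintype Wit] [DecidableEq Wit] (E : OracleMachine Msg R Wit)
  {S : Type} [Fintype S] [DecidableEq S]

/-- The controlled oracle call, when the machine's unitary for round `i` is `U i`. -/
def callOp (U : ℕ → Matrix.unitaryGroup (S × Msg) ℂ) :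
    Matrix ((Wit × E.Anc) × (S × Msg)) ((Wit × E.Anc) × (S × Msg)) ℂ :=
  Matrix.of fun z z' => if z.1 = z'.1 then
      (match E.query z.1 with
        | none => (1 : Matrix (S × Msg) (S × Msg) ℂ)
        | some (i, true) => (U i : Matrix (S × Msg) (S × Msg) ℂ)
        | some (i, false) => (U i : Matrix (S × Msg) (S × Msg) ℂ)ᴴ) z.2 z'.2
    else 0

/-- A unitary on the private and network registers, acting trivially on the internal register of
the other machine. -/
def localOp (V : Matrix.unitaryGroup ((Wit × E.Anc) × Msg) ℂ) :
    Matrix ((Wit × E.Anc) × (S × Msg)) ((Wit × E.Anc) × (S × Msg)) ℂ :=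
  Matrix.of fun z z' => if z.2.1 = z'.2.1 then
      (V : Matrix ((Wit × E.Anc) × Msg) ((Wit × E.Anc) × Msg) ℂ) (z.1, z.2.2) (z'.1, z'.2.2)
    else 0

/-- The whole computation. -/
def totalOp (U : ℕ → Matrix.unitaryGroup (S × Msg) ℂ) :
    Matrix ((Wit × E.Anc) × (S × Msg)) ((Wit × E.Anc) × (S × Msg)) ℂ :=
  E.steps.foldl (fun A V => E.callOp U * E.localOp V * A) 1

/-- The Kraus operators of the channel from the internal register of the other machine to the
output register which results from the computation when all other registers are discarded. -/
def kraus [Inhabited Msg] (U : ℕ → Matrix.unitaryGroup (S × Msg) ℂ) (j : E.Anc × S × Msg) :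
    Matrix Wit S ℂ :=
  Matrix.of fun w s => E.totalOp U ((w, j.1), (j.2.1, j.2.2)) (E.start, (s, default))

end OracleMachine

namespace Protocol

variable {M : Scenario} (K : Protocol M)

/-- An extractor: given a bound `t` on its running time, the public functions of the setup oracle,
an instance and a transcript of the agree phase, an oracle machine that outputs a purported bill. -/
abbrev Extractor : Type 1 :=
  ℕ → M.PubView → M.Id → List (K.Msg × K.Msg) → OracleMachine K.Msg K.proveRounds M.Bill

open Classical in
/-- The probability that the instance `x` is agreed on in the agree phase, and that the proof
relation accepts (on `x`) the state which the extractor, run with bound `t`, outputs when given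
black-box access to `P₂`. -/
noncomputable def extractProb (E : K.Extractor) (t : ℕ) (P : Prover M K.Msg) (I : InputGen M P.S)
    (x : M.Id) : ℝ :=
  avg fun r : M.Rand => avg fun c : K.Coins =>
    let D : M.View := M.bank r
    ∑ a : Fin K.agreeRounds → K.Msg,
      if K.Agrees r c x (List.ofFn a) then
        let F := E t D.pub x (transcript (K.ask D c) [] (List.ofFn a))
        ∑ j, ∑ i, sqNorm ((M.acc x D * F.kraus (P.prove D.pub x) i *
          K.agreeOp P D c x (List.ofFn a) * I.kraus D.pub j) *ᵥ M.supply r)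
      else 0

/-- The proof-of-knowledge property at a fixed value of the security parameter, for the extractor
`E`: whenever an instance `x` is agreed on with positive probability and the prover's success
probability `p` conditioned on this exceeds `κ`, the extractor outputs (conditioned on the same
event) a state that the proof relation accepts with probability at least `1 - δ p`. -/
def Extracts (E : K.Extractor) (κ : ℝ) (δ : ℝ → ℝ) : Prop :=
  ∀ (P : Prover M K.Msg) (I : InputGen M P.S) (x : M.Id), 0 < K.agreeProb P I x →
    κ < K.successProb P I x / K.agreeProb P I x →
      ∃ t, 1 - δ (K.successProb P I x / K.agreeProb P I x) ≤
        K.extractProb E t P I x / K.agreeProb P I x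

open Classical in
/-- The probability that the provers `A` and `B`, who share a state prepared by `I`, win the
no-cloning game: each of them interacts with its own copy of the honest verifier, the same instance
is agreed on in both executions, and both verifiers accept. -/
noncomputable def cloneGameProb (A B : Prover M K.Msg) (I : InputGen M (A.S × B.S)) : ℝ :=
  avg fun r : M.Rand => avg fun cA : K.Coins => avg fun cB : K.Coins =>
    let D : M.View := M.bank r
    ∑ x : M.Id,
      ∑ a : Fin K.agreeRounds → K.Msg, ∑ b : Fin K.proveRounds → K.Msg,
      ∑ a' : Fin K.agreeRounds → K.Msg, ∑ b' : Fin K.proveRounds → K.Msg,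
        if (K.Agrees r cA x (List.ofFn a) ∧
              K.verdict D cA (List.ofFn a ++ List.ofFn b) = true) ∧
            (K.Agrees r cB x (List.ofFn a') ∧
              K.verdict D cB (List.ofFn a' ++ List.ofFn b') = true) then
          ∑ j, sqNorm ((Matrix.kroneckerMap (· * ·)
              (K.proveOp A D cA x (List.ofFn a) (List.ofFn b) *
                K.agreeOp A D cA x (List.ofFn a))
              (K.proveOp B D cB x (List.ofFn a') (List.ofFn b') *
                K.agreeOp B D cB x (List.ofFn a')) * I.kraus D.pub j) *ᵥ M.supply r)
        else 0

end Protocol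

/-! ## Asymptotic notions -/

/-- Negligible functions of the security parameter. -/
def Negligible (η : ℕ → ℝ) : Prop :=
  Asymptotics.SuperpolynomialDecay atTop (fun k : ℕ => (k : ℝ)) η

/-- A family of protocols (indexed by the security parameter) is secure with completeness `c`,
knowledge error `κ` and extraction distance `δ`, the latter being a function of the prover's success
probability and of the security parameter. -/
def IsSecure {M : ℕ → Scenario} (K : ∀ k, Protocol (M k)) (c : ℕ → ℝ) (κ : ℕ → ℝ)
    (δ : ℝ → ℕ → ℝ) : Prop :=
  (∀ k, c k ≤ (K k).honestProb) ∧
    ∃ E : ∀ k, (K k).Extractor, ∀ᶠ k in atTop, (K k).Extracts (E k) (κ k) (fun p => δ p k)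

/-- A family of protocols is an interactive quantum money verification procedure with completeness
`c` and cloning error `s`: the honest parties succeed with probability at least `c`, and (for all
sufficiently large values of the security parameter) all pairs of provers with all input generation
algorithms win the no-cloning game with probability less than `s`. -/
def IsMoneyVerification {M : ℕ → Scenario} (K : ∀ k, Protocol (M k)) (c s : ℕ → ℝ) : Prop :=
  (∀ k, c k ≤ (K k).honestProb) ∧
    ∀ᶠ k in atTop, ∀ (A B : Prover (M k) (K k).Msg) (I : InputGen (M k) (A.S × B.S)),
      (K k).cloneGameProb A B I < s k

/-! ## Sequential repetition -/

/-- Relabelling the basis preserves unitarity. -/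
def relabel {a b : Type} [Fintype a] [DecidableEq a] [Fintype b] [DecidableEq b] (e : a ≃ b)
    (U : Matrix.unitaryGroup b ℂ) : Matrix.unitaryGroup a ℂ :=
  ⟨(U : Matrix b b ℂ).submatrix e e, by
    rw [Matrix.mem_unitaryGroup_iff, Matrix.star_eq_conjTranspose, Matrix.conjTranspose_submatrix,
      Matrix.submatrix_mul_equiv, ← Matrix.star_eq_conjTranspose,
      Matrix.mem_unitaryGroup_iff.1 U.2, Matrix.submatrix_one_equiv]⟩

/-- The unitary that applies `V y` when the control register is in the basis state `y`. -/
def controlled {a y : Type} [Fintype a] [DecidableEq a] [Fintype y] [DecidableEq y]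
    (V : y → Matrix.unitaryGroup a ℂ) : Matrix.unitaryGroup (a × y) ℂ :=
  ⟨Matrix.blockDiagonal fun i => (V i : Matrix a a ℂ), by
    rw [Matrix.mem_unitaryGroup_iff, Matrix.star_eq_conjTranspose,
      Matrix.blockDiagonal_conjTranspose, ← Matrix.blockDiagonal_mul]
    simp only [← Matrix.star_eq_conjTranspose]
    have : (fun i => (V i : Matrix a a ℂ) * star (V i : Matrix a a ℂ)) = 1 := by
      funext i
      exact Matrix.mem_unitaryGroup_iff.1 (V i).2
    rw [this, Matrix.blockDiagonal_one]⟩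

/-- The unitary that permutes the basis states by `σ`. -/
def permUnitary {a : Type} [Fintype a] [DecidableEq a] (σ : Equiv.Perm a) :
    Matrix.unitaryGroup a ℂ :=
  ⟨Matrix.of fun i j => if i = σ j then 1 else 0, by
    rw [Matrix.mem_unitaryGroup_iff]
    ext i j
    rw [Matrix.mul_apply, Finset.sum_eq_single (σ.symm i)]
    · simp [Matrix.one_apply, Matrix.star_apply, eq_comm]
    · intro k _ hk
      have : i ≠ σ k := fun h => hk (by simp [h])
      simp [this]
    · simp⟩

/-- The register in which the honest prover of the repeated protocol keeps its data for one run: the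
register of the original prover, and a register for the instance output in that run (`none` as long
as nothing has been recorded). -/
abbrev Cell (X S : Type) : Type := Option (Option X) × S

section Cells

variable {X S Msg : Type} [Fintype X] [DecidableEq X] [Fintype S] [DecidableEq S]
  [Fintype Msg] [DecidableEq Msg]

/-- Apply, to the original register and the network register, a unitary that may depend on the
recorded instance. -/
def onCell (V : Option (Option X) → Matrix.unitaryGroup (S × Msg) ℂ) :
    Matrix.unitaryGroup (Cell X S × Msg) ℂ :=
  relabel ((Equiv.prodAssoc _ _ _).trans (Equiv.prodComm _ _)) (controlled V)

/-- Copy the output instance, in the standard basis, into the (empty) record. -/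
def recordInst (out : S → Option X) : Matrix.unitaryGroup (Cell X S × Msg) ℂ :=
  permUnitary
    { toFun := fun z => ((Equiv.swap none (some (out z.1.2)) z.1.1, z.1.2), z.2)
      invFun := fun z => ((Equiv.swap none (some (out z.1.2)) z.1.1, z.1.2), z.2)
      left_inv := fun z => by simp
      right_inv := fun z => by simp }

/-- The instance output in a run: the recorded one, or, if nothing has been recorded yet, the one
read off the original register. -/
def cellOut (out : S → Option X) (z : Cell X S) : Option X := z.1.elim (out z.2) id

/-- Apply a unitary to the `q`-th of `n` registers and the network register. -/
def atRun {C : Type} [Fintype C] [DecidableEq C] {n : ℕ} (q : Fin n)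
    (U : Matrix.unitaryGroup (C × Msg) ℂ) : Matrix.unitaryGroup ((Fin n → C) × Msg) ℂ :=
  relabel (((Equiv.funSplitAt q C).prodCongr (Equiv.refl Msg)).trans
    ((Equiv.prodAssoc _ _ _).trans
      (((Equiv.refl C).prodCongr (Equiv.prodComm _ _)).trans (Equiv.prodAssoc _ _ _).symm)))
    (controlled fun _ : { j // j ≠ q } → C => U)

end Cells

/-- All components of a tuple, if they are all defined. -/
def allSome {n : ℕ} {X : Type} (f : Fin n → Option X) : Option (Fin n → X) :=
  if h : ∀ q, (f q).isSome then some fun q => (f q).get (h q) else none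

namespace Protocol

variable {M : Scenario} (K : Protocol M) (n : ℕ)

/-- The number of rounds of a complete run. -/
abbrev rounds : ℕ := K.agreeRounds + K.proveRounds

/-- The action of the honest prover in round `i` of a run: `P₁` in the agree phase; at the beginning
of the prove phase the output of `P₁` is recorded; then `P₂` on the recorded instance. -/
noncomputable def runStep (p : M.PubView) (i : ℕ) :
    Matrix.unitaryGroup (Cell M.Id K.P.S × K.Msg) ℂ :=
  if i < K.agreeRounds then onCell fun _ => K.P.agree p i
  else
    onCell (fun y => match y with
      | some (some x) => K.P.prove p x (i - K.agreeRounds)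
      | _ => 1) *
    (if i = K.agreeRounds then recordInst K.P.out else 1)

/-- The honest prover of the repeated protocol: rounds `q * K.rounds, …, (q + 1) * K.rounds - 1`
are the run number `q`. -/
noncomputable def seqProver : Prover (M.power n) K.Msg where
  S := Fin n → Cell M.Id K.P.S
  agree p i :=
    if h : i / K.rounds < n then
      atRun ⟨i / K.rounds, h⟩ (K.runStep (Scenario.compView p ⟨i / K.rounds, h⟩) (i % K.rounds))
    else 1
  out f := allSome fun q => cellOut K.P.out (f q)
  prove p x i :=
    if h : n - 1 < n then
      atRun ⟨n - 1, h⟩ (onCell fun _ =>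
        K.P.prove (Scenario.compView p ⟨n - 1, h⟩) (x ⟨n - 1, h⟩) i)
    else 1

/-- The original input generator, its output being put into a cell with empty record. -/
def inputCell (p : M.PubView) (j : K.I.ι) : Matrix (Cell M.Id K.P.S) M.Supply ℂ :=
  Matrix.of fun z u => if z.1 = none then K.I.kraus p j z.2 u else 0

theorem inputCell_complete (p : M.PubView) :
    ∑ j, (K.inputCell p j)ᴴ * K.inputCell p j = 1 := by
  rw [← K.I.complete p]
  ext u u'
  simp [Matrix.mul_apply, Matrix.sum_apply, Fintype.sum_prod_type, inputCell]

/-- The honest input generator of the repeated protocol: one independent execution of the original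
input generator for each run. -/
noncomputable def seqInput : InputGen (M.power n) (K.seqProver n).S where
  ι := Fin n → K.I.ι
  kraus p := tensorKraus (fun q => K.inputCell (Scenario.compView p q))
  complete _ := tensorKraus_complete _ fun _ => K.inputCell_complete _

/-- The prover's messages in run number `q`, extracted from the list of all its messages. -/
def runMsgs (q : ℕ) (l : List K.Msg) : List K.Msg := (l.drop (q * K.rounds)).take K.rounds

/-- The protocol for the product scenario that consists of `n` sequential runs of `K`, the `q`-th
run with the `q`-th database and with fresh coins.  The instance is the tuple of the instances of
the runs and is fixed when the agree phase of the last run is over; the first `n - 1` runs and the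
agree phase of the last run thus form the agree phase.  The verifier accepts iff it accepts in each
of the runs. -/
noncomputable def sequential : Protocol (M.power n) where
  Msg := K.Msg
  Coins := Fin n → K.Coins
  agreeRounds := (n - 1) * K.rounds + K.agreeRounds
  proveRounds := K.proveRounds
  ask D c l :=
    if h : l.length / K.rounds < n then
      K.ask (Scenario.compView D ⟨l.length / K.rounds, h⟩) (c ⟨l.length / K.rounds, h⟩)
        (K.runMsgs (l.length / K.rounds) l)
    else default
  inst D c l :=
    allSome fun q : Fin n =>
      K.inst (Scenario.compView D q) (c q) ((K.runMsgs q l).take K.agreeRounds)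
  verdict D c l :=
    decide (∀ q : Fin n, K.verdict (Scenario.compView D q) (c q) (K.runMsgs q l) = true)
  P := K.seqProver n
  I := K.seqInput n

end Protocol

end QMoney

namespace QMoney

open scoped ComplexOrder

set_option linter.unusedSectionVars false

/-! ## Norms of vectors and averages -/

section Norms

variable {d m n t : Type} [Fintype d] [Fintype m] [Fintype n] [Fintype t]

/-! There are two halves: a bound `w = κ + β` with `β < ε * κ` for a single execution of the
no-cloning game, and a duality argument which turns it into `w ^ n` for `n` sequential runs.

Single execution. For an instance `x`, let `q` be the probability that `x` is agreed on in both
executions, `s` the probability that moreover both verifiers accept, and `d = (1 - κ) ^ ν`. Suppose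
`s > κ * q`. Conditioned on joint agreement, each prover then succeeds with probability above `κ`.
Since `V₁` is public, the partner's agree phase, verifier included, can be absorbed into the input
generator (`Protocol.absorb`); the postselection on its outcome makes the preparation
trace-decreasing, which a flag repairs (`Protocol.Extracts.of_contractive`). Hence extraction works
for each prover with conditional probability at least `1 - d`, and for both at once with probability
at least `1 - 2 * d`, by the union bound for operations on different tensor factors
(`Protocol.Extracts.both`). So `q ≤ e / (1 - 2 * d)`, where `e` is the probability that `x` is
agreed on and two accepted bills are extracted. Whether or not `s > κ * q`, it follows that `s ≤ κ *
q + e / (1 - 2 * d)`. Over all `x`, the `q` sum to at most `1` (`Protocol.sum_pairWeight_le_one`)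
and the `e` to at most `μ`, because one cloner can carry out all of this
(`Protocol.sum_bothExtract_le`). The gap hypothesis, in which only `(2 - √3) / 2 < 1 / 2` matters,
makes `β = μ / (1 - 2 * d)` smaller than `ε * κ`. If `κ ≥ 1` the bound is trivial.

Repetition. The input generator may entangle the material of all copies and the provers keep memory
between runs, so the bound is not applied to conditional states run by run. Instead it is dualised:
a score that is quadratic in the Kraus operators and at most `w` on every channel has a certificate,
vectors `y k` of total squared norm at most `w` such that every operator `T` scores at most `∑ k, ‖T
y k‖²` (`exists_dual_certificate`, by the Riesz extension theorem). Starting with the last run, the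
actual supply of each copy is replaced by certificate vectors (`sum_seqOp_le`). In the end a tensor
product of such vectors is fed into the trace-preserving input channel, and the total squared norm
factorises into at most `w ^ n`.

Two features of the single-run bound serve this step. The certificate has to hold simultaneously for
all strategies that may occur in a run, which is why players carry a classical label `j`; and it is
resolved according to the public view of the copy, since prover and input generator act depending on
all public views.

Completeness. The honest prover keeps the runs in separate tensor factors, so its success
probability is exactly the `n`-th power of the original one (`Protocol.honestProb_sequential`), and
Bernoulli's inequality applies. -/

theorem sqNorm_nonneg (v : d → ℂ) : 0 ≤ sqNorm v :=
  Finset.sum_nonneg fun _ _ => Complex.normSq_nonneg _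

@[simp] theorem sqNorm_zero : sqNorm (0 : d → ℂ) = 0 := by simp [sqNorm]

theorem sqNorm_smul (c : ℂ) (v : d → ℂ) : sqNorm (c • v) = Complex.normSq c * sqNorm v := by
  simp [sqNorm, Finset.mul_sum]

theorem ofReal_sqNorm (v : d → ℂ) : (sqNorm v : ℂ) = star v ⬝ᵥ v := by
  simp [sqNorm, dotProduct, Complex.normSq_eq_conj_mul_self]

theorem ofReal_sqNorm_mulVec (A : Matrix m n ℂ) (v : n → ℂ) :
    (sqNorm (A *ᵥ v) : ℂ) = star v ⬝ᵥ ((Aᴴ * A) *ᵥ v) := by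
  rw [ofReal_sqNorm, star_mulVec, ← dotProduct_mulVec, mulVec_mulVec]

theorem sqNorm_prod (v : m × n → ℂ) : sqNorm v = ∑ i, sqNorm fun j => v (i, j) := by
  simp [sqNorm, Fintype.sum_prod_type]

theorem sqNorm_prod_right (v : m × n → ℂ) : sqNorm v = ∑ j, sqNorm fun i => v (i, j) := by
  simp [sqNorm, Fintype.sum_prod_type_right]

theorem sqNorm_comp_equiv (e : m ≃ n) (v : n → ℂ) : sqNorm (v ∘ e) = sqNorm v := by
  simp only [sqNorm, Function.comp]
  exact e.sum_comp fun i => Complex.normSq (v i)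

theorem avg_nonneg {f : m → ℝ} (h : ∀ i, 0 ≤ f i) : 0 ≤ avg f :=
  div_nonneg (Finset.sum_nonneg fun i _ => h i) (Nat.cast_nonneg _)

theorem avg_mono {f g : m → ℝ} (h : ∀ i, f i ≤ g i) : avg f ≤ avg g :=
  div_le_div_of_nonneg_right (Finset.sum_le_sum fun i _ => h i) (Nat.cast_nonneg _)

theorem avg_const [Nonempty m] (c : ℝ) : avg (fun _ : m => c) = c := by
  simp [avg]

theorem avg_add (f g : m → ℝ) : avg (fun i => f i + g i) = avg f + avg g := by
  simp [avg, Finset.sum_add_distrib, add_div]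

theorem avg_sum {ι : Type} (s : Finset ι) (f : ι → m → ℝ) :
    avg (fun i => ∑ j ∈ s, f j i) = ∑ j ∈ s, avg (f j) := by
  simp only [avg, ← Finset.sum_div]
  rw [Finset.sum_comm]

theorem avg_comm (f : m → n → ℝ) : (avg fun i => avg fun j => f i j) = avg fun j => avg fun i => f i j := by
  simp only [avg, Finset.sum_div]
  rw [Finset.sum_comm]
  exact Finset.sum_congr rfl fun _ _ => Finset.sum_congr rfl fun _ _ => div_right_comm _ _ _

theorem avg_eq_sum (f : m → ℝ) : avg f = ∑ i, (Fintype.card m : ℝ)⁻¹ * f i := by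
  rw [avg, ← Finset.mul_sum, div_eq_inv_mul]

theorem avg_le_of_le [Nonempty m] {f : m → ℝ} {c : ℝ} (h : ∀ i, f i ≤ c) : avg f ≤ c :=
  (avg_mono h).trans_eq (avg_const c)

end Norms

/-! ## Families of Kraus operators -/

section Kraus

variable {ι κ l m n t : Type} [Fintype ι] [Fintype κ] [Fintype l] [Fintype m] [Fintype n]
  [Fintype t]

/-- A family of Kraus operators of a trace-non-increasing map. -/
def Contractive (A : ι → Matrix m n ℂ) : Prop :=
  ∀ v, ∑ i, sqNorm (A i *ᵥ v) ≤ sqNorm v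

theorem ofReal_sum_sqNorm_mulVec (A : ι → Matrix m n ℂ) (v : n → ℂ) :
    ((∑ i, sqNorm (A i *ᵥ v) : ℝ) : ℂ) = star v ⬝ᵥ ((∑ i, (A i)ᴴ * A i) *ᵥ v) := by
  rw [Complex.ofReal_sum, sum_mulVec, dotProduct_sum]
  exact Finset.sum_congr rfl fun i _ => ofReal_sqNorm_mulVec _ _

theorem sum_sqNorm_of_complete [DecidableEq n] {A : ι → Matrix m n ℂ}
    (hA : ∑ i, (A i)ᴴ * A i = 1) (v : n → ℂ) : ∑ i, sqNorm (A i *ᵥ v) = sqNorm v := by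
  apply Complex.ofReal_injective
  rw [ofReal_sum_sqNorm_mulVec, hA, one_mulVec, ofReal_sqNorm]

theorem sqNorm_of_isometry [DecidableEq n] {A : Matrix m n ℂ} (hA : Aᴴ * A = 1) (v : n → ℂ) :
    sqNorm (A *ᵥ v) = sqNorm v := by
  apply Complex.ofReal_injective
  rw [ofReal_sqNorm_mulVec, hA, one_mulVec, ofReal_sqNorm]

theorem sqNorm_unitary [DecidableEq n] (U : Matrix.unitaryGroup n ℂ) (v : n → ℂ) :
    sqNorm ((U : Matrix n n ℂ) *ᵥ v) = sqNorm v :=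
  sqNorm_of_isometry (by
    rw [← star_eq_conjTranspose]; exact Matrix.mem_unitaryGroup_iff'.1 U.2) v

/-- A Hermitian matrix with vanishing quadratic form is positive semidefinite with every vector in
its kernel, hence zero. This converse of `sum_sqNorm_of_complete` lets completeness be checked on
norms. -/
theorem complete_of_sum_sqNorm [DecidableEq n] {A : ι → Matrix m n ℂ}
    (hA : ∀ v, ∑ i, sqNorm (A i *ᵥ v) = sqNorm v) : ∑ i, (A i)ᴴ * A i = 1 := by
  have h : ∀ M : Matrix n n ℂ, M.IsHermitian → (∀ v : n → ℂ, star v ⬝ᵥ (M *ᵥ v) = 0) → M = 0 := by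
    intro M hM h
    have hp : M.PosSemidef := .of_dotProduct_mulVec_nonneg hM fun x => (h x).ge
    ext i j
    have := (hp.dotProduct_mulVec_zero_iff (Pi.single j 1)).1 (h _)
    simpa using congrFun this i
  rw [← sub_eq_zero]
  refine h _ ?_ fun v => ?_
  · refine IsHermitian.sub ?_ isHermitian_one
    rw [IsHermitian, conjTranspose_sum]
    simp [conjTranspose_mul]
  · rw [sub_mulVec, dotProduct_sub, one_mulVec, ← ofReal_sum_sqNorm_mulVec, hA, ofReal_sqNorm,
      sub_self]

/-- A family of Kraus operators of a trace-non-increasing map has a defect operator. -/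
theorem Contractive.exists_defect [DecidableEq n] {A : ι → Matrix m n ℂ} (hA : Contractive A) :
    ∃ B : Matrix n n ℂ, ∀ v, ∑ i, sqNorm (A i *ᵥ v) + sqNorm (B *ᵥ v) = sqNorm v := by
  have hp : (1 - ∑ i, (A i)ᴴ * A i).PosSemidef := by
    refine .of_dotProduct_mulVec_nonneg ?_ fun v => ?_
    · refine IsHermitian.sub isHermitian_one ?_
      rw [IsHermitian, conjTranspose_sum]
      simp [conjTranspose_mul]
    · rw [sub_mulVec, dotProduct_sub, one_mulVec, ← ofReal_sum_sqNorm_mulVec, ← ofReal_sqNorm,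
        ← Complex.ofReal_sub]
      exact_mod_cast sub_nonneg.2 (hA v)
  -- `B` is a factor of the positive operator `1 - ∑ i, (A i)ᴴ * A i`.
  open scoped MatrixOrder in
  obtain ⟨B, hB⟩ := CStarAlgebra.nonneg_iff_eq_star_mul_self.mp hp.nonneg
  refine ⟨B, fun v => Complex.ofReal_injective ?_⟩
  rw [Complex.ofReal_add, ofReal_sum_sqNorm_mulVec, ofReal_sqNorm_mulVec, ← star_eq_conjTranspose B,
    ← hB, ← dotProduct_add, ← add_mulVec, add_sub_cancel, one_mulVec, ofReal_sqNorm]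

/-- A trace-non-increasing map is completed to a channel by operators with a prescribed range. -/
theorem Contractive.exists_completion [DecidableEq m] [DecidableEq n] {A : ι → Matrix m n ℂ}
    (hA : Contractive A) (z : m) :
    ∃ R : n → Matrix m n ℂ, (∑ i, (A i)ᴴ * A i + ∑ k, (R k)ᴴ * R k = 1) ∧
      ∀ k i, i ≠ z → R k i = 0 := by
  obtain ⟨B, hB⟩ := hA.exists_defect
  -- The `k`-th added operator writes the `k`-th coordinate of `B v` onto the basis vector `z`, so
  -- the added squared norms sum to that of `B v`.
  refine ⟨fun k => Matrix.of fun i x => if i = z then B k x else 0, ?_, fun k i hi => ?_⟩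
  · have h := complete_of_sum_sqNorm (A := Sum.elim A fun k => Matrix.of fun i x =>
      if i = z then B k x else 0) fun v => by
      rw [Fintype.sum_sum_type, ← hB v]
      congr 1
      simp only [Sum.elim_inr]
      refine Finset.sum_congr rfl fun k _ => ?_
      rw [sqNorm, Finset.sum_eq_single z]
      · simp [mulVec, dotProduct]
      · intro i _ hi
        simp [mulVec, dotProduct, hi]
      · simp
    rw [Fintype.sum_sum_type] at h
    simpa using h
  · funext x
    simp [hi]

theorem Contractive.single {A : ι → Matrix m n ℂ} (hA : Contractive A) (i : ι) (v : n → ℂ) :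
    sqNorm (A i *ᵥ v) ≤ sqNorm v :=
  (Finset.single_le_sum (f := fun i => sqNorm (A i *ᵥ v)) (fun _ _ => sqNorm_nonneg _)
    (Finset.mem_univ i)).trans (hA v)

/-- Sequential composition, the second map depending on the outcome of the first one. -/
theorem Contractive.comp {A : ι → Matrix m n ℂ} {B : ι → κ → Matrix l m ℂ}
    (hB : ∀ i, Contractive (B i)) (hA : Contractive A) :
    Contractive fun z : ι × κ => B z.1 z.2 * A z.1 := by
  intro v
  rw [Fintype.sum_prod_type]
  refine (Finset.sum_le_sum fun i _ => ?_).trans (hA v)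
  simpa [mulVec_mulVec] using hB i (A i *ᵥ v)

theorem kron_one_mulVec [DecidableEq t] (A : Matrix m n ℂ) (v : n × t → ℂ) (i : m) (s : t) :
    (Matrix.kroneckerMap (· * ·) A (1 : Matrix t t ℂ) *ᵥ v) (i, s)
      = (A *ᵥ fun j => v (j, s)) i := by
  simp [mulVec, dotProduct, Fintype.sum_prod_type, Matrix.one_apply]

theorem one_kron_mulVec [DecidableEq t] (A : Matrix m n ℂ) (v : t × n → ℂ) (s : t) (i : m) :
    (Matrix.kroneckerMap (· * ·) (1 : Matrix t t ℂ) A *ᵥ v) (s, i)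
      = (A *ᵥ fun j => v (s, j)) i := by
  simp [mulVec, dotProduct, Fintype.sum_prod_type, Matrix.one_apply, Finset.sum_ite_eq]

theorem sqNorm_kron_one [DecidableEq t] (A : Matrix m n ℂ) (v : n × t → ℂ) :
    sqNorm (Matrix.kroneckerMap (· * ·) A (1 : Matrix t t ℂ) *ᵥ v)
      = ∑ s, sqNorm (A *ᵥ fun j => v (j, s)) := by
  rw [sqNorm_prod_right]
  simp only [kron_one_mulVec]

theorem sqNorm_one_kron [DecidableEq t] (A : Matrix m n ℂ) (v : t × n → ℂ) :
    sqNorm (Matrix.kroneckerMap (· * ·) (1 : Matrix t t ℂ) A *ᵥ v)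
      = ∑ s, sqNorm (A *ᵥ fun j => v (s, j)) := by
  rw [sqNorm_prod]
  simp only [one_kron_mulVec]

theorem Contractive.kron_one [DecidableEq t] {A : ι → Matrix m n ℂ} (hA : Contractive A) :
    Contractive fun i => Matrix.kroneckerMap (· * ·) (A i) (1 : Matrix t t ℂ) := by
  intro v
  simp only [sqNorm_kron_one]
  rw [Finset.sum_comm, sqNorm_prod_right v]
  exact Finset.sum_le_sum fun s _ => hA _

theorem Contractive.one_kron [DecidableEq t] {A : ι → Matrix m n ℂ} (hA : Contractive A) :
    Contractive fun i => Matrix.kroneckerMap (· * ·) (1 : Matrix t t ℂ) (A i) := by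
  intro v
  simp only [sqNorm_one_kron]
  rw [Finset.sum_comm, sqNorm_prod v]
  exact Finset.sum_le_sum fun s _ => hA _

theorem kron_eq_left_mul {p q : Type} [Fintype p] [Fintype q] [DecidableEq m] [DecidableEq q]
    (A : Matrix m n ℂ) (B : Matrix p q ℂ) :
    Matrix.kroneckerMap (· * ·) A B
      = Matrix.kroneckerMap (· * ·) (1 : Matrix m m ℂ) B *
        Matrix.kroneckerMap (· * ·) A (1 : Matrix q q ℂ) := by
  have := Matrix.mul_kronecker_mul (1 : Matrix m m ℂ) A B (1 : Matrix q q ℂ)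
  simpa using this

theorem kron_eq_right_mul {p q : Type} [Fintype p] [Fintype q] [DecidableEq n] [DecidableEq p]
    (A : Matrix m n ℂ) (B : Matrix p q ℂ) :
    Matrix.kroneckerMap (· * ·) A B
      = Matrix.kroneckerMap (· * ·) A (1 : Matrix p p ℂ) *
        Matrix.kroneckerMap (· * ·) (1 : Matrix n n ℂ) B := by
  have := Matrix.mul_kronecker_mul A (1 : Matrix n n ℂ) (1 : Matrix p p ℂ) B
  simpa using this

theorem kron_mul {l' m' n' : Type} [Fintype m'] (A : Matrix l m ℂ) (B : Matrix m n ℂ)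
    (A' : Matrix l' m' ℂ) (B' : Matrix m' n' ℂ) :
    Matrix.kroneckerMap (· * ·) (A * B) (A' * B')
      = Matrix.kroneckerMap (· * ·) A A' * Matrix.kroneckerMap (· * ·) B B' :=
  Matrix.mul_kronecker_mul A B A' B'

theorem Contractive.kron {p q : Type} [Fintype p] [Fintype q] {A : ι → Matrix m n ℂ}
    {B : κ → Matrix p q ℂ} (hA : Contractive A) (hB : Contractive B) :
    Contractive fun z : ι × κ => Matrix.kroneckerMap (· * ·) (A z.1) (B z.2) := by
  classical
  have := Contractive.comp (B := fun (_ : ι) (k : κ) =>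
    Matrix.kroneckerMap (· * ·) (1 : Matrix m m ℂ) (B k)) (fun _ => hB.one_kron)
    (hA.kron_one (t := q))
  simpa only [← kron_eq_left_mul] using this

/-- The union bound for local operations on two systems. -/
theorem Contractive.union_bound {p q : Type} [Fintype p] [Fintype q] [DecidableEq n]
    [DecidableEq q] {A : ι → Matrix m n ℂ} {B : κ → Matrix p q ℂ} (hA : Contractive A)
    (hB : Contractive B) (v : n × q → ℂ) :
    ∑ i, sqNorm (Matrix.kroneckerMap (· * ·) (A i) (1 : Matrix q q ℂ) *ᵥ v)
      + ∑ k, sqNorm (Matrix.kroneckerMap (· * ·) (1 : Matrix n n ℂ) (B k) *ᵥ v) - sqNorm v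
      ≤ ∑ i, ∑ k, sqNorm (Matrix.kroneckerMap (· * ·) (A i) (B k) *ᵥ v) := by
  classical
  -- `C` is the failure branch of `A`. The weight of success of `B` splits into success with `A` and
  -- success with `C`, and the latter is at most the weight of `C`.
  obtain ⟨C, hC⟩ := hA.exists_defect
  have key : ∀ {t : Type} [Fintype t] [DecidableEq t] (u : n × t → ℂ),
      ∑ i, sqNorm (Matrix.kroneckerMap (· * ·) (A i) (1 : Matrix t t ℂ) *ᵥ u)
        + sqNorm (Matrix.kroneckerMap (· * ·) C (1 : Matrix t t ℂ) *ᵥ u) = sqNorm u := by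
    intro t _ _ u
    simp only [sqNorm_kron_one]
    rw [Finset.sum_comm, ← Finset.sum_add_distrib, sqNorm_prod_right u]
    exact Finset.sum_congr rfl fun s _ => hC _
  have h1 := key v
  have h2 : ∑ k, sqNorm (Matrix.kroneckerMap (· * ·) (1 : Matrix n n ℂ) (B k) *ᵥ v)
      = ∑ i, ∑ k, sqNorm (Matrix.kroneckerMap (· * ·) (A i) (B k) *ᵥ v)
        + ∑ k, sqNorm (Matrix.kroneckerMap (· * ·) C (B k) *ᵥ v) := by
    rw [Finset.sum_comm, ← Finset.sum_add_distrib]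
    refine Finset.sum_congr rfl fun k _ => ?_
    rw [← key (Matrix.kroneckerMap (· * ·) (1 : Matrix n n ℂ) (B k) *ᵥ v)]
    simp only [mulVec_mulVec, ← kron_eq_right_mul]
  have h3 : ∑ k, sqNorm (Matrix.kroneckerMap (· * ·) C (B k) *ᵥ v)
      ≤ sqNorm (Matrix.kroneckerMap (· * ·) C (1 : Matrix q q ℂ) *ᵥ v) := by
    have := hB.one_kron (t := n) (Matrix.kroneckerMap (· * ·) C (1 : Matrix q q ℂ) *ᵥ v)
    simpa only [mulVec_mulVec, ← kron_eq_left_mul] using this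
  linarith

end Kraus

/-! ## Interaction operators -/

section Interact

variable {S Msg : Type} [Fintype S] [DecidableEq S] [Fintype Msg] [DecidableEq Msg]

theorem respond_mulVec (U : Matrix (S × Msg) (S × Msg) ℂ) (m a : Msg) (v : S → ℂ) (s : S) :
    (respond U m a *ᵥ v) s = (U *ᵥ fun z => if z.2 = m then v z.1 else 0) (s, a) := by
  simp [mulVec, dotProduct, Fintype.sum_prod_type, respond]

theorem sum_sqNorm_respond (U : Matrix.unitaryGroup (S × Msg) ℂ) (m : Msg) (v : S → ℂ) :
    ∑ a, sqNorm (respond (U : Matrix (S × Msg) (S × Msg) ℂ) m a *ᵥ v) = sqNorm v := by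
  have h : sqNorm (fun z : S × Msg => if z.2 = m then v z.1 else 0) = sqNorm v := by
    rw [sqNorm_prod_right, Finset.sum_eq_single m]
    · simp
    · intro b _ hb
      simp [hb, sqNorm]
    · simp
  rw [← h, ← sqNorm_unitary U, sqNorm_prod_right]
  exact Finset.sum_congr rfl fun a _ => congrArg sqNorm (funext fun s => respond_mulVec _ _ _ _ _)

/-- By induction on the rounds: each of them adjoins a basis state, applies a unitary and measures
the network register, so the weights of the outcomes add up to the incoming weight. -/
theorem sum_sqNorm_interact (ask : List Msg → Msg) (U : ℕ → Matrix.unitaryGroup (S × Msg) ℂ)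
    (k : ℕ) (h : List Msg) (v : S → ℂ) :
    ∑ a : Fin k → Msg, sqNorm (interact ask (fun i => (U i : Matrix (S × Msg) (S × Msg) ℂ)) h
      (List.ofFn a) *ᵥ v) = sqNorm v := by
  induction k generalizing h v with
  | zero => simp [interact]
  | succ k ih =>
    rw [← (Fin.consEquiv fun _ : Fin (k + 1) => Msg).sum_comp, Fintype.sum_prod_type,
      ← sum_sqNorm_respond (U h.length) (ask h) v]
    refine Finset.sum_congr rfl fun b _ => ?_
    rw [← ih (h ++ [b])]
    refine Finset.sum_congr rfl fun a _ => ?_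
    rw [show (Fin.consEquiv fun _ : Fin (k + 1) => Msg) (b, a) = Fin.cons b a from rfl,
      List.ofFn_cons, interact, mulVec_mulVec]

/-- The verifier is consulted only on proper prefixes of the transcript and the prover only in the
rounds that take place. Histories of equal length may be exchanged; this is what turns a run inside
the repeated protocol into a run on its own. -/
theorem interact_congr {ask ask' : List Msg → Msg} {U U' : ℕ → Matrix (S × Msg) (S × Msg) ℂ}
    {h h' : List Msg} (hl : h.length = h'.length) (l : List Msg)
    (ha : ∀ g, g.length < l.length → ask (h ++ g) = ask' (h' ++ g))
    (hU : ∀ i < l.length, U (h.length + i) = U' (h.length + i)) :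
    interact ask U h l = interact ask' U' h' l := by
  induction l generalizing h h' with
  | nil => rfl
  | cons a l ih =>
    rw [interact, interact, ← hl]
    have h0 : ask h = ask' h' := by simpa using ha [] (by simp)
    have h1 : U h.length = U' h.length := hU 0 (by simp)
    rw [h0, h1]
    congr 1
    refine ih (by simp [hl]) (fun g hg => ?_) (fun i hi => ?_)
    · simpa using ha (a :: g) (by simpa using hg)
    · have := hU (i + 1) (by simpa using hi)
      simpa [add_assoc, add_comm 1 i] using this

theorem interact_append (ask : List Msg → Msg) (U : ℕ → Matrix (S × Msg) (S × Msg) ℂ)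
    (h l l' : List Msg) :
    interact ask U h (l ++ l') = interact ask U (h ++ l) l' * interact ask U h l := by
  induction l generalizing h with
  | nil => simp [interact]
  | cons a l ih => simp [interact, ih, Matrix.mul_assoc]

theorem interact_shift (ask : List Msg → Msg) (U : ℕ → Matrix (S × Msg) (S × Msg) ℂ)
    (h g l : List Msg) :
    interact ask U (h ++ g) l
      = interact (fun g => ask (h ++ g)) (fun i => U (h.length + i)) g l := by
  induction l generalizing g with
  | nil => rfl
  | cons a l ih => simp [interact, ← ih]

theorem transcript_congr {ask ask' : List Msg → Msg} (h l : List Msg)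
    (ha : ∀ g, g.length < h.length + l.length → ask g = ask' g) :
    transcript ask h l = transcript ask' h l := by
  induction l generalizing h with
  | nil => rfl
  | cons a l ih =>
    rw [transcript, transcript, ha h (by simp)]
    congr 1
    exact ih _ fun g hg => ha g (by simpa [add_assoc, add_comm 1] using hg)

end Interact

/-! ### Norm bounds for agree phase, prove phase, verification and extraction -/

namespace Protocol

variable {M : Scenario} (K : Protocol M)

theorem sqNorm_indicator_mulVec_le {S : Type} [Fintype S] [DecidableEq S] (p : S → Prop)
    [DecidablePred p] (v : S → ℂ) :
    sqNorm (Matrix.diagonal (fun s => if p s then (1 : ℂ) else 0) *ᵥ v) ≤ sqNorm v := by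
  refine Finset.sum_le_sum fun s _ => ?_
  rw [mulVec_diagonal]
  split_ifs <;> simp [Complex.normSq_nonneg]

theorem agreeOp_contractive (P : Prover M K.Msg) (D : M.View) (c : K.Coins) (x : M.Id) (k : ℕ) :
    Contractive fun a : Fin k → K.Msg => K.agreeOp P D c x (List.ofFn a) := by
  intro v
  rw [← sum_sqNorm_interact (K.ask D c) (P.agree D.pub) k [] v]
  refine Finset.sum_le_sum fun a _ => ?_
  dsimp only [agreeOp]
  rw [← mulVec_mulVec]
  exact sqNorm_indicator_mulVec_le _ _

theorem proveOp_contractive (P : Prover M K.Msg) (D : M.View) (c : K.Coins) (x : M.Id)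
    (a : List K.Msg) (k : ℕ) :
    Contractive fun b : Fin k → K.Msg => K.proveOp P D c x a (List.ofFn b) :=
  fun v => (sum_sqNorm_interact _ (P.prove D.pub x) k [] v).le

/-- This is used to replace the database by a representative with the same public view, whose
verifier can be simulated from public data. -/
theorem agreeOp_congr (P : Prover M K.Msg) {D D' : M.View} (hD : D.pub = D'.pub) (c : K.Coins)
    (x : M.Id) (a : List K.Msg) (h : ∀ g, g.length < a.length → K.ask D c g = K.ask D' c g) :
    K.agreeOp P D c x a = K.agreeOp P D' c x a := by
  rw [agreeOp, agreeOp, hD]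
  congr 1
  exact interact_congr rfl a (fun g hg => by simpa using h g hg) fun _ _ => rfl

end Protocol

theorem Scenario.sqNorm_acc_le (M : Scenario) (x : M.Id) (D : M.View) (w : M.Bill → ℂ) :
    sqNorm (M.acc x D *ᵥ w) ≤ sqNorm w := by
  rw [← sqNorm_of_isometry (M.ver_isometry x D) w, sqNorm_prod]
  have : M.acc x D *ᵥ w = fun g => (M.ver x D *ᵥ w) (true, g) := by
    funext g
    simp [mulVec, dotProduct, Scenario.acc]
  rw [this]
  exact Finset.single_le_sum (f := fun b => sqNorm fun g => (M.ver x D *ᵥ w) (b, g))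
    (fun _ _ => sqNorm_nonneg _) (Finset.mem_univ true)

namespace OracleMachine

variable {Msg : Type} [Fintype Msg] [DecidableEq Msg] {R : ℕ}
  {Wit : Type} [Fintype Wit] [DecidableEq Wit] (E : OracleMachine Msg R Wit)
  {S : Type} [Fintype S] [DecidableEq S]

theorem sqNorm_callOp_mulVec (U : ℕ → Matrix.unitaryGroup (S × Msg) ℂ)
    (v : (Wit × E.Anc) × (S × Msg) → ℂ) : sqNorm (E.callOp U *ᵥ v) = sqNorm v := by
  rw [sqNorm_prod, sqNorm_prod v]
  refine Finset.sum_congr rfl fun w _ => ?_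
  obtain ⟨V, hV⟩ : ∃ V : Matrix.unitaryGroup (S × Msg) ℂ, (V : Matrix (S × Msg) (S × Msg) ℂ) =
      match E.query w with
        | none => (1 : Matrix (S × Msg) (S × Msg) ℂ)
        | some (i, true) => (U i : Matrix (S × Msg) (S × Msg) ℂ)
        | some (i, false) => (U i : Matrix (S × Msg) (S × Msg) ℂ)ᴴ := by
    rcases E.query w with _ | ⟨i, _ | _⟩
    · exact ⟨1, rfl⟩
    · exact ⟨star (U i), rfl⟩
    · exact ⟨U i, rfl⟩
  rw [← sqNorm_unitary V fun z => v (w, z), hV]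
  congr 1
  funext z
  simp only [mulVec, dotProduct, callOp, Matrix.of_apply, ite_mul, zero_mul]
  rw [Fintype.sum_prod_type, Finset.sum_eq_single w]
  · simp
  · intro b _ hb
    simp [hb.symm]
  · simp

theorem sqNorm_localOp_mulVec (V : Matrix.unitaryGroup ((Wit × E.Anc) × Msg) ℂ)
    (v : (Wit × E.Anc) × (S × Msg) → ℂ) : sqNorm (E.localOp V *ᵥ v) = sqNorm v := by
  have hs : ∀ u : (Wit × E.Anc) × (S × Msg) → ℂ,
      sqNorm u = ∑ s, sqNorm fun z : (Wit × E.Anc) × Msg => u (z.1, (s, z.2)) := by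
    intro u
    let e : S × ((Wit × E.Anc) × Msg) ≃ (Wit × E.Anc) × (S × Msg) :=
      { toFun := fun z => (z.2.1, (z.1, z.2.2))
        invFun := fun z => (z.2.1, (z.1, z.2.2))
        left_inv := fun _ => rfl
        right_inv := fun _ => rfl }
    rw [sqNorm, ← e.sum_comp, Fintype.sum_prod_type]
    rfl
  rw [hs, hs v]
  refine Finset.sum_congr rfl fun s _ => ?_
  rw [← sqNorm_unitary V fun z => v (z.1, (s, z.2))]
  congr 1
  funext z
  simp only [mulVec, dotProduct, localOp, Matrix.of_apply, ite_mul, zero_mul]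
  conv_lhs => rw [Fintype.sum_prod_type]
  conv_rhs => rw [Fintype.sum_prod_type]
  refine Finset.sum_congr rfl fun _ _ => ?_
  rw [Fintype.sum_prod_type, Finset.sum_eq_single s]
  · simp
  · intro b _ hb
    simp [hb.symm]
  · simp

theorem sqNorm_totalOp_mulVec (U : ℕ → Matrix.unitaryGroup (S × Msg) ℂ)
    (v : (Wit × E.Anc) × (S × Msg) → ℂ) : sqNorm (E.totalOp U *ᵥ v) = sqNorm v := by
  have : ∀ (L : List (Matrix.unitaryGroup ((Wit × E.Anc) × Msg) ℂ))
      (A : Matrix ((Wit × E.Anc) × (S × Msg)) ((Wit × E.Anc) × (S × Msg)) ℂ),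
      sqNorm (L.foldl (fun A V => E.callOp U * E.localOp V * A) A *ᵥ v) = sqNorm (A *ᵥ v) := by
    intro L
    induction L with
    | nil => intro A; rfl
    | cons V L ih =>
      intro A
      rw [List.foldl_cons, ih, ← mulVec_mulVec, ← mulVec_mulVec, sqNorm_callOp_mulVec,
        sqNorm_localOp_mulVec]
  rw [totalOp, this, one_mulVec]

/-- The Kraus operators are the blocks of the norm-preserving `totalOp` on inputs with fresh private
and network registers, so that the bound is in fact an equality. -/
theorem kraus_contractive [Inhabited Msg] (U : ℕ → Matrix.unitaryGroup (S × Msg) ℂ) :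
    Contractive (E.kraus U) := by
  intro v
  let u : (Wit × E.Anc) × (S × Msg) → ℂ :=
    fun z => if z.1 = E.start ∧ z.2.2 = default then v z.2.1 else 0
  have hu : sqNorm u = sqNorm v := by
    rw [sqNorm_prod, Finset.sum_eq_single E.start, sqNorm_prod_right,
      Finset.sum_eq_single default]
    · simp [u]
    · intro b _ hb
      simp [u, hb, sqNorm]
    · simp
    · intro b _ hb
      simp [u, hb, sqNorm]
    · simp
  have hk : ∀ j w, (E.kraus U j *ᵥ v) w = (E.totalOp U *ᵥ u) ((w, j.1), (j.2.1, j.2.2)) := by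
    intro j w
    simp only [mulVec, dotProduct, kraus, Matrix.of_apply]
    rw [Fintype.sum_prod_type, Finset.sum_eq_single E.start, Fintype.sum_prod_type]
    · refine Finset.sum_congr rfl fun s _ => ?_
      rw [Finset.sum_eq_single default]
      · simp [u]
      · intro b _ hb
        simp [u, hb]
      · simp
    · intro b _ hb
      simp [u, hb]
    · simp
  rw [← hu, ← sqNorm_totalOp_mulVec E U u]
  refine le_of_eq ?_
  simp only [sqNorm, hk]
  simp only [Fintype.sum_prod_type]
  simp only [Finset.sum_comm (s := (Finset.univ : Finset Wit))]

end OracleMachine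

theorem extract_contractive {M : Scenario} {Msg : Type} [Fintype Msg] [DecidableEq Msg]
    [Inhabited Msg] {R : ℕ} (F : OracleMachine Msg R M.Bill) {S : Type} [Fintype S]
    [DecidableEq S] (U : ℕ → Matrix.unitaryGroup (S × Msg) ℂ) (x : M.Id) (D : M.View) :
    Contractive fun i => M.acc x D * F.kraus U i := by
  intro v
  refine (Finset.sum_le_sum fun i _ => ?_).trans (F.kraus_contractive U v)
  rw [← mulVec_mulVec]
  exact M.sqNorm_acc_le x D _

/-! ## Extraction from trace-non-increasing preparations -/

section Flag

variable {S Msg X : Type} [Fintype S] [DecidableEq S] [Fintype Msg] [DecidableEq Msg] [Fintype X]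

/-- The unitary `U`, acting trivially on an additional flag. -/
def flagged (U : Matrix.unitaryGroup (S × Msg) ℂ) : Matrix.unitaryGroup ((S × Bool) × Msg) ℂ :=
  relabel
    { toFun := fun z => ((z.1.1, z.2), z.1.2)
      invFun := fun z => ((z.1.1, z.2), z.1.2)
      left_inv := fun _ => rfl
      right_inv := fun _ => rfl }
    (controlled fun _ : Bool => U)

theorem flagged_apply (U : Matrix.unitaryGroup (S × Msg) ℂ) (z z' : (S × Bool) × Msg) :
    (flagged U : Matrix ((S × Bool) × Msg) ((S × Bool) × Msg) ℂ) z z'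
      = if z.1.2 = z'.1.2 then (U : Matrix (S × Msg) (S × Msg) ℂ) (z.1.1, z.2) (z'.1.1, z'.2)
        else 0 := by
  simp [flagged, relabel, controlled, blockDiagonal_apply]

theorem respond_flagged (U : Matrix.unitaryGroup (S × Msg) ℂ) (m a : Msg) :
    respond (flagged U : Matrix ((S × Bool) × Msg) ((S × Bool) × Msg) ℂ) m a
      = Matrix.kroneckerMap (· * ·) (respond (U : Matrix (S × Msg) (S × Msg) ℂ) m a)
          (1 : Matrix Bool Bool ℂ) := by
  ext z z'
  simp [respond, flagged_apply, Matrix.one_apply]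

theorem interact_flagged (ask : List Msg → Msg) (U : ℕ → Matrix.unitaryGroup (S × Msg) ℂ)
    (h l : List Msg) :
    interact ask
        (fun i => (flagged (U i) : Matrix ((S × Bool) × Msg) ((S × Bool) × Msg) ℂ)) h l
      = Matrix.kroneckerMap (· * ·)
          (interact ask (fun i => (U i : Matrix (S × Msg) (S × Msg) ℂ)) h l)
          (1 : Matrix Bool Bool ℂ) := by
  induction l generalizing h with
  | nil => simp [interact]
  | cons a l ih =>
    rw [interact, interact, ih, respond_flagged, ← kron_mul, Matrix.mul_one]

/-- Prepare a state together with a raised flag. -/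
def raise (N : Matrix S X ℂ) : Matrix (S × Bool) X ℂ :=
  Matrix.of fun z x => if z.2 = true then N z.1 x else 0

theorem sqNorm_raise_mulVec (N : Matrix S X ℂ) (v : X → ℂ) :
    sqNorm (raise N *ᵥ v) = sqNorm (N *ᵥ v) := by
  rw [sqNorm_prod_right]
  simp [raise, mulVec, dotProduct, sqNorm]

theorem kron_mul_raise {T : Type} (A : Matrix T S ℂ) (g : Bool → ℂ) (hg : g true = 1)
    (N : Matrix S X ℂ) :
    Matrix.kroneckerMap (· * ·) A (Matrix.diagonal g) * raise N = raise (A * N) := by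
  ext z x
  rcases z with ⟨s, _ | _⟩ <;>
    simp [Matrix.mul_apply, raise, Fintype.sum_prod_type, Matrix.diagonal_apply, hg]

theorem kron_one_mul_raise {T : Type} (A : Matrix T S ℂ) (N : Matrix S X ℂ) :
    Matrix.kroneckerMap (· * ·) A (1 : Matrix Bool Bool ℂ) * raise N = raise (A * N) := by
  rw [← diagonal_one]
  exact kron_mul_raise A _ rfl N

namespace OracleMachine

variable {R : ℕ} {Wit : Type} [Fintype Wit] [DecidableEq Wit] (E : OracleMachine Msg R Wit)

/-- Oracle calls and local unitaries are tensored with the identity of the flag, hence so is the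
whole computation: with black-box access the extractor cannot notice the flag. -/
theorem totalOp_flagged (U : ℕ → Matrix.unitaryGroup (S × Msg) ℂ)
    (z z' : (Wit × E.Anc) × ((S × Bool) × Msg)) :
    E.totalOp (fun i => flagged (U i)) z z'
      = if z.2.1.2 = z'.2.1.2 then E.totalOp U (z.1, (z.2.1.1, z.2.2)) (z'.1, (z'.2.1.1, z'.2.2))
        else 0 := by
  let e : (Wit × E.Anc) × ((S × Bool) × Msg) ≃ ((Wit × E.Anc) × (S × Msg)) × Bool :=
    { toFun := fun z => ((z.1, (z.2.1.1, z.2.2)), z.2.1.2)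
      invFun := fun z => (z.1.1, ((z.1.2.1, z.2), z.1.2.2))
      left_inv := fun _ => rfl
      right_inv := fun _ => rfl }
  let lift : Matrix ((Wit × E.Anc) × (S × Msg)) ((Wit × E.Anc) × (S × Msg)) ℂ →
      Matrix ((Wit × E.Anc) × ((S × Bool) × Msg)) ((Wit × E.Anc) × ((S × Bool) × Msg)) ℂ :=
    fun A => (Matrix.kroneckerMap (· * ·) A (1 : Matrix Bool Bool ℂ)).submatrix e e
  have hlift : ∀ A B, lift (A * B) = lift A * lift B := by
    intro A B
    simp only [lift]
    rw [submatrix_mul_equiv, ← kron_mul, Matrix.mul_one]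
  have hc : E.callOp (fun i => flagged (U i)) = lift (E.callOp U) := by
    ext z z'
    simp only [callOp, lift, Matrix.of_apply, submatrix_apply, kroneckerMap_apply, e,
      Equiv.coe_fn_mk, Matrix.one_apply]
    rcases E.query z.1 with _ | ⟨i, _ | _⟩
    · by_cases h : z.1 = z'.1 <;> by_cases h' : z.2.1.2 = z'.2.1.2 <;>
        simp [h, h', Matrix.one_apply, Prod.ext_iff]
    · by_cases h : z.1 = z'.1 <;> by_cases h' : z.2.1.2 = z'.2.1.2 <;>
        simp [h, h', flagged_apply, eq_comm]
    · by_cases h : z.1 = z'.1 <;> by_cases h' : z.2.1.2 = z'.2.1.2 <;>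
        simp [h, h', flagged_apply]
  have hl : ∀ V, E.localOp V = lift (E.localOp V) := by
    intro V
    ext z z'
    simp only [localOp, lift, Matrix.of_apply, submatrix_apply, kroneckerMap_apply, e,
      Equiv.coe_fn_mk, Matrix.one_apply]
    by_cases h : z.2.1.1 = z'.2.1.1 <;> by_cases h' : z.2.1.2 = z'.2.1.2 <;>
      simp [h, h', Prod.ext_iff]
  have h1 : lift 1 = 1 := by
    simp only [lift]
    rw [← submatrix_one_equiv e]
    congr 1
    exact Matrix.one_kronecker_one
  have key : ∀ (L : List (Matrix.unitaryGroup ((Wit × E.Anc) × Msg) ℂ)) A,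
      L.foldl (fun A V => E.callOp (fun i => flagged (U i)) * E.localOp V * A) (lift A)
        = lift (L.foldl (fun A V => E.callOp U * E.localOp V * A) A) := by
    intro L
    induction L with
    | nil => intro A; rfl
    | cons V L ih =>
      intro A
      rw [List.foldl_cons, List.foldl_cons, ← ih, hlift, hlift, ← hl, ← hc]
  have : E.totalOp (fun i => flagged (U i)) = lift (E.totalOp U) := by
    rw [totalOp, ← h1, key]
    rfl
  rw [this]
  simp [lift, e, Matrix.one_apply]

/-- The flag belongs to the registers discarded after extraction, so its value is part of the Kraus
index; on states with raised flag only the index `true` contributes. -/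
theorem kraus_flagged_mul_raise [Inhabited Msg] (U : ℕ → Matrix.unitaryGroup (S × Msg) ℂ)
    (j : E.Anc × (S × Bool) × Msg) (N : Matrix S X ℂ) :
    E.kraus (fun i => flagged (U i)) j * raise N
      = if j.2.1.2 = true then E.kraus U (j.1, j.2.1.1, j.2.2) * N else 0 := by
  ext w x
  rcases j with ⟨anc, ⟨s, _ | _⟩, m⟩ <;>
    simp [Matrix.mul_apply, raise, Fintype.sum_prod_type, kraus, totalOp_flagged]

end OracleMachine

end Flag

/-- The prover which behaves like `P` if its flag is raised, and outputs `⊥` otherwise. -/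
abbrev Prover.flag {M : Scenario} {Msg : Type} [Fintype Msg] [DecidableEq Msg] (P : Prover M Msg) :
    Prover M Msg where
  S := P.S × Bool
  agree p i := flagged (P.agree p i)
  out z := if z.2 = true then P.out z.1 else none
  prove p x i := flagged (P.prove p x i)

namespace Protocol

variable {M : Scenario} (K : Protocol M) {ι : Type} [Fintype ι]

open Classical in
/-- The weight of agreement on `x` when the prover's state is prepared by the operators `N`. -/
noncomputable def agreeWeight (P : Prover M K.Msg) (N : M.PubView → ι → Matrix P.S M.Supply ℂ)
    (x : M.Id) : ℝ :=
  avg fun r : M.Rand => avg fun c : K.Coins =>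
    ∑ a : Fin K.agreeRounds → K.Msg,
      if K.Agrees r c x (List.ofFn a) then
        ∑ j, sqNorm ((K.agreeOp P (M.bank r) c x (List.ofFn a) *
          N (Scenario.View.pub (M.bank r : M.View)) j) *ᵥ M.supply r)
      else 0

open Classical in
/-- The weight of agreement on `x` and acceptance when the prover's state is prepared by the
operators `N`. -/
noncomputable def successWeight (P : Prover M K.Msg)
    (N : M.PubView → ι → Matrix P.S M.Supply ℂ) (x : M.Id) : ℝ :=
  avg fun r : M.Rand => avg fun c : K.Coins =>
    ∑ a : Fin K.agreeRounds → K.Msg, ∑ b : Fin K.proveRounds → K.Msg,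
      if K.Agrees r c x (List.ofFn a) ∧
          K.verdict (M.bank r) c (List.ofFn a ++ List.ofFn b) = true then
        ∑ j, sqNorm ((K.proveOp P (M.bank r) c x (List.ofFn a) (List.ofFn b) *
          K.agreeOp P (M.bank r) c x (List.ofFn a) *
          N (Scenario.View.pub (M.bank r : M.View)) j) *ᵥ M.supply r)
      else 0

open Classical in
/-- The weight of agreement on `x` and successful extraction when the prover's state is prepared by
the operators `N`. -/
noncomputable def extractWeight (E : K.Extractor) (t : ℕ) (P : Prover M K.Msg)
    (N : M.PubView → ι → Matrix P.S M.Supply ℂ) (x : M.Id) : ℝ :=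
  avg fun r : M.Rand => avg fun c : K.Coins =>
    let p := Scenario.View.pub (M.bank r : M.View)
    ∑ a : Fin K.agreeRounds → K.Msg,
      if K.Agrees r c x (List.ofFn a) then
        let F := E t p x (transcript (K.ask (M.bank r) c) [] (List.ofFn a))
        ∑ j, ∑ i, sqNorm ((M.acc x (M.bank r) * F.kraus (P.prove p x) i *
          K.agreeOp P (M.bank r) c x (List.ofFn a) * N p j) *ᵥ M.supply r)
      else 0

/-- A lowered flag means output `⊥`, so agreement projects onto the raised flag. -/
theorem agreeOp_flag (P : Prover M K.Msg) (D : M.View) (c : K.Coins) (x : M.Id)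
    (a : List K.Msg) :
    K.agreeOp P.flag D c x a = Matrix.kroneckerMap (· * ·) (K.agreeOp P D c x a)
      (Matrix.diagonal fun f : Bool => if f = true then 1 else 0) := by
  have h : K.agreeOp P.flag D c x a =
      (Matrix.diagonal (fun z : P.S × Bool =>
        if (if z.2 = true then P.out z.1 else none) = some x then (1 : ℂ) else 0)) *
      Matrix.kroneckerMap (· * ·) (interact (K.ask D c)
        (fun i => (P.agree D.pub i : Matrix (P.S × K.Msg) (P.S × K.Msg) ℂ)) [] a)
        (1 : Matrix Bool Bool ℂ) := by
    rw [← interact_flagged]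
    rfl
  rw [h, agreeOp]
  ext ⟨s, f⟩ ⟨s', f'⟩
  rw [diagonal_mul, kroneckerMap_apply, kroneckerMap_apply, diagonal_mul]
  rcases f <;> rcases f' <;> simp

theorem proveOp_flag (P : Prover M K.Msg) (D : M.View) (c : K.Coins) (x : M.Id)
    (a b : List K.Msg) :
    K.proveOp P.flag D c x a b = Matrix.kroneckerMap (· * ·) (K.proveOp P D c x a b)
      (1 : Matrix Bool Bool ℂ) :=
  interact_flagged _ _ _ _

/-- Operators that complete a preparation to a channel end in a state with lowered flag; agreement
on an instance annihilates them. -/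
theorem kron_diagonal_mul_eq_zero {S X T : Type} [Fintype S] (A : Matrix T S ℂ)
    (R : Matrix (S × Bool) X ℂ) (s₀ : S) (hR : ∀ i, i ≠ (s₀, false) → R i = 0) :
    Matrix.kroneckerMap (· * ·) A (Matrix.diagonal fun f : Bool => if f = true then (1 : ℂ) else 0)
      * R = 0 := by
  have : ∀ s x, R (s, true) x = 0 := fun s x => congrFun (hR (s, true) (by simp)) x
  ext ⟨s, f⟩ x
  rcases f <;> simp [Matrix.mul_apply, Fintype.sum_prod_type, Matrix.diagonal_apply, this]

/-- The extraction property carries over to trace-non-increasing preparations. -/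
theorem Extracts.of_contractive {K : Protocol M} {E : K.Extractor} {κ : ℝ} {δ : ℝ → ℝ}
    (hE : K.Extracts E κ δ) (P : Prover M K.Msg) (N : M.PubView → ι → Matrix P.S M.Supply ℂ)
    (hN : ∀ p, Contractive (N p)) (x : M.Id) (h0 : 0 < K.agreeWeight P N x)
    (hs : κ < K.successWeight P N x / K.agreeWeight P N x) :
    ∃ t, 1 - δ (K.successWeight P N x / K.agreeWeight P N x) ≤
      K.extractWeight E t P N x / K.agreeWeight P N x := by
  classical
  -- The completing operators need a basis state to end in; positive weight of agreement provides
  -- one.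
  obtain ⟨s₀⟩ : Nonempty P.S := by
    by_contra h
    rw [not_nonempty_iff] at h
    apply h0.ne'
    simp [agreeWeight, sqNorm, avg]
  have hC : ∀ p, Contractive fun j => raise (N p j) := fun p v => by
    simpa only [sqNorm_raise_mulVec] using hN p v
  -- The raised preparation is completed to a channel by operators that end in `(s₀, false)`. They
  -- do not contribute to agreement, success or extraction, so the three probabilities for the
  -- flagged prover are the three weights for `N`.
  choose R hR hR0 using fun p => (hC p).exists_completion (s₀, false)
  let I : InputGen M P.flag.S :=
    { ι := ι ⊕ M.Supply
      kraus := fun p => Sum.elim (fun j => raise (N p j)) (R p)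
      complete := fun p => by
        rw [Fintype.sum_sum_type]
        exact hR p }
  have hz : ∀ p k D c a, K.agreeOp P.flag D c x a * R p k = 0 := fun p k D c a => by
    rw [agreeOp_flag]
    exact kron_diagonal_mul_eq_zero _ _ s₀ (hR0 p k)
  have hr : ∀ p j D c a, K.agreeOp P.flag D c x a * raise (N p j)
      = raise (K.agreeOp P D c x a * N p j) := fun p j D c a => by
    rw [agreeOp_flag]
    exact kron_mul_raise _ _ (by simp) _
  have hsum : ∀ (f : ι ⊕ M.Supply → ℝ), (∀ k, f (.inr k) = 0) →
      ∑ j, f j = ∑ j, f (.inl j) := fun f hf => by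
    rw [Fintype.sum_sum_type]
    simp [hf]
  have hA : K.agreeProb P.flag I x = K.agreeWeight P N x := by
    refine congrArg avg (funext fun r => congrArg avg (funext fun c =>
      Finset.sum_congr rfl fun a _ => if_congr Iff.rfl ?_ rfl))
    refine (hsum _ fun k => ?_).trans (Finset.sum_congr rfl fun j _ => ?_)
    · exact (congrArg (fun A : Matrix P.flag.S M.Supply ℂ => sqNorm (A *ᵥ M.supply r))
        (hz _ k _ _ _)).trans (by simp)
    · exact (congrArg (fun A : Matrix P.flag.S M.Supply ℂ => sqNorm (A *ᵥ M.supply r))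
        (hr _ j _ _ _)).trans (sqNorm_raise_mulVec _ _)
  have hS : K.successProb P.flag I x = K.successWeight P N x := by
    refine congrArg avg (funext fun r => congrArg avg (funext fun c =>
      Finset.sum_congr rfl fun a _ => Finset.sum_congr rfl fun b _ => if_congr Iff.rfl ?_ rfl))
    refine (hsum _ fun k => ?_).trans (Finset.sum_congr rfl fun j _ => ?_)
    · refine (congrArg (fun A : Matrix P.flag.S M.Supply ℂ => sqNorm (A *ᵥ M.supply r))
        (((Matrix.mul_assoc _ _ _).trans (congrArg _ (hz _ k _ _ _))).trans
          (Matrix.mul_zero _))).trans (by simp)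
    · refine (congrArg (fun A : Matrix P.flag.S M.Supply ℂ => sqNorm (A *ᵥ M.supply r))
        ((Matrix.mul_assoc _ _ _).trans (congrArg _ (hr _ j _ _ _)))).trans ?_
      rw [proveOp_flag, Matrix.mul_assoc]
      refine (congrArg (fun A : Matrix (P.S × Bool) M.Supply ℂ => sqNorm (A *ᵥ M.supply r))
        (kron_one_mul_raise _ _)).trans (sqNorm_raise_mulVec _ _)
  have hX : ∀ t, K.extractProb E t P.flag I x = K.extractWeight E t P N x := by
    intro t
    refine congrArg avg (funext fun r => congrArg avg (funext fun c =>
      Finset.sum_congr rfl fun a _ => if_congr Iff.rfl ?_ rfl))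
    refine (hsum _ fun k => ?_).trans (Finset.sum_congr rfl fun j _ => ?_)
    · refine Finset.sum_eq_zero fun i _ => ?_
      refine (congrArg (fun A : Matrix M.G M.Supply ℂ => sqNorm (A *ᵥ M.supply r))
        (((Matrix.mul_assoc _ _ _).trans (congrArg _ (hz _ k _ _ _))).trans
          (Matrix.mul_zero _))).trans (by simp)
    · set F := E t (Scenario.View.pub (M.bank r : M.View)) x
        (transcript (K.ask (M.bank r) c) [] (List.ofFn a))
      -- The extractor sees the same instance and transcript as with the unflagged prover; the two
      -- Kraus families differ only by the flag component of the index.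
      have : ∀ i : F.Anc × (P.S × Bool) × K.Msg,
          sqNorm ((M.acc x (M.bank r) *
            F.kraus (P.flag.prove (Scenario.View.pub (M.bank r : M.View)) x) i *
            K.agreeOp P.flag (M.bank r) c x (List.ofFn a) *
            raise (N (Scenario.View.pub (M.bank r : M.View)) j)) *ᵥ M.supply r)
          = if i.2.1.2 = true then sqNorm ((M.acc x (M.bank r) *
            F.kraus (P.prove (Scenario.View.pub (M.bank r : M.View)) x) (i.1, i.2.1.1, i.2.2) *
            K.agreeOp P (M.bank r) c x (List.ofFn a) *
            N (Scenario.View.pub (M.bank r : M.View)) j) *ᵥ M.supply r) else 0 := by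
        intro i
        refine (congrArg (fun A : Matrix M.G M.Supply ℂ => sqNorm (A *ᵥ M.supply r))
          ((Matrix.mul_assoc _ _ _).trans (congrArg _ (hr _ j _ _ _)))).trans ?_
        refine (congrArg (fun A : Matrix M.G M.Supply ℂ => sqNorm (A *ᵥ M.supply r))
          ((Matrix.mul_assoc _ _ _).trans (congrArg _
            (F.kraus_flagged_mul_raise _ i _)))).trans ?_
        split_ifs <;> simp [Matrix.mul_assoc]
      refine (Finset.sum_congr rfl fun i _ => this i).trans ?_
      simp only [Fintype.sum_prod_type]
      simp
  have := hE P.flag I x (by rwa [hA]) (by rwa [hA, hS])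
  simpa only [hA, hS, hX] using this

end Protocol

/-! ## Two provers on one instance -/

/-- A representative of the outcomes of the setup with a given public view. -/
noncomputable def Scenario.representative (M : Scenario) (p : M.PubView) : M.Rand :=
  open Classical in
  if h : ∃ r : M.Rand, Scenario.View.pub (M.bank r : M.View) = p then h.choose
  else Classical.arbitrary _

theorem Scenario.pub_representative (M : Scenario) (r : M.Rand) :
    Scenario.View.pub (M.bank (M.representative (Scenario.View.pub (M.bank r : M.View))) : M.View)
      = Scenario.View.pub (M.bank r : M.View) := by
  have h : ∃ r' : M.Rand, Scenario.View.pub (M.bank r' : M.View)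
    = Scenario.View.pub (M.bank r : M.View) := ⟨r, rfl⟩
  rw [Scenario.representative, dif_pos h]
  exact h.choose_spec

namespace Protocol

variable {M : Scenario} (K : Protocol M)

open Classical in
/-- The expectation of `φ`, evaluated on the subnormalised state of the prover after agreement
on `x`. -/
noncomputable def soloWeight {ι : Type} [Fintype ι] (P : Prover M K.Msg)
    (N : M.PubView → ι → Matrix P.S M.Supply ℂ) (x : M.Id)
    (φ : M.Rand → K.Coins → (Fin K.agreeRounds → K.Msg) → (P.S → ℂ) → ℝ) : ℝ :=
  avg fun r : M.Rand => avg fun c : K.Coins => ∑ a : Fin K.agreeRounds → K.Msg,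
    if K.Agrees r c x (List.ofFn a) then
      ∑ j, φ r c a ((K.agreeOp P (M.bank r) c x (List.ofFn a) *
        N (Scenario.View.pub (M.bank r : M.View)) j) *ᵥ M.supply r)
    else 0

open Classical in
/-- The expectation of `ψ`, evaluated on the subnormalised joint state of two provers after
agreement on `x` in both executions. -/
noncomputable def pairWeight (A B : Prover M K.Msg) (x : M.Id)
    (N : M.PubView → Matrix (A.S × B.S) M.Supply ℂ)
    (ψ : M.Rand → K.Coins → K.Coins → (Fin K.agreeRounds → K.Msg) → (Fin K.agreeRounds → K.Msg) →
      (A.S × B.S → ℂ) → ℝ) : ℝ :=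
  avg fun r : M.Rand => avg fun cA : K.Coins => avg fun cB : K.Coins =>
    ∑ a : Fin K.agreeRounds → K.Msg, ∑ a' : Fin K.agreeRounds → K.Msg,
      if K.Agrees r cA x (List.ofFn a) ∧ K.Agrees r cB x (List.ofFn a') then
        ψ r cA cB a a' ((Matrix.kroneckerMap (· * ·) (K.agreeOp A (M.bank r) cA x (List.ofFn a))
          (K.agreeOp B (M.bank r) cB x (List.ofFn a')) *
          N (Scenario.View.pub (M.bank r : M.View))) *ᵥ M.supply r)
      else 0

/-- The weights of agreement, success and extraction differ only in a quadratic functional of the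
state after the agree phase. Writing them all as `soloWeight` allows one proof of the absorption
step. -/
theorem agreeWeight_eq_soloWeight {ι : Type} [Fintype ι] (P : Prover M K.Msg)
    (N : M.PubView → ι → Matrix P.S M.Supply ℂ) (x : M.Id) :
    K.agreeWeight P N x = K.soloWeight P N x fun _ _ _ => sqNorm := rfl

theorem successWeight_eq_soloWeight {ι : Type} [Fintype ι] (P : Prover M K.Msg)
    (N : M.PubView → ι → Matrix P.S M.Supply ℂ) (x : M.Id) :
    K.successWeight P N x = K.soloWeight P N x fun r c a v => ∑ b : Fin K.proveRounds → K.Msg,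
      if K.verdict (M.bank r) c (List.ofFn a ++ List.ofFn b) = true then
        sqNorm (K.proveOp P (M.bank r) c x (List.ofFn a) (List.ofFn b) *ᵥ v) else 0 := by
  classical
  refine congrArg avg (funext fun r => congrArg avg (funext fun c =>
      Finset.sum_congr rfl fun a _ => ?_))
  by_cases h : K.Agrees r c x (List.ofFn a)
  · simp only [h, true_and, if_true]
    rw [Finset.sum_comm]
    refine Finset.sum_congr rfl fun b _ => ?_
    split_ifs <;> simp [mulVec_mulVec, Matrix.mul_assoc]
  · simp [h]

theorem extractWeight_eq_soloWeight {ι : Type} [Fintype ι] (E : K.Extractor) (t : ℕ)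
    (P : Prover M K.Msg) (N : M.PubView → ι → Matrix P.S M.Supply ℂ) (x : M.Id) :
    K.extractWeight E t P N x = K.soloWeight P N x fun r c a v =>
      ∑ i, sqNorm ((M.acc x (M.bank r) *
        (E t (Scenario.View.pub (M.bank r : M.View)) x
          (transcript (K.ask (M.bank r) c) [] (List.ofFn a))).kraus
          (P.prove (Scenario.View.pub (M.bank r : M.View)) x) i) *ᵥ v) := by
  classical
  refine congrArg avg (funext fun r => congrArg avg (funext fun c =>
      Finset.sum_congr rfl fun a _ => ?_))
  by_cases h : K.Agrees r c x (List.ofFn a)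
  · simp only [h, if_true]
    refine Finset.sum_congr rfl fun j _ => Finset.sum_congr rfl fun i _ => ?_
    rw [mulVec_mulVec, Matrix.mul_assoc, Matrix.mul_assoc]
  · simp [h]

theorem pairWeight_mono (A B : Prover M K.Msg) (x : M.Id)
    (N : M.PubView → Matrix (A.S × B.S) M.Supply ℂ)
    {ψ ψ' : M.Rand → K.Coins → K.Coins → (Fin K.agreeRounds → K.Msg) →
      (Fin K.agreeRounds → K.Msg) → (A.S × B.S → ℂ) → ℝ}
    (h : ∀ r cA cB a a' v, ψ r cA cB a a' v ≤ ψ' r cA cB a a' v) :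
    K.pairWeight A B x N ψ ≤ K.pairWeight A B x N ψ' := by
  refine avg_mono fun r => avg_mono fun cA => avg_mono fun cB => Finset.sum_le_sum fun a _ =>
    Finset.sum_le_sum fun a' _ => ?_
  split_ifs
  exacts [h _ _ _ _ _ _, le_rfl]

theorem pairWeight_add (A B : Prover M K.Msg) (x : M.Id)
    (N : M.PubView → Matrix (A.S × B.S) M.Supply ℂ)
    (ψ ψ' : M.Rand → K.Coins → K.Coins → (Fin K.agreeRounds → K.Msg) →
      (Fin K.agreeRounds → K.Msg) → (A.S × B.S → ℂ) → ℝ) :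
    K.pairWeight A B x N (fun r cA cB a a' v => ψ r cA cB a a' v + ψ' r cA cB a a' v)
      = K.pairWeight A B x N ψ + K.pairWeight A B x N ψ' := by
  simp only [pairWeight, ← avg_add, ← Finset.sum_add_distrib]
  refine congrArg avg (funext fun r => congrArg avg (funext fun cA => congrArg avg
    (funext fun cB => Finset.sum_congr rfl fun a _ => Finset.sum_congr rfl fun a' _ => ?_)))
  split_ifs
  exacts [rfl, (add_zero _).symm]

/-- The game is symmetric under exchange of the two provers, so only absorption of the second prover
has to be treated. -/
theorem pairWeight_swap (A B : Prover M K.Msg) (x : M.Id)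
    (N : M.PubView → Matrix (A.S × B.S) M.Supply ℂ)
    (ψ : M.Rand → K.Coins → K.Coins → (Fin K.agreeRounds → K.Msg) →
      (Fin K.agreeRounds → K.Msg) → (A.S × B.S → ℂ) → ℝ) :
    K.pairWeight B A x (fun p => (N p).submatrix Prod.swap id)
      (fun r cB cA a' a v => ψ r cA cB a a' (v ∘ Prod.swap)) = K.pairWeight A B x N ψ := by
  classical
  refine congrArg avg (funext fun r => ?_)
  rw [avg_comm]
  refine congrArg avg (funext fun cA => congrArg avg (funext fun cB => ?_))
  rw [Finset.sum_comm]
  refine Finset.sum_congr rfl fun a _ => Finset.sum_congr rfl fun a' _ => ?_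
  refine if_congr and_comm ?_ rfl
  dsimp only
  congr 1
  funext z
  obtain ⟨s, s'⟩ := z
  simp only [Function.comp, Prod.swap_prod_mk, ← mulVec_mulVec]
  simp only [mulVec, dotProduct, kroneckerMap_apply, submatrix_apply, id]
  rw [← (Equiv.prodComm A.S B.S).sum_comp]
  exact Finset.sum_congr rfl fun z _ => by
    simp only [Equiv.prodComm_apply, Prod.fst_swap, Prod.snd_swap, Prod.swap_swap]
    ring

/-- The input that results for the first prover if the input generator also plays the agree phase of
the second prover and its verifier, for the latter of which it uses the public view only, and
succeeds in agreeing on `x`. -/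
noncomputable def absorb (A B : Prover M K.Msg) (x : M.Id)
    (N : M.PubView → Matrix (A.S × B.S) M.Supply ℂ) (p : M.PubView)
    (z : K.Coins × (Fin K.agreeRounds → K.Msg) × B.S) : Matrix A.S M.Supply ℂ :=
  open Classical in
  -- One Kraus operator for each choice of coins, messages and final basis state of the second
  -- prover. The amplitude `1 / √(card Coins)` yields uniform coins; the other outcomes of the agree
  -- phase are dropped, so the family is only contractive.
  if K.inst (M.bank (M.representative p)) z.1 (List.ofFn z.2.1) = some x then
    (((√(Fintype.card K.Coins : ℝ))⁻¹ : ℝ) : ℂ) • Matrix.of fun s f =>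
      (Matrix.kroneckerMap (· * ·) (1 : Matrix A.S A.S ℂ)
        (K.agreeOp B (M.bank (M.representative p)) z.1 x (List.ofFn z.2.1)) * N p) (s, z.2.2) f
  else 0

theorem normSq_inv_sqrt_card :
    Complex.normSq (((√(Fintype.card K.Coins : ℝ))⁻¹ : ℝ) : ℂ)
      = (Fintype.card K.Coins : ℝ)⁻¹ := by
  rw [Complex.normSq_ofReal, ← mul_inv, Real.mul_self_sqrt (Nat.cast_nonneg _)]

theorem absorb_contractive (A B : Prover M K.Msg) (x : M.Id)
    (N : M.PubView → Matrix (A.S × B.S) M.Supply ℂ)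
    (hN : ∀ p v, sqNorm (N p *ᵥ v) ≤ sqNorm v) (p : M.PubView) :
    Contractive (K.absorb A B x N p) := by
  intro v
  refine le_trans ?_ (hN p v)
  rw [Fintype.sum_prod_type]
  refine le_trans (Finset.sum_le_sum (g := fun _ => (Fintype.card K.Coins : ℝ)⁻¹ *
    sqNorm (N p *ᵥ v)) fun c _ => ?_) ?_
  · refine le_trans ?_ (mul_le_mul_of_nonneg_left
      ((K.agreeOp_contractive B (M.bank (M.representative p)) c x K.agreeRounds).one_kron
        (t := A.S) (N p *ᵥ v)) (by positivity))
    rw [Fintype.sum_prod_type, Finset.mul_sum]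
    refine Finset.sum_le_sum fun a _ => ?_
    rw [sqNorm_prod_right, Finset.mul_sum]
    refine Finset.sum_le_sum fun s _ => ?_
    simp only [absorb]
    split_ifs
    · rw [smul_mulVec, sqNorm_smul, normSq_inv_sqrt_card, mulVec_mulVec]
      exact le_rfl
    · rw [zero_mulVec, sqNorm_zero]
      exact mul_nonneg (by positivity) (sqNorm_nonneg _)
  · simp

/-- The simulated verifier of the representative database coincides with the real one because the
agree phase is public. Homogeneity of `φ` accounts for the amplitude of the coins, and `hψ` says
that `ψ` is `φ` after discarding the second register in its standard basis. -/
theorem soloWeight_absorb (hpub : K.AgreePhasePublic) (A B : Prover M K.Msg) (x : M.Id)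
    (N : M.PubView → Matrix (A.S × B.S) M.Supply ℂ)
    (φ : M.Rand → K.Coins → (Fin K.agreeRounds → K.Msg) → (A.S → ℂ) → ℝ)
    (ψ : M.Rand → K.Coins → (Fin K.agreeRounds → K.Msg) → (A.S × B.S → ℂ) → ℝ)
    (hφ : ∀ r c a (k : ℂ) v, φ r c a (k • v) = Complex.normSq k * φ r c a v)
    (hψ : ∀ r c a v, ∑ s', φ r c a (fun s => v (s, s')) = ψ r c a v) :
    K.soloWeight A (K.absorb A B x N) x φ
      = K.pairWeight A B x N fun r cA _ a _ => ψ r cA a := by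
  classical
  refine congrArg avg (funext fun r => congrArg avg (funext fun cA => ?_))
  rw [avg_sum]
  refine Finset.sum_congr rfl fun a _ => ?_
  by_cases hA : K.Agrees r cA x (List.ofFn a)
  swap
  · simp [hA, avg]
  simp only [hA, true_and, if_true]
  rw [Fintype.sum_prod_type, avg_eq_sum]
  refine Finset.sum_congr rfl fun cB _ => ?_
  rw [Fintype.sum_prod_type, Finset.mul_sum]
  refine Finset.sum_congr rfl fun a' _ => ?_
  set p := Scenario.View.pub (M.bank r : M.View) with hp
  obtain ⟨hask, hinst⟩ := hpub (M.representative p) r (M.pub_representative r) cB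
  -- The input generator tests only the output of the simulated verifier; validity of `x` in the
  -- actual database is already known from the first execution.
  have hB : K.inst (M.bank (M.representative p)) cB (List.ofFn a') = some x
      ↔ K.Agrees r cB x (List.ofFn a') := by
    rw [hinst _ (by simp), Agrees]
    exact (and_iff_left hA.2).symm
  have hop : K.agreeOp B (M.bank (M.representative p)) cB x (List.ofFn a')
      = K.agreeOp B (M.bank r) cB x (List.ofFn a') :=
    K.agreeOp_congr B (M.pub_representative r) cB x _ fun g hg => hask g (by simpa using hg)
  have h0 : φ r cA a 0 = 0 := by simpa using hφ r cA a 0 0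
  by_cases hB' : K.Agrees r cB x (List.ofFn a')
  · rw [if_pos hB', ← hψ, Finset.mul_sum]
    refine Finset.sum_congr rfl fun s' _ => ?_
    rw [← normSq_inv_sqrt_card, ← hφ]
    congr 1
    simp only [absorb, hB.2 hB', if_true]
    rw [Matrix.mul_smul, smul_mulVec]
    congr 1
    funext s
    rw [hop, kron_eq_right_mul (K.agreeOp A (M.bank r) cA x (List.ofFn a)), Matrix.mul_assoc,
      ← mulVec_mulVec (M.supply r) (Matrix.kroneckerMap _ (K.agreeOp A (M.bank r) cA x _) 1),
      kron_one_mulVec, ← mulVec_mulVec]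
    rfl
  · rw [if_neg hB', mul_zero]
    refine Finset.sum_eq_zero fun s' _ => ?_
    simp only [absorb, hB, hB', if_false, Matrix.mul_zero, zero_mulVec, h0]

end Protocol

/-! ### Joint extraction from two provers -/

namespace Protocol

variable {M : Scenario} (K : Protocol M)

/-- The probability that both verifiers accept in the prove phase. -/
noncomputable def bothAccept (A B : Prover M K.Msg) (x : M.Id) (r : M.Rand) (cA cB : K.Coins)
    (a a' : Fin K.agreeRounds → K.Msg) (v : A.S × B.S → ℂ) : ℝ :=
  ∑ b : Fin K.proveRounds → K.Msg, ∑ b' : Fin K.proveRounds → K.Msg,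
    if K.verdict (M.bank r) cA (List.ofFn a ++ List.ofFn b) = true ∧
        K.verdict (M.bank r) cB (List.ofFn a' ++ List.ofFn b') = true then
      sqNorm (Matrix.kroneckerMap (· * ·)
        (K.proveOp A (M.bank r) cA x (List.ofFn a) (List.ofFn b))
        (K.proveOp B (M.bank r) cB x (List.ofFn a') (List.ofFn b')) *ᵥ v) else 0

/-- The operators that describe the extraction of a bill from the prover, followed by its
verification. -/
noncomputable def extractOp (E : K.Extractor) (t : ℕ) (P : Prover M K.Msg) (x : M.Id) (r : M.Rand)
    (c : K.Coins) (a : Fin K.agreeRounds → K.Msg)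
    (i : (E t (Scenario.View.pub (M.bank r : M.View)) x
          (transcript (K.ask (M.bank r) c) [] (List.ofFn a))).Anc × P.S × K.Msg) :
    Matrix M.G P.S ℂ :=
  M.acc x (M.bank r) * (E t (Scenario.View.pub (M.bank r : M.View)) x
          (transcript (K.ask (M.bank r) c) [] (List.ofFn a))).kraus
          (P.prove (Scenario.View.pub (M.bank r : M.View)) x) i

/-- The probability that the bills extracted from both provers are accepted. -/
noncomputable def bothExtract (E : K.Extractor) (tA tB : ℕ) (A B : Prover M K.Msg) (x : M.Id)
    (r : M.Rand) (cA cB : K.Coins) (a a' : Fin K.agreeRounds → K.Msg) (v : A.S × B.S → ℂ) : ℝ :=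
  ∑ i, ∑ i', sqNorm (Matrix.kroneckerMap (· * ·) (K.extractOp E tA A x r cA a i)
    (K.extractOp E tB B x r cB a' i') *ᵥ v)

theorem extractOp_contractive (E : K.Extractor) (t : ℕ) (P : Prover M K.Msg) (x : M.Id)
    (r : M.Rand) (c : K.Coins) (a : Fin K.agreeRounds → K.Msg) :
    Contractive (K.extractOp E t P x r c a) :=
  extract_contractive _ _ _ _

theorem bothExtract_nonneg (E : K.Extractor) (tA tB : ℕ) (A B : Prover M K.Msg) (x : M.Id)
    (r : M.Rand) (cA cB : K.Coins) (a a' : Fin K.agreeRounds → K.Msg) (v : A.S × B.S → ℂ) :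
    0 ≤ K.bothExtract E tA tB A B x r cA cB a a' v :=
  Finset.sum_nonneg fun _ _ => Finset.sum_nonneg fun _ _ => sqNorm_nonneg _

/-- Forgetting the second verdict and summing over the second prover's messages cannot decrease the
weight, as its prove phase is contractive. -/
theorem bothAccept_le_left (A B : Prover M K.Msg) (x : M.Id) (r : M.Rand) (cA cB : K.Coins)
    (a a' : Fin K.agreeRounds → K.Msg) (v : A.S × B.S → ℂ) :
    K.bothAccept A B x r cA cB a a' v ≤ ∑ b : Fin K.proveRounds → K.Msg,
      if K.verdict (M.bank r) cA (List.ofFn a ++ List.ofFn b) = true then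
        sqNorm (Matrix.kroneckerMap (· * ·)
          (K.proveOp A (M.bank r) cA x (List.ofFn a) (List.ofFn b))
          (1 : Matrix B.S B.S ℂ) *ᵥ v) else 0 := by
  refine Finset.sum_le_sum fun b _ => ?_
  split_ifs with h
  · refine le_trans (Finset.sum_le_sum fun b' _ => ?_)
      ((K.proveOp_contractive B (M.bank r) cB x (List.ofFn a') K.proveRounds).one_kron
        (t := A.S) _)
    rw [mulVec_mulVec, ← kron_eq_left_mul]
    split_ifs
    exacts [le_rfl, sqNorm_nonneg _]
  · simp [h]

theorem bothAccept_le_right (A B : Prover M K.Msg) (x : M.Id) (r : M.Rand) (cA cB : K.Coins)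
    (a a' : Fin K.agreeRounds → K.Msg) (v : A.S × B.S → ℂ) :
    K.bothAccept A B x r cA cB a a' v ≤ ∑ b' : Fin K.proveRounds → K.Msg,
      if K.verdict (M.bank r) cB (List.ofFn a' ++ List.ofFn b') = true then
        sqNorm (Matrix.kroneckerMap (· * ·) (1 : Matrix A.S A.S ℂ)
          (K.proveOp B (M.bank r) cB x (List.ofFn a') (List.ofFn b')) *ᵥ v) else 0 := by
  rw [bothAccept, Finset.sum_comm]
  refine Finset.sum_le_sum fun b' _ => ?_
  split_ifs with h
  · refine le_trans (Finset.sum_le_sum fun b _ => ?_)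
      ((K.proveOp_contractive A (M.bank r) cA x (List.ofFn a) K.proveRounds).kron_one
        (t := B.S) _)
    rw [mulVec_mulVec, ← kron_eq_right_mul]
    split_ifs
    exacts [le_rfl, sqNorm_nonneg _]
  · simp [h]

theorem bothAccept_le (A B : Prover M K.Msg) (x : M.Id) (r : M.Rand) (cA cB : K.Coins)
    (a a' : Fin K.agreeRounds → K.Msg) (v : A.S × B.S → ℂ) :
    K.bothAccept A B x r cA cB a a' v ≤ sqNorm v := by
  refine (K.bothAccept_le_left A B x r cA cB a a' v).trans ?_
  refine le_trans (Finset.sum_le_sum fun b _ => ?_)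
    ((K.proveOp_contractive A (M.bank r) cA x (List.ofFn a) K.proveRounds).kron_one (t := B.S) v)
  split_ifs
  exacts [le_rfl, sqNorm_nonneg _]

theorem soloWeight_mono {ι : Type} [Fintype ι] (P : Prover M K.Msg)
    (N : M.PubView → ι → Matrix P.S M.Supply ℂ) (x : M.Id)
    {φ φ' : M.Rand → K.Coins → (Fin K.agreeRounds → K.Msg) → (P.S → ℂ) → ℝ}
    (h : ∀ r c a v, φ r c a v ≤ φ' r c a v) : K.soloWeight P N x φ ≤ K.soloWeight P N x φ' := by
  refine avg_mono fun r => avg_mono fun c => Finset.sum_le_sum fun a _ => ?_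
  split_ifs
  exacts [Finset.sum_le_sum fun j _ => h _ _ _ _, le_rfl]

theorem successWeight_le_agreeWeight {ι : Type} [Fintype ι] (P : Prover M K.Msg)
    (N : M.PubView → ι → Matrix P.S M.Supply ℂ) (x : M.Id) :
    K.successWeight P N x ≤ K.agreeWeight P N x := by
  rw [successWeight_eq_soloWeight, agreeWeight_eq_soloWeight]
  refine K.soloWeight_mono P N x fun r c a v => ?_
  refine le_trans (Finset.sum_le_sum fun b _ => ?_)
    (K.proveOp_contractive P (M.bank r) c x (List.ofFn a) K.proveRounds v)
  split_ifs
  exacts [le_rfl, sqNorm_nonneg _]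

/-- If both provers succeed with probability greater than the knowledge error, conditioned on `x`
being agreed on in both executions, then bills can be extracted from both of them. -/
theorem Extracts.both {K : Protocol M} {E : K.Extractor} {κ d : ℝ} {δ : ℝ → ℝ}
    (hE : K.Extracts E κ δ) (hδ : ∀ p, κ < p → p ≤ 1 → δ p ≤ d) (hpub : K.AgreePhasePublic)
    (A B : Prover M K.Msg) (x : M.Id) (N : M.PubView → Matrix (A.S × B.S) M.Supply ℂ)
    (hN : ∀ p v, sqNorm (N p *ᵥ v) ≤ sqNorm v)
    (h0 : 0 < K.pairWeight A B x N fun _ _ _ _ _ => sqNorm)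
    (hs : κ * K.pairWeight A B x N (fun _ _ _ _ _ => sqNorm)
      < K.pairWeight A B x N (K.bothAccept A B x)) :
    ∃ tA tB, (1 - 2 * d) * K.pairWeight A B x N (fun _ _ _ _ _ => sqNorm)
      ≤ K.pairWeight A B x N (K.bothExtract E tA tB A B x) := by
  -- Extraction for either prover, once its partner has been absorbed into a preparation `N'` with
  -- the same weight of agreement and at least the joint weight of success.
  have main : ∀ (P : Prover M K.Msg) {ι : Type} [Fintype ι]
      (N' : M.PubView → ι → Matrix P.S M.Supply ℂ), (∀ p, Contractive (N' p)) →
      K.agreeWeight P N' x = K.pairWeight A B x N (fun _ _ _ _ _ => sqNorm) →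
      K.pairWeight A B x N (K.bothAccept A B x) ≤ K.successWeight P N' x →
      ∃ t, (1 - d) * K.pairWeight A B x N (fun _ _ _ _ _ => sqNorm)
        ≤ K.extractWeight E t P N' x := by
    intro P ι _ N' hN' hq hs'
    have h0' : 0 < K.agreeWeight P N' x := hq ▸ h0
    have hκ : κ < K.successWeight P N' x / K.agreeWeight P N' x := by
      rw [lt_div_iff₀ h0', hq]
      exact hs.trans_le hs'
    obtain ⟨t, ht⟩ := hE.of_contractive P N' hN' x h0' hκ
    refine ⟨t, ?_⟩
    rw [le_div_iff₀ h0'] at ht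
    rw [← hq]
    refine le_trans (mul_le_mul_of_nonneg_right (sub_le_sub_left (hδ _ hκ ?_) 1) h0'.le) ht
    exact (div_le_one h0').2 (K.successWeight_le_agreeWeight P N' x)
  obtain ⟨tA, hA⟩ := main A (K.absorb A B x N) (K.absorb_contractive A B x N hN)
    (by
      rw [agreeWeight_eq_soloWeight]
      exact K.soloWeight_absorb hpub A B x N _ (fun _ _ _ => sqNorm)
        (fun _ _ _ k v => sqNorm_smul k v) fun _ _ _ v => (sqNorm_prod_right v).symm)
    (by
      rw [successWeight_eq_soloWeight, K.soloWeight_absorb hpub A B x N _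
        (fun r c a v => ∑ b : Fin K.proveRounds → K.Msg,
          if K.verdict (M.bank r) c (List.ofFn a ++ List.ofFn b) = true then
            sqNorm (Matrix.kroneckerMap (· * ·)
              (K.proveOp A (M.bank r) c x (List.ofFn a) (List.ofFn b))
              (1 : Matrix B.S B.S ℂ) *ᵥ v) else 0)]
      · exact K.pairWeight_mono A B x N fun r cA cB a a' v =>
          K.bothAccept_le_left A B x r cA cB a a' v
      · intro r c a k v
        rw [Finset.mul_sum]
        refine Finset.sum_congr rfl fun b _ => ?_
        rw [mul_ite, mul_zero, mulVec_smul, sqNorm_smul]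
      · intro r c a v
        rw [Finset.sum_comm]
        refine Finset.sum_congr rfl fun b _ => ?_
        rw [sqNorm_kron_one]
        split_ifs <;> simp)
  obtain ⟨tB, hB⟩ := main B (K.absorb B A x fun p => (N p).submatrix Prod.swap id)
    (K.absorb_contractive B A x _ fun p v => by
      have : (N p).submatrix Prod.swap id *ᵥ v = (N p *ᵥ v) ∘ Equiv.prodComm _ _ := rfl
      rw [this, sqNorm_comp_equiv]
      exact hN p v)
    (by
      rw [agreeWeight_eq_soloWeight, K.soloWeight_absorb hpub B A x _ _
        (fun _ _ _ v => sqNorm (v ∘ Prod.swap)) (fun _ _ _ k v => sqNorm_smul k v)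
        fun _ _ _ v => (by
          rw [← sqNorm_prod_right v]; exact (sqNorm_comp_equiv (Equiv.prodComm _ _) v).symm)]
      exact K.pairWeight_swap A B x N fun _ _ _ _ _ => sqNorm)
    (by
      rw [successWeight_eq_soloWeight, K.soloWeight_absorb hpub B A x _ _
        (fun r c a v => ∑ b : Fin K.proveRounds → K.Msg,
          if K.verdict (M.bank r) c (List.ofFn a ++ List.ofFn b) = true then
            sqNorm (Matrix.kroneckerMap (· * ·) (1 : Matrix A.S A.S ℂ)
              (K.proveOp B (M.bank r) c x (List.ofFn a) (List.ofFn b)) *ᵥ (v ∘ Prod.swap)) else 0)]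
      · refine le_of_le_of_eq (K.pairWeight_mono A B x N fun r cA cB a a' v =>
          K.bothAccept_le_right A B x r cA cB a a' v) ?_
        exact (K.pairWeight_swap A B x N _).symm
      · intro r c a k v
        rw [Finset.mul_sum]
        refine Finset.sum_congr rfl fun b _ => ?_
        rw [mul_ite, mul_zero, mulVec_smul, sqNorm_smul]
      · intro r c a v
        rw [Finset.sum_comm]
        refine Finset.sum_congr rfl fun b _ => ?_
        rw [sqNorm_one_kron]
        split_ifs <;> simp)
  rw [extractWeight_eq_soloWeight, K.soloWeight_absorb hpub A B x N _
    (fun r c a v => ∑ i, sqNorm (Matrix.kroneckerMap (· * ·) (K.extractOp E tA A x r c a i)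
      (1 : Matrix B.S B.S ℂ) *ᵥ v))] at hA
  rotate_left
  · intro r c a k v
    rw [Finset.mul_sum]
    exact Finset.sum_congr rfl fun i _ => by rw [mulVec_smul, sqNorm_smul]
  · intro r c a v
    rw [Finset.sum_comm]
    exact Finset.sum_congr rfl fun i _ => by rw [sqNorm_kron_one]; rfl
  rw [extractWeight_eq_soloWeight, K.soloWeight_absorb hpub B A x _ _
    (fun r c a v => ∑ i, sqNorm (Matrix.kroneckerMap (· * ·) (1 : Matrix A.S A.S ℂ)
      (K.extractOp E tB B x r c a i) *ᵥ (v ∘ Prod.swap)))] at hB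
  rotate_left
  · intro r c a k v
    rw [Finset.mul_sum]
    exact Finset.sum_congr rfl fun i _ => by rw [mulVec_smul, sqNorm_smul]
  · intro r c a v
    rw [Finset.sum_comm]
    exact Finset.sum_congr rfl fun i _ => by rw [sqNorm_one_kron]; rfl
  have hB' := hB.trans_eq (K.pairWeight_swap A B x N fun r _ cB _ a' v =>
    ∑ i, sqNorm (Matrix.kroneckerMap (· * ·) (1 : Matrix A.S A.S ℂ)
      (K.extractOp E tB B x r cB a' i) *ᵥ v))
  refine ⟨tA, tB, ?_⟩
  -- The union bound, averaged: two extractions of weight at least `(1 - d) * q` each leave at least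
  -- `(1 - 2 * d) * q` for both.
  have hU := K.pairWeight_mono A B x N (ψ' := fun r cA cB a a' v =>
      K.bothExtract E tA tB A B x r cA cB a a' v + sqNorm v)
    fun r cA cB a a' v => sub_le_iff_le_add.1 ((K.extractOp_contractive E tA A x r cA a).union_bound
      (K.extractOp_contractive E tB B x r cB a') v)
  rw [pairWeight_add, pairWeight_add] at hU
  linarith

end Protocol

/-- A strategy for one execution in which the prover need not output an instance.  The flag
`ok x s` tells whether the basis state `s` is compatible with the instance `x`, and the behaviour in
the prove phase may depend on the instance that the verifier has output. -/
structure Player (M : Scenario) (Msg : Type) [Fintype Msg] [DecidableEq Msg] (S : Type)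
    [Fintype S] [DecidableEq S] where
  agree : M.PubView → ℕ → Matrix.unitaryGroup (S × Msg) ℂ
  ok : M.Id → S → Bool
  prove : M.PubView → M.Id → ℕ → Matrix.unitaryGroup (S × Msg) ℂ

/-- The prover that always outputs the instance `x` on compatible states. -/
abbrev Player.prover {M : Scenario} {Msg : Type} [Fintype Msg] [DecidableEq Msg] {S : Type}
    [Fintype S] [DecidableEq S] (A : Player M Msg S) (x : M.Id) : Prover M Msg where
  S := S
  agree := A.agree
  out s := if A.ok x s = true then some x else none
  prove := A.prove

/-! ### Summing over instances and labels: total agreement and the combined cloner -/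

namespace Protocol

variable {M : Scenario} (K : Protocol M) {SA SB : Type} [Fintype SA] [DecidableEq SA]
  [Fintype SB] [DecidableEq SB]

/-- Dropping the projection onto the output `x` leaves an interaction that, for players, no longer
depends on `x`; this makes the sum over `x` tractable. -/
theorem sqNorm_kron_agreeOp_le (A B : Prover M K.Msg) (x : M.Id) (D : M.View) (cA cB : K.Coins)
    (a a' : List K.Msg) (v : A.S × B.S → ℂ) :
    sqNorm (Matrix.kroneckerMap (· * ·) (K.agreeOp A D cA x a) (K.agreeOp B D cB x a') *ᵥ v)
      ≤ sqNorm (Matrix.kroneckerMap (· * ·)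
        (interact (K.ask D cA)
          (fun i => (A.agree D.pub i : Matrix (A.S × K.Msg) (A.S × K.Msg) ℂ)) [] a)
        (interact (K.ask D cB)
          (fun i => (B.agree D.pub i : Matrix (B.S × K.Msg) (B.S × K.Msg) ℂ)) [] a') *ᵥ v) := by
  have h : ∀ {S : Type} [Fintype S] [DecidableEq S] (p : S → Prop) [DecidablePred p],
      Contractive fun _ : Unit => Matrix.diagonal fun s => if p s then (1 : ℂ) else 0 := by
    intro S _ _ p _ w
    rw [Fintype.sum_unique]
    exact sqNorm_indicator_mulVec_le p w
  unfold agreeOp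
  rw [kron_mul, ← mulVec_mulVec]
  exact ((h fun s => A.out s = some x).kron (h fun s => B.out s = some x)).single ((), ()) _

/-- A verifier outputs at most one instance. -/
theorem sum_sum_ite_some_le {X : Type} [Fintype X] (o o' : Option X) (c : ℝ)
    (hc : 0 ≤ c) [∀ x : X, Decidable (o = some x ∧ o' = some x)] :
    ∑ x, (if o = some x ∧ o' = some x then c else 0) ≤ c := by
  classical
  rcases o with _ | y
  · simpa using hc
  · rw [Finset.sum_eq_single y]
    · split_ifs
      exacts [le_rfl, hc]
    · intro x _ hx
      exact if_neg fun h => hx (Option.some_injective _ h.1).symm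
    · simp

open Classical in
/-- Agreement on the various instances are mutually exclusive events. -/
theorem sum_agree_le (A : Player M K.Msg SA) (B : Player M K.Msg SB) (D : M.View)
    (v : SA × SB → ℂ) :
    (∑ x : M.Id, ∑ cA : K.Coins, ∑ cB : K.Coins,
      ∑ a : Fin K.agreeRounds → K.Msg, ∑ a' : Fin K.agreeRounds → K.Msg,
      if K.inst D cA (List.ofFn a) = some x ∧ K.inst D cB (List.ofFn a') = some x then
        (Fintype.card K.Coins : ℝ)⁻¹ * ((Fintype.card K.Coins : ℝ)⁻¹ *
          sqNorm (Matrix.kroneckerMap (· * ·) (K.agreeOp (A.prover x) D cA x (List.ofFn a))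
            (K.agreeOp (B.prover x) D cB x (List.ofFn a')) *ᵥ v))
      else 0) ≤ sqNorm v := by
  have hw : ∀ {S : Type} [Fintype S] [DecidableEq S] (A : Player M K.Msg S) (c : K.Coins),
      Contractive fun a : Fin K.agreeRounds → K.Msg => interact (K.ask D c)
        (fun i => (A.agree D.pub i : Matrix (S × K.Msg) (S × K.Msg) ℂ)) [] (List.ofFn a) :=
    fun A c v => (sum_sqNorm_interact _ _ _ _ v).le
  rw [Finset.sum_comm]
  have hc : ∑ _cA : K.Coins, ∑ _cB : K.Coins, (Fintype.card K.Coins : ℝ)⁻¹ *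
      ((Fintype.card K.Coins : ℝ)⁻¹ * sqNorm v) = sqNorm v := by
    simp
  rw [← hc]
  refine Finset.sum_le_sum fun cA _ => ?_
  rw [Finset.sum_comm]
  refine Finset.sum_le_sum fun cB _ => ?_
  rw [Finset.sum_comm]
  -- For fixed coins and without the projections, the weights of all pairs of transcripts sum to at
  -- most the weight of `v`, and each pair is charged to at most one instance.
  have h2 := ((hw A cA).kron (hw B cB)) v
  rw [Fintype.sum_prod_type] at h2
  refine le_trans ?_ (mul_le_mul_of_nonneg_left (mul_le_mul_of_nonneg_left h2
    (by positivity : (0 : ℝ) ≤ (Fintype.card K.Coins : ℝ)⁻¹))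
    (by positivity : (0 : ℝ) ≤ (Fintype.card K.Coins : ℝ)⁻¹))
  simp only [Finset.mul_sum]
  refine Finset.sum_le_sum fun a _ => ?_
  rw [Finset.sum_comm]
  refine Finset.sum_le_sum fun a' _ => ?_
  refine le_trans (Finset.sum_le_sum fun x _ => ?_) (sum_sum_ite_some_le
    (K.inst D cA (List.ofFn a)) (K.inst D cB (List.ofFn a')) _
    (mul_nonneg (by positivity) (mul_nonneg (by positivity) (sqNorm_nonneg _))))
  split_ifs
  · gcongr
    exact K.sqNorm_kron_agreeOp_le (A.prover x) (B.prover x) x D cA cB _ _ v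
  · exact le_rfl

variable {J : Type} [Fintype J]

theorem pairWeight_eq_sum (A B : Prover M K.Msg) (x : M.Id)
    (N : M.PubView → Matrix (A.S × B.S) M.Supply ℂ)
    (ψ : M.Rand → K.Coins → K.Coins → (Fin K.agreeRounds → K.Msg) → (Fin K.agreeRounds → K.Msg) →
      (A.S × B.S → ℂ) → ℝ) :
    K.pairWeight A B x N ψ = avg fun r : M.Rand => open Classical in ∑ cA : K.Coins,
      ∑ cB : K.Coins, ∑ a : Fin K.agreeRounds → K.Msg, ∑ a' : Fin K.agreeRounds → K.Msg,
      if K.Agrees r cA x (List.ofFn a) ∧ K.Agrees r cB x (List.ofFn a') then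
        (Fintype.card K.Coins : ℝ)⁻¹ * ((Fintype.card K.Coins : ℝ)⁻¹ * ψ r cA cB a a'
        ((Matrix.kroneckerMap (· * ·) (K.agreeOp A (M.bank r) cA x (List.ofFn a))
          (K.agreeOp B (M.bank r) cB x (List.ofFn a')) *
          N (Scenario.View.pub (M.bank r : M.View))) *ᵥ M.supply r))
      else 0 := by
  refine congrArg avg (funext fun r => ?_)
  simp only [avg_eq_sum, Finset.mul_sum, mul_ite, mul_zero]

/-- Different labels are different outcomes of one contractive preparation and different instances
are exclusive, so the weights of joint agreement are those of disjoint events. -/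
theorem sum_pairWeight_le_one (A : J → Player M K.Msg SA) (B : J → Player M K.Msg SB)
    (N : M.PubView → J → Matrix (SA × SB) M.Supply ℂ) (hN : ∀ p, Contractive (N p))
    (hsupply : ∀ r, sqNorm (M.supply r) = 1) :
    ∑ j, ∑ x, K.pairWeight ((A j).prover x) ((B j).prover x) x (fun p => N p j)
      (fun _ _ _ _ _ => sqNorm) ≤ 1 := by
  classical
  simp only [pairWeight_eq_sum, ← avg_sum]
  refine avg_le_of_le fun r => ?_
  rw [← hsupply r]
  refine le_trans (Finset.sum_le_sum fun j _ => ?_)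
    (hN (Scenario.View.pub (M.bank r : M.View)) (M.supply r))
  refine le_trans (Finset.sum_le_sum fun x _ => Finset.sum_le_sum fun cA _ =>
    Finset.sum_le_sum fun cB _ => Finset.sum_le_sum fun a _ => Finset.sum_le_sum fun a' _ => ?_)
    (K.sum_agree_le (A j) (B j) (M.bank r) _)
  rw [mulVec_mulVec]
  by_cases h : K.Agrees r cA x (List.ofFn a) ∧ K.Agrees r cB x (List.ofFn a')
  · rw [if_pos h, if_pos ⟨h.1.1, h.2.1⟩]
  · rw [if_neg h]
    split_ifs
    · exact mul_nonneg (by positivity) (mul_nonneg (by positivity) (sqNorm_nonneg _))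
    · exact le_rfl

theorem sum_sqNorm_kron_mul_le {ι κ l m n p q s X : Type} [Fintype ι] [Fintype κ] [Fintype l]
    [Fintype m] [Fintype n] [Fintype p] [Fintype q] [Fintype s] [Fintype X]
    {F : ι → Matrix l m ℂ} {G : κ → Matrix p q ℂ} (hF : Contractive F) (hG : Contractive G)
    (A : Matrix m n ℂ) (B : Matrix q s ℂ) (N : Matrix (n × s) X ℂ) (u : X → ℂ) :
    ∑ i, ∑ k, sqNorm ((Matrix.kroneckerMap (· * ·) (F i * A) (G k * B) * N) *ᵥ u)
      ≤ sqNorm (Matrix.kroneckerMap (· * ·) A B *ᵥ (N *ᵥ u)) := by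
  have := (hF.kron hG) (Matrix.kroneckerMap (· * ·) A B *ᵥ (N *ᵥ u))
  rw [Fintype.sum_prod_type] at this
  simpa only [mulVec_mulVec, ← kron_mul, ← Matrix.mul_assoc] using this

/-- The total probability of extracting two accepted bills is bounded by the cloning parameter. -/
theorem sum_bothExtract_le {μ : ℝ} (hμ : M.HasCloningParameter μ) (hpub : K.AgreePhasePublic)
    [Nonempty M.Id] (E : K.Extractor) (A : J → Player M K.Msg SA) (B : J → Player M K.Msg SB)
    (tA tB : J → M.Id → ℕ)
    (N : M.PubView → J → Matrix (SA × SB) M.Supply ℂ) (hN : ∀ p, Contractive (N p)) :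
    ∑ j, ∑ x, K.pairWeight ((A j).prover x) ((B j).prover x) x (fun p => N p j)
      (K.bothExtract E (tA j x) (tB j x) ((A j).prover x) ((B j).prover x) x) ≤ μ := by
  classical
  obtain ⟨x₀⟩ := ‹Nonempty M.Id›
  -- The classical record of the cloner. The component in `M.Rand` is there because the index types
  -- of the extractors depend on it; only the representative of the public view has non-zero
  -- operators.
  let Z := M.Rand × J × M.Id × K.Coins × K.Coins ×
    (Fin K.agreeRounds → K.Msg) × (Fin K.agreeRounds → K.Msg)
  let F (t : J → M.Id → ℕ) (r : M.Rand) (j : J) (x : M.Id) (c : K.Coins)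
      (a : Fin K.agreeRounds → K.Msg) : OracleMachine K.Msg K.proveRounds M.Bill :=
    E (t j x) (Scenario.View.pub (M.bank r : M.View)) x
      (transcript (K.ask (M.bank r) c) [] (List.ofFn a))
  let FA (z : Z) := F tA z.1 z.2.1 z.2.2.1 z.2.2.2.1 z.2.2.2.2.2.1
  let FB (z : Z) := F tB z.1 z.2.1 z.2.2.1 z.2.2.2.2.1 z.2.2.2.2.2.2
  let ι := Σ z : Z, ((FA z).Anc × SA × K.Msg) × ((FB z).Anc × SB × K.Msg)
  -- The cloner prepares the joint state, simulates both agree phases with the representative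
  -- database, drops all outcomes without agreement, and runs both extractors. The factor `1 / card
  -- Coins` is the product of two amplitudes `1 / √(card Coins)`.
  let k : M.PubView → ι → Matrix (M.Bill × M.Bill) M.Supply ℂ := fun p ⟨z, i, i'⟩ =>
    if z.1 = M.representative p ∧
        K.inst (M.bank z.1) z.2.2.2.1 (List.ofFn z.2.2.2.2.2.1) = some z.2.2.1 ∧
        K.inst (M.bank z.1) z.2.2.2.2.1 (List.ofFn z.2.2.2.2.2.2) = some z.2.2.1 then
      (((Fintype.card K.Coins : ℝ)⁻¹ : ℝ) : ℂ) • (Matrix.kroneckerMap (· * ·)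
        ((FA z).kraus ((A z.2.1).prove p z.2.2.1) i * K.agreeOp ((A z.2.1).prover z.2.2.1)
          (M.bank z.1) z.2.2.2.1 z.2.2.1 (List.ofFn z.2.2.2.2.2.1))
        ((FB z).kraus ((B z.2.1).prove p z.2.2.1) i' * K.agreeOp ((B z.2.1).prover z.2.2.1)
          (M.bank z.1) z.2.2.2.2.1 z.2.2.1 (List.ofFn z.2.2.2.2.2.2)) * N p z.2.1)
    else 0
  have hk : ∀ p, Contractive (k p) := by
    intro p u
    refine le_trans ?_ (hN p u)
    rw [Fintype.sum_sigma, Fintype.sum_prod_type, Finset.sum_eq_single (M.representative p)]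
    rotate_left
    · intro r _ hr
      simp [k, hr]
    · simp
    rw [Fintype.sum_prod_type]
    refine Finset.sum_le_sum fun j _ => ?_
    refine le_trans ?_ (K.sum_agree_le (A j) (B j) (M.bank (M.representative p)) _)
    simp only [Fintype.sum_prod_type (α₁ := M.Id), Fintype.sum_prod_type (α₁ := K.Coins),
      Fintype.sum_prod_type (α₁ := Fin K.agreeRounds → K.Msg)]
    refine Finset.sum_le_sum fun x _ => Finset.sum_le_sum fun cA _ => Finset.sum_le_sum fun cB _ =>
      Finset.sum_le_sum fun a _ => Finset.sum_le_sum fun a' _ => ?_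
    simp only [k, true_and]
    split_ifs
    · rw [Fintype.sum_prod_type]
      simp only [smul_mulVec, sqNorm_smul, Complex.normSq_ofReal, ← Finset.mul_sum]
      rw [mul_assoc]
      refine mul_le_mul_of_nonneg_left (mul_le_mul_of_nonneg_left ?_ (by positivity))
        (by positivity)
      exact sum_sqNorm_kron_mul_le (OracleMachine.kraus_contractive _ _)
        (OracleMachine.kraus_contractive _ _) _ _ _ _
    · simp
  -- The dropped outcomes are completed to a channel in an arbitrary way, with the arbitrary label
  -- `x₀`: they can only add to the cloning probability. The start state of an extractor supplies a
  -- basis state of the bill register.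
  let C₀ : ∀ p, ∃ R : M.Supply → Matrix (M.Bill × M.Bill) M.Supply ℂ,
      (∑ i, (k p i)ᴴ * k p i + ∑ l, (R l)ᴴ * R l = 1) := fun p =>
    ((hk p).exists_completion ((E 0 p x₀ []).start.1, (E 0 p x₀ []).start.1)).imp fun _ h => h.1
  choose R hR using C₀
  let C : M.Cloner :=
    { ι := ι ⊕ M.Supply
      kraus := fun p => Sum.elim (k p) (R p)
      label := fun _ => Sum.elim (fun i => i.1.2.2.1) fun _ => x₀
      complete := fun p => by
        rw [Fintype.sum_sum_type]
        exact hR p }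
  refine le_trans ?_ (hμ C)
  simp only [pairWeight_eq_sum, ← avg_sum]
  refine avg_mono fun r => ?_
  set p := Scenario.View.pub (M.bank r : M.View) with hp
  have hsum : ∑ i : ι, (if M.Valid r i.1.2.2.1 then
        sqNorm ((Matrix.kroneckerMap (· * ·) (M.acc i.1.2.2.1 (M.bank r))
          (M.acc i.1.2.2.1 (M.bank r)) * k p i) *ᵥ M.supply r) else 0)
      ≤ ∑ i : ι ⊕ M.Supply, (if M.Valid r (C.label p i) then
        sqNorm ((Matrix.kroneckerMap (· * ·) (M.acc (C.label p i) (M.bank r))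
          (M.acc (C.label p i) (M.bank r)) * C.kraus p i) *ᵥ M.supply r) else 0) := by
    rw [Fintype.sum_sum_type]
    refine le_add_of_le_of_nonneg le_rfl (Finset.sum_nonneg fun i _ => ?_)
    split_ifs
    exacts [sqNorm_nonneg _, le_rfl]
  refine le_trans ?_ hsum
  rw [Fintype.sum_sigma, Fintype.sum_prod_type]
  refine le_trans ?_ (Finset.single_le_sum (fun r' _ => Finset.sum_nonneg fun z _ =>
    Finset.sum_nonneg fun i _ => ?_) (Finset.mem_univ (M.representative p)))
  swap
  · split_ifs
    exacts [sqNorm_nonneg _, le_rfl]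
  rw [Fintype.sum_prod_type]
  refine Finset.sum_le_sum fun j _ => ?_
  simp only [Fintype.sum_prod_type (α₁ := M.Id), Fintype.sum_prod_type (α₁ := K.Coins),
    Fintype.sum_prod_type (α₁ := Fin K.agreeRounds → K.Msg)]
  refine Finset.sum_le_sum fun x _ => Finset.sum_le_sum fun cA _ => Finset.sum_le_sum fun cB _ =>
    Finset.sum_le_sum fun a _ => Finset.sum_le_sum fun a' _ => ?_
  by_cases h : K.Agrees r cA x (List.ofFn a) ∧ K.Agrees r cB x (List.ofFn a')
  swap
  · rw [if_neg h]
    refine Finset.sum_nonneg fun i _ => ?_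
    split_ifs
    exacts [sqNorm_nonneg _, le_rfl]
  rw [if_pos h]
  have hA := hpub (M.representative p) r (M.pub_representative r) cA
  have hB := hpub (M.representative p) r (M.pub_representative r) cB
  have hopA : K.agreeOp ((A j).prover x) (M.bank (M.representative p)) cA x (List.ofFn a)
      = K.agreeOp ((A j).prover x) (M.bank r) cA x (List.ofFn a) :=
    K.agreeOp_congr _ (M.pub_representative r) cA x _ fun g hg => hA.1 g (by simpa using hg)
  have hopB : K.agreeOp ((B j).prover x) (M.bank (M.representative p)) cB x (List.ofFn a')
      = K.agreeOp ((B j).prover x) (M.bank r) cB x (List.ofFn a') :=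
    K.agreeOp_congr _ (M.pub_representative r) cB x _ fun g hg => hB.1 g (by simpa using hg)
  have hFA : F tA (M.representative p) j x cA a = F tA r j x cA a := by
    simp only [F]
    rw [M.pub_representative r, transcript_congr [] (List.ofFn a) fun g hg =>
      hA.1 g (by simpa using hg)]
  have hFB : F tB (M.representative p) j x cB a' = F tB r j x cB a' := by
    simp only [F]
    rw [M.pub_representative r, transcript_congr [] (List.ofFn a') fun g hg =>
      hB.1 g (by simpa using hg)]
  have hi : K.inst (M.bank (M.representative p)) cA (List.ofFn a) = some x ∧
      K.inst (M.bank (M.representative p)) cB (List.ofFn a') = some x := by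
    rw [hA.2 _ (by simp), hB.2 _ (by simp)]
    exact ⟨h.1.1, h.2.1⟩
  simp only [k, true_and, if_pos h.1.2, if_pos hi, FA, FB]
  rw [hopA, hopB, Fintype.sum_prod_type]
  -- For arbitrary machines, because the ranges of the sums depend on the machine; the
  -- representative is exchanged for the actual database only after specialisation.
  have gen : ∀ G G' : OracleMachine K.Msg K.proveRounds M.Bill,
      (Fintype.card K.Coins : ℝ)⁻¹ * ((Fintype.card K.Coins : ℝ)⁻¹ *
        ∑ i, ∑ i', sqNorm (Matrix.kroneckerMap (· * ·)
          (M.acc x (M.bank r) * G.kraus ((A j).prove p x) i)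
          (M.acc x (M.bank r) * G'.kraus ((B j).prove p x) i') *ᵥ
          ((Matrix.kroneckerMap (· * ·)
            (K.agreeOp ((A j).prover x) (M.bank r) cA x (List.ofFn a))
            (K.agreeOp ((B j).prover x) (M.bank r) cB x (List.ofFn a')) * N p j) *ᵥ M.supply r)))
      = ∑ i, ∑ i', sqNorm ((Matrix.kroneckerMap (· * ·) (M.acc x (M.bank r))
          (M.acc x (M.bank r)) * (((Fintype.card K.Coins : ℝ)⁻¹ : ℝ) : ℂ) •
          (Matrix.kroneckerMap (· * ·)
            (G.kraus ((A j).prove p x) i *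
              K.agreeOp ((A j).prover x) (M.bank r) cA x (List.ofFn a))
            (G'.kraus ((B j).prove p x) i' *
              K.agreeOp ((B j).prover x) (M.bank r) cB x (List.ofFn a')) * N p j)) *ᵥ
          M.supply r) := by
    intro G G'
    simp only [Matrix.mul_smul, smul_mulVec, sqNorm_smul, Complex.normSq_ofReal,
      ← Finset.mul_sum]
    rw [mul_assoc]
    refine congrArg _ (congrArg _ (Finset.sum_congr rfl fun i _ => Finset.sum_congr rfl
      fun i' _ => ?_))
    rw [mulVec_mulVec, kron_mul, kron_mul, Matrix.mul_assoc, Matrix.mul_assoc]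
  refine le_of_eq (Eq.trans ?_ (gen (F tA (M.representative p) j x cA a)
    (F tB (M.representative p) j x cB a')))
  rw [hFA, hFB]
  rfl

end Protocol

/-! ## The value of a single execution -/

theorem sqNorm_pi {ι X : Type} [Fintype ι] [DecidableEq ι] [Fintype X] (v : ι → X → ℂ) :
    sqNorm (fun f : ι → X => ∏ i, v i (f i)) = ∏ i, sqNorm (v i) := by
  simp only [sqNorm, map_prod]
  rw [Finset.prod_univ_sum, Fintype.piFinset_univ]

theorem Scenario.sqNorm_supply (M : Scenario) (r : M.Rand) : sqNorm (M.supply r) = 1 := by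
  rw [show M.supply r = fun f => ∏ ν, M.noteState r ν (f ν) from rfl, sqNorm_pi]
  refine Finset.prod_eq_one fun ν _ => ?_
  by_cases h : (M.bank r ν).isSome
  · have := M.money_norm r ν
    simpa [sqNorm, Scenario.noteState, h, Fintype.sum_option] using this
  · simp [sqNorm, Scenario.noteState, h]

namespace Protocol

variable {M : Scenario} (K : Protocol M) {SA SB : Type} [Fintype SA] [DecidableEq SA]
  [Fintype SB] [DecidableEq SB] {J : Type} [Fintype J]

/-- The value of the no-cloning game for a single execution: the cloning parameter bounds by how
much it can exceed the knowledge error. -/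
theorem sum_bothAccept_le {E : K.Extractor} {κ d μ β : ℝ} {δ : ℝ → ℝ}
    (hE : K.Extracts E κ δ) (hμ : M.HasCloningParameter μ) (hpub : K.AgreePhasePublic)
    (hκ : 0 < κ) (hδ : κ < 1 → ∀ p, κ < p → p ≤ 1 → δ p ≤ d) (hβ0 : 0 ≤ β)
    (hβ : κ < 1 → Nonempty M.Id → 0 < 1 - 2 * d ∧ μ ≤ β * (1 - 2 * d))
    (A : J → Player M K.Msg SA) (B : J → Player M K.Msg SB)
    (N : M.PubView → J → Matrix (SA × SB) M.Supply ℂ) (hN : ∀ p, Contractive (N p)) :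
    ∑ j, ∑ x, K.pairWeight ((A j).prover x) ((B j).prover x) x (fun p => N p j)
      (K.bothAccept ((A j).prover x) ((B j).prover x) x) ≤ κ + β := by
  classical
  rcases isEmpty_or_nonempty M.Id with hId | hId
  · simp only [Finset.univ_eq_empty, Finset.sum_empty, Finset.sum_const_zero]
    positivity
  set q : J → M.Id → ℝ := fun j x => K.pairWeight ((A j).prover x) ((B j).prover x) x
    (fun p => N p j) (fun _ _ _ _ _ => sqNorm) with hq
  set s : J → M.Id → ℝ := fun j x => K.pairWeight ((A j).prover x) ((B j).prover x) x
    (fun p => N p j) (K.bothAccept ((A j).prover x) ((B j).prover x) x) with hs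
  have hq0 : ∀ j x, 0 ≤ q j x := fun j x => avg_nonneg fun r => avg_nonneg fun cA =>
    avg_nonneg fun cB => Finset.sum_nonneg fun a _ => Finset.sum_nonneg fun a' _ => by
      split_ifs
      exacts [sqNorm_nonneg _, le_rfl]
  have hsq : ∀ j x, s j x ≤ q j x := fun j x => K.pairWeight_mono _ _ x _ fun r cA cB a a' v =>
    K.bothAccept_le _ _ x r cA cB a a' v
  have hq1 : ∑ j, ∑ x, q j x ≤ 1 := K.sum_pairWeight_le_one A B N hN M.sqNorm_supply
  by_cases hκ1 : κ < 1
  · obtain ⟨hd, hμβ⟩ := hβ hκ1 hId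
    -- If success exceeds `κ * q`, then `q` itself is charged to the extraction of two bills;
    -- otherwise `κ * q` suffices and the time bounds are irrelevant.
    have hex : ∀ j x, ∃ tA tB, s j x ≤ κ * q j x + (1 - 2 * d)⁻¹ *
        K.pairWeight ((A j).prover x) ((B j).prover x) x (fun p => N p j)
          (K.bothExtract E tA tB ((A j).prover x) ((B j).prover x) x) := by
      intro j x
      have hnn : ∀ tA tB, 0 ≤ (1 - 2 * d)⁻¹ *
          K.pairWeight ((A j).prover x) ((B j).prover x) x (fun p => N p j)
          (K.bothExtract E tA tB ((A j).prover x) ((B j).prover x) x) := fun tA tB =>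
        mul_nonneg (inv_nonneg.2 hd.le) (avg_nonneg fun r => avg_nonneg fun cA =>
          avg_nonneg fun cB => Finset.sum_nonneg fun a _ => Finset.sum_nonneg fun a' _ => by
            split_ifs
            exacts [K.bothExtract_nonneg _ _ _ _ _ _ _ _ _ _ _ _, le_rfl])
      by_cases hgood : κ * q j x < s j x
      · have hpos : 0 < q j x := by
          rcases (hq0 j x).lt_or_eq with h | h
          · exact h
          · have := hsq j x
            rw [← h] at this hgood
            linarith
        obtain ⟨tA, tB, h⟩ := Extracts.both hE (hδ hκ1) hpub ((A j).prover x) ((B j).prover x) x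
          (fun p => N p j) (fun p v => (hN p).single j v) hpos hgood
        refine ⟨tA, tB, ?_⟩
        have h2 : q j x ≤ (1 - 2 * d)⁻¹ *
            K.pairWeight ((A j).prover x) ((B j).prover x) x (fun p => N p j)
              (K.bothExtract E tA tB ((A j).prover x) ((B j).prover x) x) := by
          rw [← div_eq_inv_mul, le_div_iff₀ hd, mul_comm]
          exact h
        have h3 := hsq j x
        have h4 : 0 ≤ κ * q j x := mul_nonneg hκ.le (hq0 j x)
        linarith
      · exact ⟨0, 0, (not_lt.1 hgood).trans (le_add_of_nonneg_right (hnn 0 0))⟩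
    choose tA tB ht using hex
    have he := K.sum_bothExtract_le hμ hpub E A B tA tB N hN
    calc ∑ j, ∑ x, s j x ≤ κ * ∑ j, ∑ x, q j x + (1 - 2 * d)⁻¹ * ∑ j, ∑ x,
          K.pairWeight ((A j).prover x) ((B j).prover x) x (fun p => N p j)
            (K.bothExtract E (tA j x) (tB j x) ((A j).prover x) ((B j).prover x) x) := by
          simp only [Finset.mul_sum, ← Finset.sum_add_distrib]
          exact Finset.sum_le_sum fun j _ => Finset.sum_le_sum fun x _ => ht j x
      _ ≤ κ * 1 + (1 - 2 * d)⁻¹ * μ := by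
          have := inv_nonneg.2 hd.le
          gcongr
      _ ≤ κ + β := by
          rw [mul_one, ← div_eq_inv_mul]
          gcongr
          exact (div_le_iff₀ hd).2 hμβ
  -- For `κ ≥ 1` the total weight of agreement, at most `1`, is enough.
  · calc ∑ j, ∑ x, s j x ≤ ∑ j, ∑ x, q j x :=
          Finset.sum_le_sum fun j _ => Finset.sum_le_sum fun x _ => hsq j x
      _ ≤ κ + β := by linarith [not_lt.1 hκ1]

end Protocol

/-! ## Duality -/

section Duality

variable {X Z Γ : Type} [Fintype X] [DecidableEq X] [Fintype Z] [DecidableEq Z]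

/-- The identity is an interior point of the positive cone, with the sum of the entry norms as a
crude bound on the quadratic form of `H`. This provides the domination hypothesis of the Riesz
extension theorem. -/
theorem exists_smul_one_add_posSemidef {H : Matrix X X ℂ} (hH : H.IsHermitian) :
    ∃ t : ℝ, (t • (1 : Matrix X X ℂ) + H).PosSemidef := by
  have hP : ∀ t : ℝ, (t • (1 : Matrix X X ℂ) + H).IsHermitian := fun t => by
    rw [IsHermitian, conjTranspose_add, conjTranspose_smul, hH.eq]
    simp
  refine ⟨∑ x, ∑ x', ‖H x x'‖, .of_dotProduct_mulVec_nonneg (hP _) fun v => ?_⟩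
  rw [Complex.nonneg_iff]
  refine ⟨?_, ((hP _).im_star_dotProduct_mulVec_self v).symm⟩
  rw [add_mulVec, smul_mulVec, one_mulVec, dotProduct_add, dotProduct_smul, ← ofReal_sqNorm,
    Complex.add_re, Complex.real_smul, ← Complex.ofReal_mul, Complex.ofReal_re]
  have hv : ∀ x, ‖v x‖ ^ 2 ≤ sqNorm v := fun x => by
    rw [← Complex.normSq_eq_norm_sq]
    exact Finset.single_le_sum (f := fun i => Complex.normSq (v i))
      (fun _ _ => Complex.normSq_nonneg _) (Finset.mem_univ x)
  have hb : ‖star v ⬝ᵥ (H *ᵥ v)‖ ≤ (∑ x, ∑ x', ‖H x x'‖) * sqNorm v := by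
    simp only [dotProduct, mulVec, Finset.mul_sum, Finset.sum_mul]
    refine (norm_sum_le _ _).trans (Finset.sum_le_sum fun x _ => (norm_sum_le _ _).trans
      (Finset.sum_le_sum fun x' _ => ?_))
    rw [norm_mul, norm_mul, Pi.star_apply, norm_star]
    have : ‖v x‖ * ‖v x'‖ ≤ sqNorm v := by
      nlinarith [hv x, hv x', sq_nonneg (‖v x‖ - ‖v x'‖)]
    calc ‖v x‖ * (‖H x x'‖ * ‖v x'‖) = ‖H x x'‖ * (‖v x‖ * ‖v x'‖) := by ring
      _ ≤ _ := mul_le_mul_of_nonneg_left this (norm_nonneg _)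
  have := neg_le_of_abs_le ((Complex.abs_re_le_norm _).trans hb)
  linarith

/-- The operator with the single non-zero row `star v`. -/
def rowOp (z : Z) (v : X → ℂ) : Matrix Z X ℂ := Matrix.of fun i x => if i = z then star (v x) else 0

/-- Every rank-one positive matrix is thus of the form `Tᴴ * T` for an admissible `T`, whatever the
non-empty output register. -/
theorem rowOp_conjTranspose_mul_self (z : Z) (v : X → ℂ) :
    (rowOp z v)ᴴ * rowOp z v = vecMulVec v (star v) := by
  ext x x'
  rw [Matrix.mul_apply, Finset.sum_eq_single z]
  · simp [rowOp, vecMulVec_apply]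
  · intro i _ hi
    simp [rowOp, hi]
  · simp

/-- Strong duality for the optimisation over channels: if every channel from `X` to `Z` with a
classical label `γ` has score at most `w`, then the score has a dual certificate of size `w`. -/
theorem exists_dual_certificate (q : Γ → Matrix Z X ℂ → ℝ) (hq0 : ∀ γ T, 0 ≤ q γ T)
    (hqs : ∀ γ (t : ℝ) T, q γ (t • T) = t ^ 2 * q γ T) {w : ℝ} (hw0 : 0 ≤ w)
    (hw : ∀ (J : Type) [Fintype J] (lab : J → Γ) (T : J → Matrix Z X ℂ),
      ∑ j, (T j)ᴴ * T j = 1 → ∑ j, q (lab j) (T j) ≤ w) :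
    ∃ (m : ℕ) (y : Fin m → X → ℂ), ∑ k, sqNorm (y k) ≤ w ∧
      ∀ γ T, q γ T ≤ ∑ k, sqNorm (T *ᵥ y k) := by
  have hqz : ∀ γ, q γ 0 = 0 := fun γ => by simpa using hqs γ 0 0
  by_cases htriv : IsEmpty Γ ∨ IsEmpty Z ∨ IsEmpty X
  · refine ⟨0, fun _ => 0, by simpa using hw0, fun γ T => ?_⟩
    have : T = 0 := by
      rcases htriv with h | h | h
      · exact (h.false γ).elim
      · ext i; exact (h.false i).elim
      · ext i j; exact (h.false j).elim
    simp [this, hqz]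
  obtain ⟨⟨γ₀⟩, ⟨z₀⟩, ⟨x₀⟩⟩ : Nonempty Γ ∧ Nonempty Z ∧ Nonempty X := by
    simpa only [not_or, not_isEmpty_iff] using htriv
  -- The hypothesis on channels, extended by homogeneity to families with `∑ j, (T j)ᴴ * T j` a
  -- multiple `t` of the identity; for `t = 0` all operators vanish.
  have hwt : ∀ (t : ℝ) (J : Type) [Fintype J] (lab : J → Γ) (T : J → Matrix Z X ℂ),
      ∑ j, (T j)ᴴ * T j = t • (1 : Matrix X X ℂ) → ∑ j, q (lab j) (T j) ≤ w * t := by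
    intro t J _ lab T hT
    have hn : ∀ v, ∑ j, sqNorm (T j *ᵥ v) = t * sqNorm v := fun v => by
      apply Complex.ofReal_injective
      rw [ofReal_sum_sqNorm_mulVec, hT, smul_mulVec, one_mulVec, dotProduct_smul,
        ← ofReal_sqNorm, Complex.real_smul, Complex.ofReal_mul]
    have ht : 0 ≤ t := by
      have h1 := hn (Pi.single x₀ 1)
      have h2 : sqNorm (Pi.single x₀ 1 : X → ℂ) = 1 := by
        rw [sqNorm, Finset.sum_eq_single x₀]
        · simp
        · intro b _ hb
          simp [hb]
        · simp
      rw [h2, mul_one] at h1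
      rw [← h1]
      exact Finset.sum_nonneg fun _ _ => sqNorm_nonneg _
    rcases ht.eq_or_lt with rfl | ht
    · have hz : ∀ j, T j = 0 := fun j => by
        refine Matrix.ext_of_mulVec_single fun x => ?_
        have h1 := hn (Pi.single x 1)
        rw [zero_mul, Finset.sum_eq_zero_iff_of_nonneg fun _ _ => sqNorm_nonneg _] at h1
        have h2 := h1 j (Finset.mem_univ j)
        rw [sqNorm, Finset.sum_eq_zero_iff_of_nonneg fun _ _ => Complex.normSq_nonneg _] at h2
        funext z
        rw [zero_mulVec]
        exact Complex.normSq_eq_zero.1 (h2 z (Finset.mem_univ z))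
      simp [hz, hqz]
    · have h1 := hw J lab (fun j => (√t)⁻¹ • T j) (by
        simp only [conjTranspose_smul, Matrix.smul_mul, Matrix.mul_smul, smul_smul, star_trivial,
          ← Finset.smul_sum, hT]
        rw [← mul_inv, Real.mul_self_sqrt ht.le, inv_mul_cancel₀ ht.ne', one_smul])
      simp only [hqs, inv_pow, Real.sq_sqrt ht.le, ← Finset.mul_sum] at h1
      rwa [inv_mul_le_iff₀ ht, mul_comm] at h1
  -- Only the Hermitian part enters the cone below. Skew-Hermitian matrices then lie in it with both
  -- signs, and one can work in the real space of all complex matrices.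
  let herm : Matrix X X ℂ → Matrix X X ℂ := fun H => (1 / 2 : ℝ) • (H + Hᴴ)
  have herm_self : ∀ {H : Matrix X X ℂ}, H.IsHermitian → herm H = H := fun {H} hH => by
    simp only [herm]
    rw [hH.eq, ← two_smul ℝ H, smul_smul]
    norm_num
  -- Pairs `(H, a)` such that the Hermitian part of `H` is `∑ j, (T j)ᴴ * T j` for some labelled
  -- family whose total score is at least `-a`.
  let s : PointedCone ℝ (Matrix X X ℂ × ℝ) :=
    { carrier := {u | ∃ (J : Type) (_ : Fintype J) (lab : J → Γ) (T : J → Matrix Z X ℂ),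
        ∑ j, (T j)ᴴ * T j = herm u.1 ∧ 0 ≤ u.2 + ∑ j, q (lab j) (T j)}
      add_mem' := by
        rintro u u' ⟨J, _, lab, T, h1, h2⟩ ⟨J', _, lab', T', h1', h2'⟩
        refine ⟨J ⊕ J', inferInstance, Sum.elim lab lab', Sum.elim T T', ?_, ?_⟩
        · rw [Fintype.sum_sum_type]
          simp only [Sum.elim_inl, Sum.elim_inr, h1, h1', herm, Prod.fst_add, conjTranspose_add,
            ← smul_add]
          congr 1
          abel
        · rw [Fintype.sum_sum_type]
          simp only [Sum.elim_inl, Sum.elim_inr, Prod.snd_add]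
          linarith
      zero_mem' := ⟨Empty, inferInstance, Empty.elim, Empty.elim, by simp [herm], by simp⟩
      smul_mem' := by
        rintro ⟨c, hc⟩ u ⟨J, _, lab, T, h1, h2⟩
        refine ⟨J, inferInstance, lab, fun j => √c • T j, ?_, ?_⟩
        · change _ = herm (c • u.1)
          simp only [conjTranspose_smul, Matrix.smul_mul, Matrix.mul_smul, smul_smul, star_trivial,
            ← Finset.smul_sum, h1, Real.mul_self_sqrt hc, herm, ← smul_add, mul_comm]
        · change 0 ≤ c * u.2 + _
          simp only [hqs, Real.sq_sqrt hc, ← Finset.mul_sum, ← mul_add]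
          exact mul_nonneg hc h2 }
  -- Normalised so that `F (t • 1, a) = w * t + a`; this is non-negative on the part of the cone
  -- over multiples of the identity, precisely because of `hwt`.
  let F : Matrix X X ℂ × ℝ →ₗ[ℝ] ℝ :=
    { toFun := fun u => w / Fintype.card X * u.1.trace.re + u.2
      map_add' := fun u v => by simp; ring
      map_smul' := fun c u => by simp; ring }
  let dom : Submodule ℝ (Matrix X X ℂ × ℝ) := (Submodule.span ℝ {1}).prod ⊤
  have hcard : (Fintype.card X : ℝ) ≠ 0 := by
    have : Nonempty X := ⟨x₀⟩
    exact Nat.cast_ne_zero.2 Fintype.card_ne_zero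
  have hF : ∀ t a : ℝ, F (t • (1 : Matrix X X ℂ), a) = w * t + a := fun t a => by
    simp only [F, LinearMap.coe_mk, AddHom.coe_mk, trace_smul, trace_one, Complex.real_smul]
    rw [Complex.re_ofReal_mul, Complex.natCast_re]
    field_simp
  have hdom : ∀ t a : ℝ, ((t • (1 : Matrix X X ℂ), a) : Matrix X X ℂ × ℝ) ∈ dom := fun t a =>
    ⟨Submodule.smul_mem _ _ (Submodule.mem_span_singleton_self _), trivial⟩
  have hermt : ∀ t : ℝ, herm (t • (1 : Matrix X X ℂ)) = t • (1 : Matrix X X ℂ) := fun t =>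
    herm_self (by rw [IsHermitian, conjTranspose_smul]; simp)
  -- For the domination hypothesis, a multiple of the identity makes the Hermitian part positive,
  -- hence a sum of rank-one terms realised by `rowOp`; the choice `-a` cancels the second
  -- component.
  obtain ⟨g, hg1, hg2⟩ := riesz_extension s (F.toPMap dom) (by
      rintro ⟨⟨H, a⟩, hH⟩ ⟨J, _, lab, T, h1, h2⟩
      obtain ⟨t, rfl⟩ := Submodule.mem_span_singleton.1 hH.1
      change 0 ≤ F (t • (1 : Matrix X X ℂ), a)
      rw [hF]
      have := hwt t J lab T (h1.trans (hermt t))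
      simp only at h2
      linarith) (by
      rintro ⟨H, a⟩
      have hh : (herm H).IsHermitian := by
        simp only [herm]
        rw [IsHermitian, conjTranspose_smul, conjTranspose_add, conjTranspose_conjTranspose,
          add_comm, star_trivial]
      obtain ⟨t, ht⟩ := exists_smul_one_add_posSemidef hh
      obtain ⟨m, v, hv⟩ := Matrix.posSemidef_iff_eq_sum_vecMulVec.1 ht
      refine ⟨⟨(t • (1 : Matrix X X ℂ), -a), hdom _ _⟩, Fin m, inferInstance, fun _ => γ₀,
        fun i => rowOp z₀ (v i), ?_, ?_⟩
      · simp only [rowOp_conjTranspose_mul_self, ← hv]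
        have h1 := hermt t
        simp only [herm, Prod.fst_add, conjTranspose_add] at h1 ⊢
        nth_rewrite 1 [← h1]
        rw [← smul_add]
        congr 1
        abel
      · simp only [Prod.snd_add, neg_add_cancel, zero_add]
        exact Finset.sum_nonneg fun _ _ => hq0 _ _)
  have hgt : ∀ t a : ℝ, g (t • (1 : Matrix X X ℂ), a) = w * t + a := fun t a => by
    rw [← hF]
    exact hg1 ⟨_, hdom t a⟩
  let G : Matrix X X ℂ →ₗ[ℝ] ℝ := g.comp (LinearMap.inl ℝ _ _)
  -- The pair `(Tᴴ * T, -q γ T)` lies in the cone, so the extended functional dominates the score.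
  have hGq : ∀ γ T, q γ T ≤ G (Tᴴ * T) := by
    intro γ T
    have h1 := hg2 (Tᴴ * T, -q γ T) ⟨Unit, inferInstance, fun _ => γ, fun _ => T, by
      simpa using (herm_self (isHermitian_conjTranspose_mul_self T)).symm, by simp⟩
    have h2 : g (Tᴴ * T, -q γ T) = G (Tᴴ * T) + g ((0 : ℝ) • (1 : Matrix X X ℂ), -q γ T) := by
      simp only [G, LinearMap.comp_apply, LinearMap.inl_apply, zero_smul, ← map_add]
      simp
    rw [h2, hgt] at h1
    linarith
  have hGstar : ∀ H : Matrix X X ℂ, G Hᴴ = G H := by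
    have hle : ∀ H : Matrix X X ℂ, 0 ≤ G (H - Hᴴ) := fun H =>
      hg2 _ ⟨Empty, inferInstance, Empty.elim, Empty.elim, by
        simp only [herm, Finset.univ_eq_empty, Finset.sum_empty, conjTranspose_sub,
          conjTranspose_conjTranspose, LinearMap.inl_apply]
        rw [sub_add_sub_cancel, sub_self, smul_zero], by simp⟩
    intro H
    have h1 := hle H
    have h2 := hle Hᴴ
    rw [conjTranspose_conjTranspose] at h2
    rw [map_sub] at h1 h2
    linarith
  -- The matrix that represents `G` as the real part of the trace against `Y`. It is Hermitian as
  -- `G` is invariant under conjugate transposition, and positive as `G` dominates non-negative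
  -- scores; a rank-one decomposition of it gives the vectors `y k`.
  let Y : Matrix X X ℂ := Matrix.of fun x x' =>
    ((G (Matrix.single x' x 1) : ℝ) : ℂ) - Complex.I * (G (Matrix.single x' x Complex.I) : ℝ)
  have hGY : ∀ H : Matrix X X ℂ, G H = (∑ x, ∑ x', Y x x' * H x' x).re := by
    intro H
    conv_lhs => rw [Matrix.matrix_eq_sum_single H]
    rw [Finset.sum_comm]
    simp only [map_sum, Complex.re_sum]
    refine Finset.sum_congr rfl fun x _ => Finset.sum_congr rfl fun x' _ => ?_
    have : Matrix.single x' x (H x' x) = (H x' x).re • Matrix.single x' x (1 : ℂ)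
        + (H x' x).im • Matrix.single x' x Complex.I := by
      rw [Matrix.smul_single, Matrix.smul_single, ← Matrix.single_add]
      congr 1
      simp [Complex.re_add_im]
    rw [this, map_add, map_smul, map_smul]
    simp [Y]
    ring
  have hY : Y.IsHermitian := by
    ext x x'
    have h1 := hGstar (Matrix.single x x' 1)
    have h2 := hGstar (Matrix.single x x' Complex.I)
    rw [conjTranspose_single] at h1 h2
    have h3 : Matrix.single x' x (star Complex.I) = -Matrix.single x' x Complex.I := by
      ext i j
      simp only [Matrix.single_apply, Matrix.neg_apply]
      split_ifs <;> simp
    rw [h3, map_neg] at h2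
    rw [star_one] at h1
    simp only [conjTranspose_apply, Y, Matrix.of_apply]
    rw [← h1, ← h2]
    simp [sub_eq_add_neg]
  have hYp : Y.PosSemidef := by
    refine .of_dotProduct_mulVec_nonneg hY fun v => ?_
    rw [Complex.nonneg_iff]
    refine ⟨?_, (hY.im_star_dotProduct_mulVec_self v).symm⟩
    have h1 := (hq0 γ₀ _).trans (hGq γ₀ (rowOp z₀ v))
    rw [rowOp_conjTranspose_mul_self, hGY] at h1
    have h2 : star v ⬝ᵥ (Y *ᵥ v) = ∑ x, ∑ x', Y x x' * vecMulVec v (star v) x' x := by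
      simp only [dotProduct, mulVec, Finset.mul_sum, vecMulVec_apply, Pi.star_apply]
      exact Finset.sum_congr rfl fun x _ => Finset.sum_congr rfl fun x' _ => by ring
    rw [h2]
    exact h1
  obtain ⟨m, y, hy⟩ := Matrix.posSemidef_iff_eq_sum_vecMulVec.1 hYp
  have hsum : ∀ {Z' : Type} [Fintype Z'] (T : Matrix Z' X ℂ),
      ∑ k, sqNorm (T *ᵥ y k) = G (Tᴴ * T) := by
    intro Z' _ T
    rw [hGY, ← Complex.ofReal_re (∑ k, sqNorm (T *ᵥ y k)), Complex.ofReal_sum, hy]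
    congr 1
    simp only [ofReal_sqNorm_mulVec, dotProduct, mulVec, Matrix.sum_apply, vecMulVec_apply,
      Finset.mul_sum, Finset.sum_mul, Pi.star_apply]
    rw [Finset.sum_comm]
    conv_rhs => rw [Finset.sum_comm]
    refine Finset.sum_congr rfl fun x _ => ?_
    rw [Finset.sum_comm]
    exact Finset.sum_congr rfl fun x' _ => Finset.sum_congr rfl fun k _ => by ring
  refine ⟨m, y, le_of_eq ?_, fun γ T => (hGq γ T).trans_eq (hsum T).symm⟩
  -- The total squared norm is the trace of `Y`, which is `G 1 = w`.
  have := hsum (1 : Matrix X X ℂ)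
  simp only [one_mulVec] at this
  rw [this, conjTranspose_one, Matrix.one_mul]
  have h1 := hgt 1 0
  rw [one_smul, mul_one, add_zero] at h1
  exact h1

end Duality

/-- The representative of the outcomes of the setup that have the same public view as `r`. -/
noncomputable def Scenario.rep (M : Scenario) (r : M.Rand) : M.Rand :=
  M.representative (Scenario.View.pub (M.bank r : M.View))

/-! ### Dual certificate for a single run -/

namespace Protocol

variable {M : Scenario} (K : Protocol M) {SA SB : Type} [Fintype SA] [DecidableEq SA]
  [Fintype SB] [DecidableEq SB]

/-- All classical data of one execution of the no-cloning game: the randomness of the setup, the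
instance, the coins of both verifiers, and the messages of both provers in the two phases. -/
abbrev Run : Type :=
  M.Rand × M.Id × (K.Coins × K.Coins) ×
    ((Fin K.agreeRounds → K.Msg) × (Fin K.proveRounds → K.Msg)) ×
    ((Fin K.agreeRounds → K.Msg) × (Fin K.proveRounds → K.Msg))

/-- The provers win in the given run. -/
def Wins (h : K.Run) : Prop :=
  (K.Agrees h.1 h.2.2.1.1 h.2.1 (List.ofFn h.2.2.2.1.1) ∧
    K.verdict (M.bank h.1) h.2.2.1.1 (List.ofFn h.2.2.2.1.1 ++ List.ofFn h.2.2.2.1.2) = true) ∧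
  (K.Agrees h.1 h.2.2.1.2 h.2.1 (List.ofFn h.2.2.2.2.1) ∧
    K.verdict (M.bank h.1) h.2.2.1.2 (List.ofFn h.2.2.2.2.1 ++ List.ofFn h.2.2.2.2.2) = true)

open Classical in
/-- The probability of the classical random choices in a run, restricted to the winning runs. -/
noncomputable def runWeight (h : K.Run) : ℝ :=
  if K.Wins h then
    (Fintype.card M.Rand : ℝ)⁻¹ * ((Fintype.card K.Coins : ℝ)⁻¹ * (Fintype.card K.Coins : ℝ)⁻¹)
  else 0

theorem runWeight_nonneg (h : K.Run) : 0 ≤ K.runWeight h := by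
  rw [runWeight]
  split_ifs <;> positivity

/-- The operator that describes the actions of one player. -/
def playerOp {S : Type} [Fintype S] [DecidableEq S] (A : Player M K.Msg S) (r : M.Rand)
    (c : K.Coins) (x : M.Id)
    (l : (Fin K.agreeRounds → K.Msg) × (Fin K.proveRounds → K.Msg)) : Matrix S S ℂ :=
  K.proveOp (A.prover x) (M.bank r) c x (List.ofFn l.1) (List.ofFn l.2) *
    K.agreeOp (A.prover x) (M.bank r) c x (List.ofFn l.1)

/-- The operator that describes the actions of both players. -/
def runOp (A : Player M K.Msg SA) (B : Player M K.Msg SB) (h : K.Run) :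
    Matrix (SA × SB) (SA × SB) ℂ :=
  Matrix.kroneckerMap (· * ·) (K.playerOp A h.1 h.2.2.1.1 h.2.1 h.2.2.2.1)
    (K.playerOp B h.1 h.2.2.1.2 h.2.1 h.2.2.2.2)

theorem sum_pairWeight_bothAccept (A : Player M K.Msg SA) (B : Player M K.Msg SB)
    (N : M.PubView → Matrix (SA × SB) M.Supply ℂ) :
    ∑ x, K.pairWeight (A.prover x) (B.prover x) x N (K.bothAccept (A.prover x) (B.prover x) x)
      = ∑ h : K.Run, K.runWeight h * sqNorm (K.runOp A B h *ᵥ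
          (N (Scenario.View.pub (M.bank h.1 : M.View)) *ᵥ M.supply h.1)) := by
  classical
  simp only [Fintype.sum_prod_type]
  rw [Finset.sum_comm]
  refine Finset.sum_congr rfl fun x _ => ?_
  rw [pairWeight, avg_eq_sum]
  refine Finset.sum_congr rfl fun r _ => ?_
  rw [avg_eq_sum, Finset.mul_sum]
  refine Finset.sum_congr rfl fun cA _ => ?_
  rw [avg_eq_sum, Finset.mul_sum, Finset.mul_sum]
  refine Finset.sum_congr rfl fun cB _ => ?_
  rw [Finset.mul_sum, Finset.mul_sum, Finset.mul_sum]
  refine Finset.sum_congr rfl fun a _ => ?_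
  rw [Finset.mul_sum, Finset.mul_sum, Finset.mul_sum]
  conv_rhs => rw [Finset.sum_comm]
  refine Finset.sum_congr rfl fun a' _ => ?_
  simp only [bothAccept]
  by_cases h : K.Agrees r cA x (List.ofFn a) ∧ K.Agrees r cB x (List.ofFn a')
  · rw [if_pos h, Finset.mul_sum, Finset.mul_sum, Finset.mul_sum]
    refine Finset.sum_congr rfl fun b _ => ?_
    rw [Finset.mul_sum, Finset.mul_sum, Finset.mul_sum]
    refine Finset.sum_congr rfl fun b' _ => ?_
    simp only [runWeight, Wins, h.1, h.2, true_and]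
    split_ifs
    · rw [mulVec_mulVec, mulVec_mulVec, runOp, playerOp, playerOp, kron_mul]
      simp only [Matrix.mul_assoc, mul_assoc]
    · simp
  · rw [if_neg h]
    simp only [mul_zero]
    refine (Finset.sum_eq_zero fun b _ => Finset.sum_eq_zero fun b' _ => ?_).symm
    rw [runWeight, if_neg, zero_mul]
    exact fun hw => h ⟨hw.1.1, hw.2.1⟩

/-- A dual certificate for the value of a single execution that is valid for all players from a
given collection. -/
theorem exists_run_certificate {Γ : Type} {w : ℝ} (hw0 : 0 ≤ w)
    (A : Γ → Player M K.Msg SA) (B : Γ → Player M K.Msg SB)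
    (hw : ∀ (J : Type) [Fintype J] (lab : J → Γ)
      (N : M.PubView → J → Matrix (SA × SB) M.Supply ℂ), (∀ p, Contractive (N p)) →
      ∑ j, ∑ x, K.pairWeight ((A (lab j)).prover x) ((B (lab j)).prover x) x (fun p => N p j)
        (K.bothAccept ((A (lab j)).prover x) ((B (lab j)).prover x) x) ≤ w) :
    ∃ (m : ℕ) (y : M.Rand → Fin m → M.Supply → ℂ), ∑ p, ∑ k, sqNorm (y p k) ≤ w ∧
      ∀ γ p (T : Matrix (SA × SB) M.Supply ℂ),
        (∑ h : K.Run, open Classical in if M.rep h.1 = p then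
          K.runWeight h * sqNorm (K.runOp (A γ) (B γ) h *ᵥ (T *ᵥ M.supply h.1)) else 0)
        ≤ ∑ k, sqNorm (T *ᵥ y p k) := by
  classical
  -- One matrix on `M.Supply × M.Rand` encodes a preparation for every public view: the second input
  -- factor selects the view through its representative. Duality for a single channel thus covers
  -- preparations that depend on the view.
  let slice (T : Matrix (SA × SB) (M.Supply × M.Rand) ℂ) (p : M.PubView) :
      Matrix (SA × SB) M.Supply ℂ := Matrix.of fun z f => T z (f, M.representative p)
  let q (γ : Γ) (T : Matrix (SA × SB) (M.Supply × M.Rand) ℂ) : ℝ :=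
    ∑ h : K.Run, K.runWeight h * sqNorm (K.runOp (A γ) (B γ) h *ᵥ
      (slice T (Scenario.View.pub (M.bank h.1 : M.View)) *ᵥ M.supply h.1))
  obtain ⟨m, y, hy1, hy2⟩ := exists_dual_certificate q
    (fun γ T => Finset.sum_nonneg fun h _ => mul_nonneg (K.runWeight_nonneg h) (sqNorm_nonneg _))
    (fun γ t T => by
      simp only [q, Finset.mul_sum]
      refine Finset.sum_congr rfl fun h _ => ?_
      have : slice (t • T) (Scenario.View.pub (M.bank h.1 : M.View))
          = (t : ℂ) • slice T (Scenario.View.pub (M.bank h.1 : M.View)) := by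
        ext z f
        simp [slice]
      rw [this, smul_mulVec, mulVec_smul, sqNorm_smul, Complex.normSq_ofReal]
      ring) hw0
    (fun J _ lab T hT => by
      have := hw J lab (fun p j => slice (T j) p) fun p v => by
        have h1 := sum_sqNorm_of_complete hT
          fun z => if z.2 = M.representative p then v z.1 else 0
        have h2 : sqNorm (fun z : M.Supply × M.Rand =>
            if z.2 = M.representative p then v z.1 else 0) = sqNorm v := by
          rw [sqNorm_prod_right, Finset.sum_eq_single (M.representative p)]
          · simp
          · intro b _ hb
            simp [hb, sqNorm]
          · simp
        rw [h2] at h1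
        refine le_of_eq (Eq.trans (Finset.sum_congr rfl fun j _ => congrArg sqNorm ?_) h1)
        funext z
        simp [slice, mulVec, dotProduct, Fintype.sum_prod_type]
      simpa only [sum_pairWeight_bothAccept, q] using this)
  refine ⟨m, fun p k f => y k (f, p), ?_, fun γ p T => ?_⟩
  · rw [Finset.sum_comm]
    simpa only [sqNorm_prod_right] using hy1
  -- Placing `T` in the slice `p`, with zero in the others, isolates the runs whose view is that of
  -- `p`.
  · have := hy2 γ (Matrix.of fun z f => if f.2 = p then T z f.1 else 0)
    refine le_of_eq_of_le (Finset.sum_congr rfl fun h _ => ?_) (this.trans_eq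
      (Finset.sum_congr rfl fun k _ => congrArg sqNorm (funext fun z => ?_)))
    · split_ifs with hp
      · congr 4
        ext z f
        simp only [slice, Matrix.of_apply]
        exact (if_pos hp).symm
      · have h0 : slice (Matrix.of fun z f => if f.2 = p then T z f.1 else 0)
            (Scenario.View.pub (M.bank h.1 : M.View)) = 0 := by
          ext z f
          simp only [slice, Matrix.of_apply]
          exact if_neg hp
        rw [h0, zero_mulVec, mulVec_zero, sqNorm_zero, mul_zero]
    · simp [mulVec, dotProduct, Fintype.sum_prod_type]

end Protocol

/-! ## Composition of dual certificates -/

/-- The product of operators that are applied one after the other. -/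
def seqOp {Z : Type} [Fintype Z] [DecidableEq Z] : (n : ℕ) → (Fin n → Matrix Z Z ℂ) → Matrix Z Z ℂ
  | 0, _ => 1
  | n + 1, W => W (Fin.last n) * seqOp n fun q => W q.castSucc

theorem kron_seqOp {Z Z' : Type} [Fintype Z] [DecidableEq Z] [Fintype Z'] [DecidableEq Z']
    (n : ℕ) (W : Fin n → Matrix Z Z ℂ) (W' : Fin n → Matrix Z' Z' ℂ) :
    Matrix.kroneckerMap (· * ·) (seqOp n W) (seqOp n W')
      = seqOp n fun q => Matrix.kroneckerMap (· * ·) (W q) (W' q) := by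
  induction n with
  | zero => exact Matrix.one_kronecker_one
  | succ n ih => rw [seqOp, seqOp, seqOp, kron_mul, ih]

theorem sum_snoc {n : ℕ} {H R : Type} [Fintype H] [AddCommMonoid R] (f : (Fin (n + 1) → H) → R) :
    ∑ h, f h = ∑ h' : Fin n → H, ∑ h₀, f (Fin.snoc (α := fun _ => H) h' h₀) := by
  rw [← (Fin.snocEquiv fun _ : Fin (n + 1) => H).sum_comp, Fintype.sum_prod_type,
    Finset.sum_comm]
  rfl

/-- Runs whose value is certified by `y` are executed one after the other, on the various tensor
factors of a state given by a multilinear map. -/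
theorem sum_seqOp_le {H R X Z : Type} [Fintype H] [Fintype R] [DecidableEq R] [Fintype X]
    [DecidableEq X] [Fintype Z] [DecidableEq Z] {m : ℕ} (ρ : H → R) (c : H → ℝ)
    (hc : ∀ h, 0 ≤ c h) (u : H → X → ℂ) (y : R → Fin m → X → ℂ) (n : ℕ)
    (Ψ : (Fin n → R) → MultilinearMap ℂ (fun _ : Fin n => X → ℂ) (Z → ℂ))
    (W : Fin n → (Fin n → R) → (Fin n → H) → Matrix Z Z ℂ)
    (hW : ∀ q p h h', (∀ j ≤ q, h j = h' j) → W q p h = W q p h')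
    (hy : ∀ q p h (T : Matrix Z X ℂ), (∑ h₀, if ρ h₀ = p q then
      c h₀ * sqNorm (W q p (Function.update h q h₀) *ᵥ (T *ᵥ u h₀)) else 0)
        ≤ ∑ k, sqNorm (T *ᵥ y (p q) k)) :
    ∑ h : Fin n → H, (∏ q, c (h q)) *
        sqNorm (seqOp n (fun q => W q (ρ ∘ h) h) *ᵥ Ψ (ρ ∘ h) (u ∘ h))
      ≤ ∑ p : Fin n → R, ∑ k : Fin n → Fin m, sqNorm (Ψ p fun q => y (p q) (k q)) := by
  -- The element `d` of `H` later serves as a dummy entry for the run that has been split off.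
  rcases isEmpty_or_nonempty H with hH | ⟨⟨d⟩⟩
  · rcases n with _ | n
    · rw [Fintype.sum_unique, Fintype.sum_unique, Fintype.sum_unique]
      simp only [seqOp, Finset.univ_eq_empty, Finset.prod_empty, one_mul, one_mulVec]
      refine le_of_eq (congrArg sqNorm ?_)
      congr 1
      · congr 1
        exact Subsingleton.elim _ _
      · exact Subsingleton.elim _ _
    · rw [Finset.univ_eq_empty, Finset.sum_empty]
      exact Finset.sum_nonneg fun _ _ => Finset.sum_nonneg fun _ _ => sqNorm_nonneg _
  induction n with
  | zero =>
    rw [Fintype.sum_unique, Fintype.sum_unique, Fintype.sum_unique]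
    simp only [seqOp, Finset.univ_eq_empty, Finset.prod_empty, one_mul, one_mulVec]
    refine le_of_eq (congrArg sqNorm ?_)
    congr 1
    · congr 1
      exact Subsingleton.elim _ _
    · exact Subsingleton.elim _ _
  | succ n ih =>
    -- The earlier runs. By `hW` they do not see the data of the last run, only its view `p₀`; hence
    -- the dummy `d`.
    let O (p₀ : R) (h' : Fin n → H) : Matrix Z Z ℂ := seqOp n fun q =>
      W q.castSucc (Fin.snoc (α := fun _ => R) (ρ ∘ h') p₀) (Fin.snoc (α := fun _ => H) h' d)
    -- The state after the earlier runs as a linear function of the last tensor factor. It plays the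
    -- role of the preparation in the last run.
    let T (p₀ : R) (h' : Fin n → H) : Matrix Z X ℂ := LinearMap.toMatrix'
      ((O p₀ h').mulVecLin ∘ₗ
        (Ψ (Fin.snoc (α := fun _ => R) (ρ ∘ h') p₀)).curryRight (u ∘ h'))
    have hT : ∀ p₀ h' v, T p₀ h' *ᵥ v = O p₀ h' *ᵥ
        Ψ (Fin.snoc (α := fun _ => R) (ρ ∘ h') p₀)
          (Fin.snoc (α := fun _ => X → ℂ) (u ∘ h') v) := by
      intro p₀ h' v
      rw [← Matrix.toLin'_apply, Matrix.toLin'_toMatrix']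
      rfl
    calc ∑ h : Fin (n + 1) → H, (∏ q, c (h q)) *
          sqNorm (seqOp (n + 1) (fun q => W q (ρ ∘ h) h) *ᵥ Ψ (ρ ∘ h) (u ∘ h))
        -- The sum is partitioned by the view of the last run, since `T` must be fixed before the
        -- certificate applies.
        = ∑ h' : Fin n → H, ∑ h₀, ∑ p₀, (∏ q, c (h' q)) * (if ρ h₀ = p₀ then c h₀ *
            sqNorm (W (Fin.last n) (Fin.snoc (α := fun _ => R) (ρ ∘ h') p₀)
              (Function.update (Fin.snoc (α := fun _ => H) h' d) (Fin.last n) h₀) *ᵥ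
                (T p₀ h' *ᵥ u h₀)) else 0) := by
          rw [sum_snoc]
          refine Finset.sum_congr rfl fun h' _ => Finset.sum_congr rfl fun h₀ _ => ?_
          rw [← Finset.mul_sum, Finset.sum_ite_eq, if_pos (Finset.mem_univ _),
            Fin.prod_univ_castSucc]
          simp only [Fin.snoc_castSucc, Fin.snoc_last, mul_assoc]
          congr 2
          have h1 : ρ ∘ (Fin.snoc (α := fun _ => H) h' h₀)
              = Fin.snoc (α := fun _ => R) (ρ ∘ h') (ρ h₀) := Fin.comp_snoc _ _ _
          have h2 : u ∘ (Fin.snoc (α := fun _ => H) h' h₀)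
              = Fin.snoc (α := fun _ => X → ℂ) (u ∘ h') (u h₀) := Fin.comp_snoc _ _ _
          rw [h1, h2, hT, Fin.update_snoc_last, seqOp, ← mulVec_mulVec]
          congr 4
          refine funext fun q => hW _ _ _ _ fun j hj => ?_
          have hjn : j ≠ Fin.last n := fun h => by
            rw [h] at hj
            exact absurd hj (not_le.2 (Fin.castSucc_lt_last q))
          obtain ⟨j', rfl⟩ := Fin.exists_castSucc_eq.2 hjn
          simp only [Fin.snoc_castSucc]
      -- The certificate replaces the actual last factor `u h₀` by the vectors `y p₀ k`, and the
      -- last run disappears.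
      _ ≤ ∑ h' : Fin n → H, ∑ p₀, (∏ q, c (h' q)) * ∑ k, sqNorm (T p₀ h' *ᵥ y p₀ k) := by
          refine Finset.sum_le_sum fun h' _ => ?_
          rw [Finset.sum_comm]
          refine Finset.sum_le_sum fun p₀ _ => ?_
          rw [← Finset.mul_sum]
          refine mul_le_mul_of_nonneg_left ?_ (Finset.prod_nonneg fun _ _ => hc _)
          have := hy (Fin.last n) (Fin.snoc (α := fun _ => R) (ρ ∘ h') p₀)
            (Fin.snoc (α := fun _ => H) h' d) (T p₀ h')
          simpa only [Fin.snoc_last] using this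
      _ = ∑ p₀, ∑ k, ∑ h' : Fin n → H, (∏ q, c (h' q)) * sqNorm (O p₀ h' *ᵥ
            Ψ (Fin.snoc (α := fun _ => R) (ρ ∘ h') p₀)
              (Fin.snoc (α := fun _ => X → ℂ) (u ∘ h') (y p₀ k))) := by
          rw [Finset.sum_comm]
          refine Finset.sum_congr rfl fun p₀ _ => ?_
          rw [Finset.sum_comm]
          refine Finset.sum_congr rfl fun h' _ => ?_
          rw [Finset.mul_sum]
          exact Finset.sum_congr rfl fun k _ => by rw [hT]
      _ ≤ ∑ p₀, ∑ k, ∑ p : Fin n → R, ∑ k' : Fin n → Fin m,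
            sqNorm (Ψ (Fin.snoc (α := fun _ => R) p p₀)
              (Fin.snoc (α := fun _ => X → ℂ) (fun q => y (p q) (k' q)) (y p₀ k))) := by
          refine Finset.sum_le_sum fun p₀ _ => Finset.sum_le_sum fun k _ => ?_
          -- Induction with the last factor frozen at `y p₀ k` and the last view at `p₀`.
          refine ih (fun p => (LinearMap.applyₗ (y p₀ k)).compMultilinearMap
            (Ψ (Fin.snoc (α := fun _ => R) p p₀)).curryRight)
            (fun q p h => W q.castSucc (Fin.snoc (α := fun _ => R) p p₀)
              (Fin.snoc (α := fun _ => H) h d)) (fun q p h h' hh => ?_) fun q p h T' => ?_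
          · refine hW _ _ _ _ fun j hj => ?_
            have hjn : j ≠ Fin.last n := fun h => by
              rw [h] at hj
              exact absurd hj (not_le.2 (Fin.castSucc_lt_last q))
            obtain ⟨j', rfl⟩ := Fin.exists_castSucc_eq.2 hjn
            simp only [Fin.snoc_castSucc]
            exact hh j' (Fin.castSucc_le_castSucc_iff.1 hj)
          · have := hy q.castSucc (Fin.snoc (α := fun _ => R) p p₀)
              (Fin.snoc (α := fun _ => H) h d) T'
            simpa only [Fin.snoc_castSucc, ← Fin.snoc_update] using this
      _ = _ := by
          symm
          rw [sum_snoc, Finset.sum_comm]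
          refine Finset.sum_congr rfl fun p₀ _ => ?_
          conv_rhs => rw [Finset.sum_comm]
          refine Finset.sum_congr rfl fun p _ => ?_
          rw [sum_snoc, Finset.sum_comm]
          refine Finset.sum_congr rfl fun k _ => Finset.sum_congr rfl fun k' _ => ?_
          congr 2
          funext q
          induction q using Fin.lastCases with
          | last => simp only [Fin.snoc_last]
          | cast q => simp only [Fin.snoc_castSucc]

/-! ## Messages of repeated executions -/

section Messages

variable {Msg : Type}

/-- The messages of a run, from those of its two phases. -/
def joinPhases {k l : ℕ} (m : (Fin k → Msg) × (Fin l → Msg)) : List Msg :=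
  List.ofFn m.1 ++ List.ofFn m.2

/-- All messages of a sequence of runs. -/
def joinRuns {k l n : ℕ} (m : Fin n → (Fin k → Msg) × (Fin l → Msg)) : List Msg :=
  (List.ofFn fun q => joinPhases (m q)).flatten

@[simp] theorem length_joinPhases {k l : ℕ} (m : (Fin k → Msg) × (Fin l → Msg)) :
    (joinPhases m).length = k + l := by simp [joinPhases]

theorem joinRuns_succ {k l n : ℕ} (m : Fin (n + 1) → (Fin k → Msg) × (Fin l → Msg)) :
    joinRuns m = joinRuns (fun q : Fin n => m q.castSucc) ++ joinPhases (m (Fin.last n)) := by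
  rw [joinRuns, List.ofFn_succ', List.concat_eq_append, List.flatten_append]
  simp [joinRuns]

theorem joinRuns_succ' {k l n : ℕ} (m : Fin (n + 1) → (Fin k → Msg) × (Fin l → Msg)) :
    joinRuns m = joinPhases (m 0) ++ joinRuns (fun q : Fin n => m q.succ) := by
  simp [joinRuns, List.ofFn_succ]

@[simp] theorem length_joinRuns {k l n : ℕ} (m : Fin n → (Fin k → Msg) × (Fin l → Msg)) :
    (joinRuns m).length = n * (k + l) := by
  induction n with
  | zero => simp [joinRuns]
  | succ n ih => rw [joinRuns_succ, List.length_append, ih, length_joinPhases, Nat.succ_mul]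

theorem take_drop_joinRuns {k l n : ℕ} (m : Fin n → (Fin k → Msg) × (Fin l → Msg)) (q : Fin n) :
    ((joinRuns m).drop (q * (k + l))).take (k + l) = joinPhases (m q) := by
  induction n with
  | zero => exact q.elim0
  | succ n ih =>
    rw [joinRuns_succ']
    induction q using Fin.cases with
    | zero => simp
    | succ q =>
      rw [Fin.val_succ, Nat.succ_mul, Nat.add_comm (q * (k + l)), ← List.drop_drop,
        List.drop_left' (by simp)]
      exact ih _ q

variable [Fintype Msg] {R : Type} [AddCommMonoid R]

theorem sum_ofFn_append (f : List Msg → R) (k l : ℕ) :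
    ∑ a : Fin (k + l) → Msg, f (List.ofFn a)
      = ∑ m : (Fin k → Msg) × (Fin l → Msg), f (joinPhases m) := by
  rw [← (Fin.appendEquiv k l).sum_comp]
  refine Finset.sum_congr rfl fun m _ => ?_
  rw [joinPhases, ← List.ofFn_fin_append]
  rfl

theorem sum_ofFn_joinRuns (f : List Msg → R) (k l n N : ℕ) (hN : N = n * (k + l)) :
    ∑ a : Fin N → Msg, f (List.ofFn a)
      = ∑ m : Fin n → (Fin k → Msg) × (Fin l → Msg), f (joinRuns m) := by
  induction n generalizing N f with
  | zero =>
    rw [Nat.zero_mul] at hN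
    subst hN
    simp [joinRuns]
  | succ n ih =>
    rw [Nat.succ_mul] at hN
    subst hN
    rw [sum_ofFn_append, Fintype.sum_prod_type, sum_snoc]
    simp only [joinPhases]
    rw [ih (fun a => ∑ b : Fin (k + l) → Msg, f (a ++ List.ofFn b)) _ rfl]
    refine Finset.sum_congr rfl fun m _ => ?_
    rw [sum_ofFn_append (fun b => f (joinRuns m ++ b))]
    refine Finset.sum_congr rfl fun m₀ _ => ?_
    rw [joinRuns_succ]
    simp only [Fin.snoc_castSucc, Fin.snoc_last]

/-- The agree phase of the repeated protocol consists of `n` complete runs and one more agree phase,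
and its prove phase is one original prove phase; together they form a family of `n + 1` complete
runs. -/
theorem sum_messages (f : List Msg → List Msg → R) (k l n N : ℕ) (hN : N = n * (k + l) + k) :
    ∑ a : Fin N → Msg, ∑ b : Fin l → Msg, f (List.ofFn a) (List.ofFn b)
      = ∑ m : Fin (n + 1) → (Fin k → Msg) × (Fin l → Msg),
        f (joinRuns (fun q : Fin n => m q.castSucc) ++ List.ofFn (m (Fin.last n)).1)
          (List.ofFn (m (Fin.last n)).2) := by
  subst hN
  rw [sum_ofFn_append (fun a => ∑ b : Fin l → Msg, f a (List.ofFn b)), Fintype.sum_prod_type,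
    sum_snoc]
  simp only [joinPhases]
  rw [sum_ofFn_joinRuns (fun a => ∑ a' : Fin k → Msg, ∑ b : Fin l → Msg,
    f (a ++ List.ofFn a') (List.ofFn b)) k l n _ rfl]
  refine Finset.sum_congr rfl fun m _ => ?_
  rw [Fintype.sum_prod_type]
  simp only [Fin.snoc_castSucc, Fin.snoc_last]

end Messages

theorem allSome_eq_some_iff {n : ℕ} {X : Type} (f : Fin n → Option X) (x : Fin n → X) :
    allSome f = some x ↔ ∀ q, f q = some (x q) := by
  rw [allSome]
  constructor
  · intro h q
    split_ifs at h with h'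
    rw [← Option.some_injective _ h, Option.some_get]
  · intro h
    rw [dif_pos fun q => by rw [h q]; rfl]
    congr 1
    funext q
    simp [h q]

/-! ## Decomposition of the sequential repetition into runs -/

theorem interact_joinRuns {S Msg : Type} [Fintype S] [DecidableEq S] [Fintype Msg]
    [DecidableEq Msg] {k l : ℕ}
    (n : ℕ) (ask : List Msg → Msg) (U : ℕ → Matrix (S × Msg) (S × Msg) ℂ)
    (m : Fin n → (Fin k → Msg) × (Fin l → Msg)) :
    interact ask U [] (joinRuns m) = seqOp n fun q =>
      interact (fun g => ask (joinRuns (fun j : Fin q => m (j.castLE q.2.le)) ++ g))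
        (fun i => U (q * (k + l) + i)) [] (joinPhases (m q)) := by
  induction n with
  | zero => rfl
  | succ n ih =>
    rw [joinRuns_succ, interact_append, seqOp, ih]
    congr 1
    have := interact_shift ask U (joinRuns fun q : Fin n => m q.castSucc) []
      (joinPhases (m (Fin.last n)))
    rw [List.append_nil, length_joinRuns] at this
    exact this

namespace Protocol

variable {M : Scenario} (K : Protocol M) {N : ℕ}

theorem runMsgs_joinRuns {n : ℕ} (m : Fin n →
    (Fin K.agreeRounds → K.Msg) × (Fin K.proveRounds → K.Msg)) (q : Fin n) :
    K.runMsgs q (joinRuns m) = joinPhases (m q) :=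
  take_drop_joinRuns m q

/-- The messages of the agree phase of the repeated protocol. -/
def agreeMsgs (m : Fin (N + 1) →
    (Fin K.agreeRounds → K.Msg) × (Fin K.proveRounds → K.Msg)) : List K.Msg :=
  joinRuns (fun q : Fin N => m q.castSucc) ++ List.ofFn (m (Fin.last N)).1

theorem agreeMsgs_append (m : Fin (N + 1) →
    (Fin K.agreeRounds → K.Msg) × (Fin K.proveRounds → K.Msg)) :
    K.agreeMsgs m ++ List.ofFn (m (Fin.last N)).2 = joinRuns m := by
  rw [joinRuns_succ, agreeMsgs, List.append_assoc]
  rfl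

theorem length_agreeMsgs (m : Fin (N + 1) →
    (Fin K.agreeRounds → K.Msg) × (Fin K.proveRounds → K.Msg)) :
    (K.agreeMsgs m).length = N * K.rounds + K.agreeRounds := by
  simp [agreeMsgs]

/-- At the end of the repeated agree phase the last run still lacks its prove messages, but the part
from which its instance is read is complete. -/
theorem take_runMsgs_agreeMsgs (m : Fin (N + 1) →
    (Fin K.agreeRounds → K.Msg) × (Fin K.proveRounds → K.Msg)) (q : Fin (N + 1)) :
    (K.runMsgs q (K.agreeMsgs m)).take K.agreeRounds = List.ofFn (m q).1 := by
  have hq : q * K.rounds ≤ N * K.rounds := Nat.mul_le_mul_right _ (Nat.le_of_lt_succ q.2)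
  have h1 : (K.runMsgs q (joinRuns m)).take K.agreeRounds = List.ofFn (m q).1 := by
    rw [runMsgs_joinRuns, joinPhases, List.take_left' (by simp)]
  have hl := K.length_agreeMsgs m
  rw [← h1, ← K.agreeMsgs_append m, runMsgs, runMsgs, List.take_take, List.take_take,
    List.drop_append_of_le_length (by rw [hl]; omega), List.take_append_of_le_length]
  rw [List.length_drop, hl]
  have : min K.agreeRounds K.rounds ≤ K.agreeRounds := min_le_left _ _
  omega

/-- The behaviour of the verifier in run number `q`. -/
theorem sequential_ask {n : ℕ} (D : (M.power n).View) (c : Fin n → K.Coins) (q : Fin n)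
    (m : Fin q → (Fin K.agreeRounds → K.Msg) × (Fin K.proveRounds → K.Msg)) (g : List K.Msg)
    (hg : g.length < K.rounds) :
    (K.sequential n).ask D c (joinRuns m ++ g) = K.ask (Scenario.compView D q) (c q) g := by
  have hl : (joinRuns m ++ g).length / K.rounds = q := by
    rw [List.length_append, length_joinRuns]
    exact Nat.div_eq_of_lt_le (by simp) (by rw [Nat.succ_mul]; simpa using hg)
  have hm : K.runMsgs q (joinRuns m ++ g) = g := by
    rw [runMsgs, List.drop_left' (by simp), List.take_of_length_le hg.le]
  have : (K.sequential n).ask D c (joinRuns m ++ g) =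
      if h : (joinRuns m ++ g).length / K.rounds < n then
      K.ask (Scenario.compView D ⟨(joinRuns m ++ g).length / K.rounds, h⟩)
        (c ⟨(joinRuns m ++ g).length / K.rounds, h⟩)
        (K.runMsgs ((joinRuns m ++ g).length / K.rounds) (joinRuns m ++ g))
      else default := rfl
  rw [this]
  simp only [hl, hm, q.2, dif_pos]
  rfl

theorem power_valid {n : ℕ} (r : Fin n → M.Rand) (x : Fin n → M.Id) :
    (M.power n).Valid r x ↔ ∀ q, M.Valid (r q) (x q) :=
  ⟨fun h q k => h (q, k), fun h k => h k.1 k.2⟩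

theorem sequential_agrees (r : Fin (N + 1) → M.Rand) (c : Fin (N + 1) → K.Coins)
    (x : Fin (N + 1) → M.Id) (m : Fin (N + 1) →
      (Fin K.agreeRounds → K.Msg) × (Fin K.proveRounds → K.Msg)) :
    (K.sequential (N + 1)).Agrees r c x (K.agreeMsgs m)
      ↔ ∀ q, K.Agrees (r q) (c q) (x q) (List.ofFn (m q).1) := by
  have h1 : (K.sequential (N + 1)).inst ((M.power (N + 1)).bank r) c (K.agreeMsgs m)
      = allSome fun q : Fin (N + 1) => K.inst (M.bank (r q)) (c q) (List.ofFn (m q).1) := by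
    change allSome (fun q : Fin (N + 1) => K.inst (M.bank (r q)) (c q)
      ((K.runMsgs q (K.agreeMsgs m)).take K.agreeRounds)) = _
    simp only [take_runMsgs_agreeMsgs]
  simp only [Agrees, forall_and]
  rw [h1, ← power_valid]
  exact and_congr_left fun _ => allSome_eq_some_iff _ _

theorem sequential_verdict (r : Fin (N + 1) → M.Rand) (c : Fin (N + 1) → K.Coins)
    (m : Fin (N + 1) → (Fin K.agreeRounds → K.Msg) × (Fin K.proveRounds → K.Msg)) :
    (K.sequential (N + 1)).verdict ((M.power (N + 1)).bank r) c
        (K.agreeMsgs m ++ List.ofFn (m (Fin.last N)).2) = true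
      ↔ ∀ q, K.verdict (M.bank (r q)) (c q) (List.ofFn (m q).1 ++ List.ofFn (m q).2) = true := by
  rw [agreeMsgs_append]
  change decide (∀ q : Fin (N + 1), K.verdict (M.bank (r q)) (c q)
    (K.runMsgs q (joinRuns m)) = true) = true ↔ _
  simp only [runMsgs_joinRuns, decide_eq_true_eq]
  rfl

theorem interact_agreeMsgs {S : Type} [Fintype S] [DecidableEq S] (ask : List K.Msg → K.Msg)
    (U : ℕ → Matrix (S × K.Msg) (S × K.Msg) ℂ) (m : Fin (N + 1) →
      (Fin K.agreeRounds → K.Msg) × (Fin K.proveRounds → K.Msg)) :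
    interact ask U [] (K.agreeMsgs m)
      = interact (fun g => ask (joinRuns (fun q : Fin N => m q.castSucc) ++ g))
          (fun i => U (N * K.rounds + i)) [] (List.ofFn (m (Fin.last N)).1) *
        seqOp N fun q => interact
          (fun g => ask (joinRuns (fun j : Fin q => m (j.castLE q.2.le).castSucc) ++ g))
          (fun i => U (q * K.rounds + i)) [] (joinPhases (m q.castSucc)) := by
  rw [agreeMsgs, interact_append, interact_joinRuns, List.nil_append]
  congr 1
  have := interact_shift ask U (joinRuns fun q : Fin N => m q.castSucc) []
    (List.ofFn (m (Fin.last N)).1)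
  rwa [List.append_nil, length_joinRuns] at this

/-- The operator of the agree phase of the repeated protocol. -/
theorem sequential_agreeOp (P : Prover (M.power (N + 1)) K.Msg) (D : (M.power (N + 1)).View)
    (c : Fin (N + 1) → K.Coins) (x : (M.power (N + 1)).Id)
    (m : Fin (N + 1) → (Fin K.agreeRounds → K.Msg) × (Fin K.proveRounds → K.Msg)) :
    (K.sequential (N + 1)).agreeOp P D c x (K.agreeMsgs m)
      = Matrix.diagonal (fun s => if P.out s = some x then 1 else 0) *
        (interact (K.ask (Scenario.compView D (Fin.last N)) (c (Fin.last N)))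
          (fun i => (P.agree D.pub (N * K.rounds + i) :
            Matrix (P.S × K.Msg) (P.S × K.Msg) ℂ)) [] (List.ofFn (m (Fin.last N)).1) *
        seqOp N fun q => interact (K.ask (Scenario.compView D q.castSucc) (c q.castSucc))
          (fun i => (P.agree D.pub (q * K.rounds + i) :
            Matrix (P.S × K.Msg) (P.S × K.Msg) ℂ)) [] (joinPhases (m q.castSucc))) := by
  unfold agreeOp
  refine congrArg _ ((K.interact_agreeMsgs _ _ m).trans ?_)
  congr 1
  · refine interact_congr rfl _ (fun g hg => ?_) fun _ _ => rfl
    have hg' : g.length < K.agreeRounds := hg.trans_eq List.length_ofFn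
    exact K.sequential_ask D c (Fin.last N) _ g (hg'.trans_le (Nat.le_add_right _ _))
  · refine congrArg (seqOp N) (funext fun q => ?_)
    refine interact_congr rfl _ (fun g hg => ?_) fun _ _ => rfl
    exact K.sequential_ask D c q.castSucc _ g (hg.trans_eq (length_joinPhases _))

/-- The operator of the prove phase of the repeated protocol. -/
theorem sequential_proveOp (P : Prover (M.power (N + 1)) K.Msg) (D : (M.power (N + 1)).View)
    (c : Fin (N + 1) → K.Coins) (x : (M.power (N + 1)).Id)
    (m : Fin (N + 1) → (Fin K.agreeRounds → K.Msg) × (Fin K.proveRounds → K.Msg)) :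
    (K.sequential (N + 1)).proveOp P D c x (K.agreeMsgs m) (List.ofFn (m (Fin.last N)).2)
      = interact (fun g => K.ask (Scenario.compView D (Fin.last N)) (c (Fin.last N))
          (List.ofFn (m (Fin.last N)).1 ++ g))
        (fun i => (P.prove D.pub x i : Matrix (P.S × K.Msg) (P.S × K.Msg) ℂ)) []
        (List.ofFn (m (Fin.last N)).2) := by
  refine interact_congr rfl _ (fun g hg => ?_) fun _ _ => rfl
  have hg' : g.length < K.proveRounds := hg.trans_eq List.length_ofFn
  refine (congrArg ((K.sequential (N + 1)).ask D c) (List.append_assoc _ _ _)).trans ?_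
  exact K.sequential_ask D c (Fin.last N) _ _
    (by
      refine List.length_append.trans_lt ?_
      rw [List.length_ofFn]
      exact Nat.add_lt_add_left hg' _)

end Protocol

/-! ### The runs of a repeated strategy as single-run strategies -/

namespace Protocol

variable {M : Scenario} (K : Protocol M) {N : ℕ}

/-- Replace the instance of run number `q`. -/
noncomputable def setInst {n : ℕ} (x : Fin n → M.Id) (q : Fin n) (x₀ : M.Id) : (M.power n).Id :=
  Function.update x q x₀

theorem setInst_update {n : ℕ} (x : Fin n → M.Id) (q : Fin n) (x₀ x₁ : M.Id) :
    setInst (Function.update x q x₀) q x₁ = setInst x q x₁ :=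
  Function.update_idem ..

theorem setInst_self {n : ℕ} (x : (M.power n).Id) (q : Fin n) : setInst x q (x q) = x :=
  Function.update_eq_self (β := fun _ => M.Id) q x

/-- The behaviour of a prover of the repeated protocol in run number `q`, when the public view is
that of `p` and the instances of the other runs are given by `x`. -/
noncomputable def runPlayer (P : Prover (M.power (N + 1)) K.Msg) (q : Fin (N + 1)) (p : Fin (N + 1) → M.Rand)
    (x : Fin (N + 1) → M.Id) : Player M K.Msg P.S where
  agree _ i := P.agree (Scenario.View.pub ((M.power (N + 1)).bank p : (M.power (N + 1)).View))
    (q * K.rounds + i)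
  -- A prover of the repeated protocol outputs its tuple only at the end of the last agree phase, so
  -- earlier runs impose no test on the prover's register.
  ok x₀ s := if q = Fin.last N then
    decide (P.out s = some (setInst x q x₀)) else true
  -- In the earlier runs the original prove rounds still belong to the repeated agree phase, at
  -- offset `K.agreeRounds` within the run.
  prove _ x₀ i := if q = Fin.last N then
    P.prove (Scenario.View.pub ((M.power (N + 1)).bank p : (M.power (N + 1)).View))
      (setInst x q x₀) i
    else P.agree (Scenario.View.pub ((M.power (N + 1)).bank p : (M.power (N + 1)).View))
      (q * K.rounds + (K.agreeRounds + i))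

/-- The strategy in a run does not depend on that run's own entry of `x`, so the certificate is used
with one fixed label while the run varies. -/
theorem runPlayer_update (P : Prover (M.power (N + 1)) K.Msg) (q : Fin (N + 1))
    (p : Fin (N + 1) → M.Rand) (x : Fin (N + 1) → M.Id) (x₀ : M.Id) :
    K.runPlayer P q p (Function.update x q x₀) = K.runPlayer P q p x := by
  simp only [runPlayer, setInst_update]

/-- The tuple of instances matters only in the last run, by which time all of its entries belong to
runs `j ≤ q`: this is the causality hypothesis `hW` of `sum_seqOp_le`. -/
theorem runPlayer_congr (P : Prover (M.power (N + 1)) K.Msg) (q : Fin (N + 1))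
    (p : Fin (N + 1) → M.Rand) {x x' : Fin (N + 1) → M.Id} (h : ∀ j ≤ q, x j = x' j) :
    K.runPlayer P q p x = K.runPlayer P q p x' := by
  by_cases hq : q = Fin.last N
  · subst hq
    rw [show x = x' from funext fun j => h j (Fin.le_last j)]
  · simp only [runPlayer, if_neg hq]

/-- The projection onto the output tuple and the repeated prove phase join the last run; in the
earlier runs the two phases are glued from consecutive rounds of the repeated agree phase. -/
theorem sequential_mul_agreeOp (P : Prover (M.power (N + 1)) K.Msg)
    (r p : Fin (N + 1) → M.Rand)
    (hp : Scenario.View.pub ((M.power (N + 1)).bank r : (M.power (N + 1)).View)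
      = Scenario.View.pub ((M.power (N + 1)).bank p : (M.power (N + 1)).View))
    (c : Fin (N + 1) → K.Coins) (x : (M.power (N + 1)).Id)
    (m : Fin (N + 1) → (Fin K.agreeRounds → K.Msg) × (Fin K.proveRounds → K.Msg)) :
    (K.sequential (N + 1)).proveOp P ((M.power (N + 1)).bank r) c x (K.agreeMsgs m)
        (List.ofFn (m (Fin.last N)).2) *
      (K.sequential (N + 1)).agreeOp P ((M.power (N + 1)).bank r) c x (K.agreeMsgs m)
    = seqOp (N + 1) fun q =>
      K.playerOp (K.runPlayer P q p x) (r q) (c q) (x q) (m q) := by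
  rw [sequential_agreeOp, sequential_proveOp, seqOp, ← Matrix.mul_assoc, ← Matrix.mul_assoc, hp]
  congr 1
  · rw [playerOp, proveOp, agreeOp, ← Matrix.mul_assoc]
    congr 1
    · congr 1
      · refine interact_congr rfl _ (fun g _ => rfl) fun i _ => ?_
        simp only [runPlayer, if_pos, setInst_self]
      · congr 1
        funext s
        simp only [runPlayer, if_pos, setInst_self]
        simp
  · congr 1
    funext q
    have hq : q.castSucc ≠ Fin.last N := (Fin.castSucc_lt_last q).ne
    have h1 : Matrix.diagonal (fun s => if ((K.runPlayer P q.castSucc p x).prover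
        (x q.castSucc)).out s = some (x q.castSucc) then (1 : ℂ) else 0) = 1 := by
      simp only [runPlayer, if_neg hq, if_true]
      exact Matrix.diagonal_one
    rw [playerOp, proveOp, agreeOp, h1, Matrix.one_mul, joinPhases, interact_append]
    congr 1
    have := interact_shift (K.ask (M.bank (r q.castSucc)) (c q.castSucc))
      (fun i => (P.agree (Scenario.View.pub ((M.power (N + 1)).bank p : (M.power (N + 1)).View))
        (q * K.rounds + i) : Matrix (P.S × K.Msg) (P.S × K.Msg) ℂ))
      (List.ofFn (m q.castSucc).1) [] (List.ofFn (m q.castSucc).2)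
    rw [List.append_nil] at this
    refine this.trans (interact_congr rfl _ (fun g _ => rfl) fun i _ => ?_)
    simp only [runPlayer, if_neg hq, List.length_ofFn, Fin.val_castSucc, List.length_nil,
      Nat.zero_add]

end Protocol

/-- The tensor product of the states of `n` families of registers. -/
def tensorState {n : ℕ} {ν β : Type} :
    MultilinearMap ℂ (fun _ : Fin n => (ν → β) → ℂ) ((Fin n × ν → β) → ℂ) :=
  MultilinearMap.pi fun f => (MultilinearMap.mkPiAlgebra ℂ (Fin n) ℂ).compLinearMap
    fun q => LinearMap.proj fun i => f (q, i)

theorem tensorState_apply {n : ℕ} {ν β : Type} (v : Fin n → (ν → β) → ℂ) (f : Fin n × ν → β) :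
    tensorState v f = ∏ q, v q fun i => f (q, i) := by
  simp [tensorState]

theorem sqNorm_tensorState {n : ℕ} {ν β : Type} [Fintype ν] [DecidableEq ν] [Fintype β]
    (v : Fin n → (ν → β) → ℂ) : sqNorm (tensorState v) = ∏ q, sqNorm (v q) := by
  rw [← sqNorm_pi, ← sqNorm_comp_equiv (Equiv.curry (Fin n) ν β)]
  exact congrArg sqNorm (funext fun f => tensorState_apply v f)

theorem Scenario.power_supply (M : Scenario) {n : ℕ} (r : Fin n → M.Rand) :
    (M.power n).supply r = tensorState fun q => M.supply (r q) := by
  funext f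
  exact (Fintype.prod_prod_type _).trans (tensorState_apply (fun q => M.supply (r q)) f).symm

theorem sum_pi_prod {n : ℕ} {X Y R : Type} [Fintype X] [Fintype Y] [AddCommMonoid R]
    (f : (Fin n → X × Y) → R) :
    ∑ h, f h = ∑ x : Fin n → X, ∑ y : Fin n → Y, f fun q => (x q, y q) := by
  rw [← (Equiv.arrowProdEquivProdArrow (Fin n) (fun _ => X) (fun _ => Y)).symm.sum_comp,
    Fintype.sum_prod_type]
  rfl

/-! ### The repeated game as a sum over families of runs -/

namespace Protocol

variable {M : Scenario} (K : Protocol M) {N : ℕ}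

theorem sum_runs {n : ℕ} (f : (Fin n → K.Run) → ℝ) :
    ∑ h, f h = ∑ r : Fin n → M.Rand, ∑ cA : Fin n → K.Coins, ∑ cB : Fin n → K.Coins,
      ∑ x : Fin n → M.Id,
      ∑ m : Fin n → (Fin K.agreeRounds → K.Msg) × (Fin K.proveRounds → K.Msg),
      ∑ m' : Fin n → (Fin K.agreeRounds → K.Msg) × (Fin K.proveRounds → K.Msg),
        f fun q => (r q, x q, (cA q, cB q), m q, m' q) := by
  rw [sum_pi_prod]
  refine Finset.sum_congr rfl fun r _ => ?_
  rw [sum_pi_prod]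
  refine Eq.trans (Finset.sum_congr rfl fun x _ => (sum_pi_prod _).trans (sum_pi_prod _)) ?_
  rw [Finset.sum_comm]
  refine Finset.sum_congr rfl fun cA _ => ?_
  rw [Finset.sum_comm]
  exact Finset.sum_congr rfl fun cB _ => Finset.sum_congr rfl fun x _ => sum_pi_prod _

theorem prod_runWeight (h : Fin (N + 1) → K.Run) : ∏ q, K.runWeight (h q)
    = open Classical in if ∀ q, K.Wins (h q) then
      (Fintype.card (Fin (N + 1) → M.Rand) : ℝ)⁻¹ *
        ((Fintype.card (Fin (N + 1) → K.Coins) : ℝ)⁻¹ *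
          (Fintype.card (Fin (N + 1) → K.Coins) : ℝ)⁻¹) else 0 := by
  classical
  simp only [runWeight]
  rw [Finset.prod_ite_zero]
  simp [mul_pow]

/-- The public view of the product is determined by those of the copies, so provers and input
generator see no difference if each copy is replaced by its representative. -/
theorem pub_rep {n : ℕ} (r : Fin n → M.Rand) :
    Scenario.View.pub ((M.power n).bank r : (M.power n).View)
      = Scenario.View.pub ((M.power n).bank fun q => M.rep (r q) : (M.power n).View) :=
  funext fun z => (congrFun (M.pub_representative (r z.1)) z.2).symm

/-- The game against the repeated protocol in terms of its runs. -/
theorem cloneGameProb_sequential (A B : Prover (M.power (N + 1)) K.Msg)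
    (I : InputGen (M.power (N + 1)) (A.S × B.S)) :
    (K.sequential (N + 1)).cloneGameProb A B I
      = ∑ j, ∑ h : Fin (N + 1) → K.Run, (∏ q, K.runWeight (h q)) *
        sqNorm (seqOp (N + 1) (fun q => K.runOp
            (K.runPlayer A q (fun i => M.rep (h i).1) fun i => (h i).2.1)
            (K.runPlayer B q (fun i => M.rep (h i).1) fun i => (h i).2.1) (h q)) *ᵥ
          (I.kraus (Scenario.View.pub ((M.power (N + 1)).bank fun i => M.rep (h i).1 :
            (M.power (N + 1)).View)) j *ᵥ tensorState fun q => M.supply (h q).1)) := by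
  classical
  rw [Finset.sum_comm, sum_runs]
  unfold cloneGameProb
  refine (avg_eq_sum _).trans (Finset.sum_congr rfl fun r _ => ?_)
  refine (congrArg _ (avg_eq_sum _)).trans ((Finset.mul_sum _ _ _).trans
    (Finset.sum_congr rfl fun cA _ => ?_))
  refine (congrArg (fun z : ℝ => _ * (_ * z)) (avg_eq_sum _)).trans ?_
  simp only [Finset.mul_sum (a := (Fintype.card (M.power (N + 1)).Rand : ℝ)⁻¹),
    Finset.mul_sum (a := (Fintype.card (K.sequential (N + 1)).Coins : ℝ)⁻¹)]
  refine Finset.sum_congr rfl fun cB _ => ?_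
  refine Finset.sum_congr rfl fun x _ => ?_
  let F (a b a' b' : List K.Msg) : ℝ :=
    (Fintype.card (M.power (N + 1)).Rand : ℝ)⁻¹ *
      ((Fintype.card (K.sequential (N + 1)).Coins : ℝ)⁻¹ *
        ((Fintype.card (K.sequential (N + 1)).Coins : ℝ)⁻¹ *
    if ((K.sequential (N + 1)).Agrees r cA x a ∧
          (K.sequential (N + 1)).verdict ((M.power (N + 1)).bank r) cA (a ++ b) = true) ∧
        (K.sequential (N + 1)).Agrees r cB x a' ∧
          (K.sequential (N + 1)).verdict ((M.power (N + 1)).bank r) cB (a' ++ b') = true then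
      ∑ j, sqNorm ((kroneckerMap (· * ·)
        ((K.sequential (N + 1)).proveOp A ((M.power (N + 1)).bank r) cA x a b *
          (K.sequential (N + 1)).agreeOp A ((M.power (N + 1)).bank r) cA x a)
        ((K.sequential (N + 1)).proveOp B ((M.power (N + 1)).bank r) cB x a' b' *
          (K.sequential (N + 1)).agreeOp B ((M.power (N + 1)).bank r) cB x a') *
        I.kraus (Scenario.View.pub ((M.power (N + 1)).bank r : (M.power (N + 1)).View)) j) *ᵥ
          (M.power (N + 1)).supply r)
    else 0))
  refine (sum_messages (fun a b => ∑ a' : Fin (N * K.rounds + K.agreeRounds) → K.Msg,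
    ∑ b' : Fin K.proveRounds → K.Msg, F a b (List.ofFn a') (List.ofFn b')) K.agreeRounds
    K.proveRounds N _ rfl).trans (Finset.sum_congr rfl fun m _ => ?_)
  refine (sum_messages (fun a' b' => F _ _ a' b') K.agreeRounds
    K.proveRounds N _ rfl).trans (Finset.sum_congr rfl fun m' _ => ?_)
  -- Winning the repeated game means winning every run, with the entries of the agreed tuple as the
  -- instances.
  have hW : (((K.sequential (N + 1)).Agrees r cA x (K.agreeMsgs m) ∧
        (K.sequential (N + 1)).verdict ((M.power (N + 1)).bank r) cA
          (K.agreeMsgs m ++ List.ofFn (m (Fin.last N)).2) = true) ∧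
      (K.sequential (N + 1)).Agrees r cB x (K.agreeMsgs m') ∧
        (K.sequential (N + 1)).verdict ((M.power (N + 1)).bank r) cB
          (K.agreeMsgs m' ++ List.ofFn (m' (Fin.last N)).2) = true)
      ↔ ∀ q, K.Wins (r q, x q, (cA q, cB q), m q, m' q) :=
    (((K.sequential_agrees r cA x m).and (K.sequential_verdict r cA m)).and
      ((K.sequential_agrees r cB x m').and (K.sequential_verdict r cB m'))).trans
      (by simp only [Wins, forall_and])
  rw [prod_runWeight]
  change _ * (_ * (_ * if ((K.sequential (N + 1)).Agrees r cA x (K.agreeMsgs m) ∧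
        (K.sequential (N + 1)).verdict ((M.power (N + 1)).bank r) cA
          (K.agreeMsgs m ++ List.ofFn (m (Fin.last N)).2) = true) ∧
      (K.sequential (N + 1)).Agrees r cB x (K.agreeMsgs m') ∧
        (K.sequential (N + 1)).verdict ((M.power (N + 1)).bank r) cB
          (K.agreeMsgs m' ++ List.ofFn (m' (Fin.last N)).2) = true then _ else _)) = _
  by_cases h : ∀ q, K.Wins (r q, x q, (cA q, cB q), m q, m' q)
  · rw [if_pos (hW.2 h), if_pos h, ← Finset.mul_sum, mul_assoc, mul_assoc]
    refine congrArg (fun z : ℝ => _ * (_ * (_ * z))) (Finset.sum_congr rfl fun j _ => ?_)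
    refine congrArg sqNorm ((mulVec_mulVec _ _ _).symm.trans (congrArg₂ mulVec ?_ ?_))
    · exact (congrArg₂ (kroneckerMap (· * ·))
        (K.sequential_mul_agreeOp A r _ (pub_rep r) cA x m)
        (K.sequential_mul_agreeOp B r _ (pub_rep r) cB x m')).trans (kron_seqOp _ _ _)
    · exact congrArg₂ mulVec (congrArg (fun p => I.kraus p j) (pub_rep r)) (M.power_supply r)
  · rw [if_neg (mt hW.1 h), if_neg h]
    simp

end Protocol

/-! ### Exponential bound for the repeated game -/

namespace Protocol

variable {M : Scenario} (K : Protocol M)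

/-- Any bound `w` for a single execution that is uniform over registers and labelled families of
players passes to its power, by composing one dual certificate with itself along the runs. -/
theorem cloneGameProb_sequential_le {w : ℝ} (hw0 : 0 ≤ w)
    (hw : ∀ (SA SB : Type) [Fintype SA] [DecidableEq SA] [Fintype SB] [DecidableEq SB] (J : Type)
      [Fintype J] (A : J → Player M K.Msg SA) (B : J → Player M K.Msg SB)
      (N : M.PubView → J → Matrix (SA × SB) M.Supply ℂ), (∀ p, Contractive (N p)) →
      ∑ j, ∑ x, K.pairWeight ((A j).prover x) ((B j).prover x) x (fun p => N p j)
        (K.bothAccept ((A j).prover x) ((B j).prover x) x) ≤ w)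
    {N : ℕ} (A B : Prover (M.power (N + 1)) K.Msg)
    (I : InputGen (M.power (N + 1)) (A.S × B.S)) :
    (K.sequential (N + 1)).cloneGameProb A B I ≤ w ^ (N + 1) := by
  classical
  -- A label consists of the number of the run, the public views of all copies and the tuple of
  -- instances: all that the strategy in a run may depend on.
  obtain ⟨m, y, hy1, hy2⟩ := K.exists_run_certificate
    (Γ := Fin (N + 1) × (Fin (N + 1) → M.Rand) × (Fin (N + 1) → M.Id)) hw0
    (fun γ => K.runPlayer A γ.1 γ.2.1 γ.2.2) (fun γ => K.runPlayer B γ.1 γ.2.1 γ.2.2)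
    fun J _ lab T hT => hw A.S B.S J _ _ T hT
  rw [cloneGameProb_sequential]
  have key : ∀ j, _ := fun j => sum_seqOp_le (fun h : K.Run => M.rep h.1) K.runWeight
    K.runWeight_nonneg (fun h => M.supply h.1) y (N + 1)
    (fun p => (Matrix.mulVecLin (I.kraus (Scenario.View.pub
      ((M.power (N + 1)).bank p : (M.power (N + 1)).View)) j)).compMultilinearMap
        (tensorState (n := N + 1) (ν := M.Note) (β := Option M.W)))
    (fun q p h => K.runOp (K.runPlayer A q p fun i => (h i).2.1)
      (K.runPlayer B q p fun i => (h i).2.1) (h q))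
    (fun q p h h' hh => by
      rw [hh q le_rfl, K.runPlayer_congr A q p fun j hj => congrArg (fun z : K.Run => z.2.1)
        (hh j hj), K.runPlayer_congr B q p fun j hj => congrArg (fun z : K.Run => z.2.1)
        (hh j hj)])
    (fun q p h T => by
      have hu : ∀ h₀ : K.Run, (fun i => (Function.update h q h₀ i).2.1)
          = Function.update (fun i => (h i).2.1) q h₀.2.1 := fun h₀ => by
        funext i
        by_cases hi : i = q
        · subst hi
          simp
        · simp [hi]
      simp only [hu, runPlayer_update, Function.update_self]
      exact hy2 (q, p, fun i => (h i).2.1) (p q) T)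
  refine (Finset.sum_le_sum fun j _ => key j).trans ?_
  rw [Finset.sum_comm]
  -- After all replacements only the trace-preserving input channel, applied to a product vector, is
  -- left.
  have hpk : ∀ (p : Fin (N + 1) → M.Rand) (k : Fin (N + 1) → Fin m),
      ∑ j, sqNorm ((Matrix.mulVecLin (I.kraus (Scenario.View.pub
        ((M.power (N + 1)).bank p : (M.power (N + 1)).View)) j)).compMultilinearMap
        (tensorState (n := N + 1) (ν := M.Note) (β := Option M.W)) fun q => y (p q) (k q))
      = ∏ q, sqNorm (y (p q) (k q)) := fun p k =>
    (sum_sqNorm_of_complete (I.complete _) _).trans (sqNorm_tensorState _)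
  have : ∑ p : Fin (N + 1) → M.Rand, ∑ k : Fin (N + 1) → Fin m, ∏ q, sqNorm (y (p q) (k q))
      = (∑ p, ∑ k, sqNorm (y p k)) ^ (N + 1) := by
    rw [← Fin.prod_const, Finset.prod_univ_sum, Fintype.piFinset_univ]
    refine Finset.sum_congr rfl fun p _ => ?_
    rw [Finset.prod_univ_sum, Fintype.piFinset_univ]
  refine le_trans (le_of_eq ?_) (pow_le_pow_left₀ (Finset.sum_nonneg fun p _ =>
    Finset.sum_nonneg fun k _ => sqNorm_nonneg _) hy1 (N + 1))
  rw [← this]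
  refine Finset.sum_congr rfl fun p _ => ?_
  rw [Finset.sum_comm]
  exact Finset.sum_congr rfl fun k _ => hpk p k

end Protocol

/-! ## The honest prover of the repeated protocol -/

section Cells

variable {C S X Msg : Type} [Fintype C] [DecidableEq C] [Fintype S] [DecidableEq S]
  [Fintype X] [DecidableEq X] [Fintype Msg] [DecidableEq Msg] {n : ℕ}

/-- The tensor product of the vectors `φ q`. -/
def prodVec (φ : Fin n → C → ℂ) : (Fin n → C) → ℂ := fun f => ∏ q, φ q (f q)

theorem prodVec_update (φ : Fin n → C → ℂ) (q : Fin n) (v : C → ℂ) (f : Fin n → C) :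
    prodVec (Function.update φ q v) f = v (f q) * ∏ i : { j // j ≠ q }, φ i (f i) := by
  rw [prodVec, Fintype.prod_eq_mul_prod_subtype_ne _ q, Function.update_self]
  congr 1
  exact Finset.prod_congr rfl fun i _ => by rw [Function.update_of_ne i.2]

theorem respond_mul_mulVec (U : Matrix (S × Msg) (S × Msg) ℂ) (m a : Msg) (v : S → ℂ) (s : S) :
    (respond U m a *ᵥ v) s = ∑ s', U (s, a) (s', m) * v s' := rfl

theorem atRun_apply (q : Fin n) (U : Matrix.unitaryGroup (C × Msg) ℂ) (f g : Fin n → C)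
    (a m : Msg) :
    (atRun q U : Matrix ((Fin n → C) × Msg) ((Fin n → C) × Msg) ℂ) (f, a) (g, m)
      = if (fun i : { j // j ≠ q } => f i) = (fun i : { j // j ≠ q } => g i) then
        (U : Matrix (C × Msg) (C × Msg) ℂ) (f q, a) (g q, m) else 0 :=
  Matrix.blockDiagonal_apply (fun _ : { j // j ≠ q } → C => (U : Matrix (C × Msg) (C × Msg) ℂ))
    ((f q, a), fun i => f i) ((g q, m), fun i => g i)

theorem onCell_apply (V : Option (Option X) → Matrix.unitaryGroup (S × Msg) ℂ)
    (z z' : Cell X S) (a m : Msg) :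
    (onCell V : Matrix (Cell X S × Msg) (Cell X S × Msg) ℂ) (z, a) (z', m)
      = if z.1 = z'.1 then (V z.1 : Matrix (S × Msg) (S × Msg) ℂ) (z.2, a) (z'.2, m) else 0 :=
  Matrix.blockDiagonal_apply (fun y => (V y : Matrix (S × Msg) (S × Msg) ℂ))
    ((z.2, a), z.1) ((z'.2, m), z'.1)

theorem respond_atRun (q : Fin n) (U : Matrix.unitaryGroup (C × Msg) ℂ) (m a : Msg)
    (φ : Fin n → C → ℂ) :
    respond (atRun q U : Matrix ((Fin n → C) × Msg) ((Fin n → C) × Msg) ℂ) m a *ᵥ prodVec φ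
      = prodVec (Function.update φ q
        (respond (U : Matrix (C × Msg) (C × Msg) ℂ) m a *ᵥ φ q)) := by
  funext f
  rw [prodVec_update, respond_mul_mulVec, respond_mul_mulVec,
    ← (Equiv.funSplitAt q C).symm.sum_comp, Fintype.sum_prod_type, Finset.sum_mul]
  refine Finset.sum_congr rfl fun s _ => ?_
  rw [Finset.sum_eq_single fun i : { j // j ≠ q } => f i]
  · have h1 : (Equiv.funSplitAt q C).symm (s, fun i : { j // j ≠ q } => f i)
        = Function.update f q s := by
      funext i
      by_cases hi : i = q
      · subst hi
        simp
      · simp [hi]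
    have h2 : (fun i : { j // j ≠ q } => f i)
        = (fun i : { j // j ≠ q } => Function.update f q s i) :=
      funext fun i => (Function.update_of_ne i.2 _ _).symm
    rw [h1, atRun_apply, if_pos h2, Function.update_self, mul_assoc, prodVec,
      Fintype.prod_eq_mul_prod_subtype_ne _ q, Function.update_self]
    congr 2
    exact Finset.prod_congr rfl fun i _ => by rw [Function.update_of_ne i.2]
  · intro t _ ht
    rw [atRun_apply, if_neg, zero_mul]
    intro h
    refine ht (funext fun i => ?_)
    rw [congrFun h i]
    simp [i.2]
  · simp

theorem interact_atRun (q : Fin n) (ask : List Msg → Msg) (U : ℕ → Matrix.unitaryGroup (C × Msg) ℂ)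
    (h l : List Msg) (φ : Fin n → C → ℂ) :
    interact ask (fun i => (atRun q (U i) : Matrix ((Fin n → C) × Msg) ((Fin n → C) × Msg) ℂ)) h l
        *ᵥ prodVec φ
      = prodVec (Function.update φ q (interact ask
        (fun i => (U i : Matrix (C × Msg) (C × Msg) ℂ)) h l *ᵥ φ q)) := by
  induction l generalizing h φ with
  | nil => simp [interact]
  | cons a l ih =>
    rw [interact, interact, ← mulVec_mulVec, respond_atRun, ih, Function.update_self,
      Function.update_idem, mulVec_mulVec]

/-- Each run acts on its own tensor factor, so a product state stays one and the order of the runs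
is immaterial. -/
theorem seqOp_mulVec_prodVec (k : ℕ) (hk : k ≤ n)
    (O : Fin k → Matrix (Fin n → C) (Fin n → C) ℂ) (T : Fin k → Matrix C C ℂ)
    (hO : ∀ q φ, O q *ᵥ prodVec φ = prodVec (Function.update φ (q.castLE hk)
      (T q *ᵥ φ (q.castLE hk)))) (φ : Fin n → C → ℂ) :
    seqOp k O *ᵥ prodVec φ
      = prodVec fun i => if h : (i : ℕ) < k then T ⟨i, h⟩ *ᵥ φ i else φ i := by
  induction k with
  | zero => simp [seqOp]
  | succ k ih =>
    rw [seqOp, ← mulVec_mulVec, ih (Nat.le_of_succ_le hk) _ (fun q => T q.castSucc)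
      fun q φ => hO q.castSucc φ, hO]
    congr 1
    funext i
    by_cases hi : i = (Fin.last k).castLE hk
    · subst hi
      rw [Function.update_self]
      simp
      rfl
    · rw [Function.update_of_ne hi]
      have hik : (i : ℕ) ≠ k := fun h => hi (Fin.ext h)
      by_cases h : (i : ℕ) < k
      · rw [dif_pos h, dif_pos (Nat.lt_succ_of_lt h)]
        rfl
      · rw [dif_neg h, dif_neg (by omega)]

theorem respond_onCell (V : Option (Option X) → Matrix.unitaryGroup (S × Msg) ℂ) (m a : Msg)
    (w : Cell X S → ℂ) (z : Cell X S) :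
    (respond (onCell V : Matrix (Cell X S × Msg) (Cell X S × Msg) ℂ) m a *ᵥ w) z
      = (respond (V z.1 : Matrix (S × Msg) (S × Msg) ℂ) m a *ᵥ fun s => w (z.1, s)) z.2 := by
  rw [respond_mul_mulVec, respond_mul_mulVec, Fintype.sum_prod_type,
    Finset.sum_eq_single z.1]
  · exact Finset.sum_congr rfl fun s _ => by rw [onCell_apply, if_pos rfl]
  · intro y _ hy
    exact Finset.sum_eq_zero fun s _ => by rw [onCell_apply, if_neg hy.symm, zero_mul]
  · simp

/-- The record is a control register that these unitaries never change, so the interaction takes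
place separately in each of its basis states. -/
theorem interact_onCell (ask : List Msg → Msg)
    (V : ℕ → Option (Option X) → Matrix.unitaryGroup (S × Msg) ℂ) (h l : List Msg)
    (w : Cell X S → ℂ) (z : Cell X S) :
    (interact ask (fun i => (onCell (V i) : Matrix (Cell X S × Msg) (Cell X S × Msg) ℂ)) h l
        *ᵥ w) z
      = (interact ask (fun i => (V i z.1 : Matrix (S × Msg) (S × Msg) ℂ)) h l *ᵥ
        fun s => w (z.1, s)) z.2 := by
  induction l generalizing h w with
  | nil => simp [interact]
  | cons a l ih =>
    rw [interact, interact, ← mulVec_mulVec, ← mulVec_mulVec, ih]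
    congr 2
    funext s
    exact respond_onCell (V h.length) (ask h) a w (z.1, s)

/-- The record of the instance, as an operation on vectors. -/
def recordVec (out : S → Option X) (w : Cell X S → ℂ) : Cell X S → ℂ := fun z =>
  w (Equiv.swap none (some (out z.2)) z.1, z.2)

theorem respond_mul_recordInst (V : Matrix (Cell X S × Msg) (Cell X S × Msg) ℂ)
    (out : S → Option X) (m a : Msg) (w : Cell X S → ℂ) :
    respond (V * ((recordInst out : Matrix.unitaryGroup (Cell X S × Msg) ℂ) :
      Matrix (Cell X S × Msg) (Cell X S × Msg) ℂ)) m a *ᵥ w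
      = respond V m a *ᵥ recordVec out w := by
  funext z
  rw [respond_mulVec, respond_mulVec, ← mulVec_mulVec]
  congr 2
  funext z'
  rw [mulVec, dotProduct, Finset.sum_eq_single
    ((Equiv.swap none (some (out z'.1.2)) z'.1.1, z'.1.2), z'.2)]
  · simp [recordInst, permUnitary, recordVec]
  · intro b _ hb
    have : z' ≠ ((Equiv.swap none (some (out b.1.2)) b.1.1, b.1.2), b.2) := by
      rintro rfl
      simp at hb
    simp [recordInst, permUnitary, this]
  · simp

end Cells

/-! ### Recording the instance in a cell -/

section Cells

variable {S X Msg : Type} [Fintype S] [DecidableEq S]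
  [Fintype X] [DecidableEq X] [Fintype Msg] [DecidableEq Msg]

/-- The state of a cell with empty record. -/
def emptyCell (v : S → ℂ) : Cell X S → ℂ := fun z => if z.1 = none then v z.2 else 0

theorem emptyCell_slice (v : S → ℂ) (y : Option (Option X)) :
    (fun s => emptyCell v (y, s)) = if y = none then v else 0 := by
  funext s
  simp only [emptyCell]
  split_ifs <;> rfl

theorem interact_onCell_emptyCell (ask : List Msg → Msg)
    (U : ℕ → Matrix.unitaryGroup (S × Msg) ℂ) (h l : List Msg) (v : S → ℂ) :
    interact ask (fun i => (onCell fun _ => U i : Matrix.unitaryGroup (Cell X S × Msg) ℂ).1) h l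
        *ᵥ emptyCell v
      = emptyCell (interact ask (fun i => (U i : Matrix (S × Msg) (S × Msg) ℂ)) h l *ᵥ v) := by
  funext z
  refine (interact_onCell ask (fun i _ => U i) h l (emptyCell v) z).trans ?_
  rw [emptyCell_slice, emptyCell]
  split_ifs
  · rfl
  · rw [mulVec_zero]
    rfl

theorem sqNorm_emptyCell (v : S → ℂ) : sqNorm (emptyCell v : Cell X S → ℂ) = sqNorm v := by
  rw [sqNorm_prod, Finset.sum_eq_single none]
  · rw [emptyCell_slice, if_pos rfl]
  · intro y _ hy
    rw [emptyCell_slice, if_neg hy, sqNorm_zero]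
  · simp

theorem diagonal_cellOut_emptyCell (out : S → Option X) (x : X) (v : S → ℂ) :
    Matrix.diagonal (fun z : Cell X S => if cellOut out z = some x then (1 : ℂ) else 0) *ᵥ
        emptyCell v
      = emptyCell (Matrix.diagonal (fun s => if out s = some x then (1 : ℂ) else 0) *ᵥ v) := by
  funext z
  rw [mulVec_diagonal, emptyCell, emptyCell, mulVec_diagonal]
  obtain ⟨y, s⟩ := z
  rcases y with _ | y
  · rfl
  · simp

/-- Recording is merged into the first prove round and thus happens only if there is one; hence `l ≠
[]`. -/
theorem interact_record (ask : List Msg → Msg)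
    (V : ℕ → Option (Option X) → Matrix.unitaryGroup (S × Msg) ℂ) (out : S → Option X)
    (l : List Msg) (hl : l ≠ []) (w : Cell X S → ℂ) :
    interact ask (fun i => (onCell (V i) * if i = 0 then recordInst out else 1 :
        Matrix.unitaryGroup (Cell X S × Msg) ℂ).1) [] l *ᵥ w
      = interact ask (fun i => (onCell (V i) : Matrix (Cell X S × Msg) (Cell X S × Msg) ℂ)) [] l
        *ᵥ recordVec out w := by
  obtain ⟨a, l, rfl⟩ := List.exists_cons_of_ne_nil hl
  rw [interact, interact, ← mulVec_mulVec, ← mulVec_mulVec]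
  have h1 : (onCell (V 0) * if (0 : ℕ) = 0 then recordInst out else 1 :
      Matrix.unitaryGroup (Cell X S × Msg) ℂ).1
      = (onCell (V 0)).1 * (recordInst out : Matrix.unitaryGroup (Cell X S × Msg) ℂ).1 := by
    rw [if_pos rfl]
    rfl
  rw [List.length_nil, h1, respond_mul_recordInst]
  congr 1
  refine interact_congr rfl _ (fun _ _ => rfl) fun i _ => ?_
  rw [if_neg (by simp), mul_one]

theorem recordVec_emptyCell_slice (out : S → Option X) (v : S → ℂ) (y : Option (Option X)) :
    (fun s => recordVec out (emptyCell v) (y, s))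
      = fun s => if y = some (out s) then v s else 0 := by
  funext s
  simp only [recordVec, emptyCell, Equiv.swap_apply_eq_iff, Equiv.swap_apply_left]

/-- The effect of a complete run in the repeated protocol on a cell. -/
theorem sqNorm_interact_record (ask : List Msg → Msg)
    (V : ℕ → Option (Option X) → Matrix.unitaryGroup (S × Msg) ℂ) (out : S → Option X)
    (l : List Msg) (v : S → ℂ) (x : X) :
    sqNorm (Matrix.diagonal (fun z : Cell X S => if cellOut out z = some x then (1 : ℂ) else 0) *ᵥ
      (interact ask (fun i => (onCell (V i) * if i = 0 then recordInst out else 1 :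
        Matrix.unitaryGroup (Cell X S × Msg) ℂ).1) [] l *ᵥ emptyCell v))
      = sqNorm (interact ask (fun i => (V i (some (some x)) : Matrix (S × Msg) (S × Msg) ℂ)) [] l *ᵥ
        (Matrix.diagonal (fun s => if out s = some x then (1 : ℂ) else 0) *ᵥ v)) := by
  -- Without prove rounds the record stays empty and the final output is read off the original
  -- register.
  rcases eq_or_ne l [] with rfl | hl
  · simp only [interact, one_mulVec]
    rw [diagonal_cellOut_emptyCell, sqNorm_emptyCell]
  -- Deferred measurement: testing the record for `x` after the run equals projecting onto `out s =
  -- some x` before it, since in the slice `some (some x)` recording acts as this projection.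
  · rw [interact_record ask V out l hl, sqNorm_prod, Finset.sum_eq_single (some (some x))]
    · congr 1
      funext s
      rw [mulVec_diagonal, if_pos (show cellOut out (some (some x), s) = some x from rfl),
        one_mul, interact_onCell, recordVec_emptyCell_slice]
      congr 2
      funext s
      simp [mulVec_diagonal, eq_comm]
    · intro y _ hy
      refine Eq.trans (congrArg sqNorm (funext fun s => ?_)) (sqNorm_zero (d := S))
      rw [mulVec_diagonal]
      rcases y with _ | y
      · rw [interact_onCell, recordVec_emptyCell_slice]
        simp only [reduceCtorEq, if_false]
        rw [show (fun _ : S => (0 : ℂ)) = 0 from rfl, mulVec_zero]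
        simp
      · rw [if_neg (fun h : cellOut out (some y, s) = some x => hy (congrArg some h)), zero_mul]
        rfl
    · simp

end Cells

/-! ### The honest prover run by run -/

namespace Protocol

variable {M : Scenario} (K : Protocol M) {n : ℕ}

theorem inputCell_mulVec (p : M.PubView) (j : K.I.ι) (u : M.Supply → ℂ) :
    K.inputCell p j *ᵥ u = emptyCell (K.I.kraus p j *ᵥ u) := by
  funext z
  rw [emptyCell]
  split_ifs with h <;> simp [mulVec, dotProduct, inputCell, h]

theorem interact_runStep_agree (ask : List K.Msg → K.Msg) (p : M.PubView)
    (a : Fin K.agreeRounds → K.Msg) (v : K.P.S → ℂ) :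
    interact ask (fun i => (K.runStep p i).1) [] (List.ofFn a) *ᵥ emptyCell v
      = emptyCell (interact ask (fun i => (K.P.agree p i).1) [] (List.ofFn a) *ᵥ v) := by
  rw [← interact_onCell_emptyCell]
  congr 1
  refine interact_congr rfl _ (fun _ _ => rfl) fun i hi => ?_
  rw [List.length_ofFn] at hi
  rw [List.length_nil, Nat.zero_add, runStep, if_pos hi]

/-- A complete run of the honest prover of the repeated protocol. -/
theorem sqNorm_run (D : M.View) (c : K.Coins) (x : M.Id)
    (l : (Fin K.agreeRounds → K.Msg) × (Fin K.proveRounds → K.Msg)) (v : K.P.S → ℂ) :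
    sqNorm (Matrix.diagonal (fun z : Cell M.Id K.P.S =>
        if cellOut K.P.out z = some x then (1 : ℂ) else 0) *ᵥ
      (interact (K.ask D c) (fun i => (K.runStep D.pub i).1) [] (joinPhases l) *ᵥ
        emptyCell v))
      = sqNorm ((K.proveOp K.P D c x (List.ofFn l.1) (List.ofFn l.2) *
        K.agreeOp K.P D c x (List.ofFn l.1)) *ᵥ v) := by
  have h2 : interact (K.ask D c) (fun i => (K.runStep D.pub i).1) (List.ofFn l.1)
        (List.ofFn l.2)
      = interact (fun g => K.ask D c (List.ofFn l.1 ++ g)) (fun i => (onCell (fun y => match y with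
        | some (some x) => K.P.prove D.pub x i
        | _ => 1) * if i = 0 then recordInst K.P.out else 1 :
        Matrix.unitaryGroup (Cell M.Id K.P.S × K.Msg) ℂ).1) [] (List.ofFn l.2) := by
    have := interact_shift (K.ask D c) (fun i => (K.runStep D.pub i).1)
      (List.ofFn l.1) [] (List.ofFn l.2)
    rw [List.append_nil] at this
    refine this.trans (interact_congr rfl _ (fun _ _ => rfl) fun i _ => ?_)
    rw [List.length_ofFn, List.length_nil, Nat.zero_add, runStep, if_neg (by omega)]
    simp only [Nat.add_sub_cancel_left, Nat.add_eq_left]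
  rw [joinPhases, interact_append, List.nil_append, ← mulVec_mulVec,
    interact_runStep_agree, h2, sqNorm_interact_record, mulVec_mulVec, mulVec_mulVec,
    proveOp, agreeOp, Matrix.mul_assoc]

end Protocol

namespace Protocol

variable {M : Scenario} (K : Protocol M) {N : ℕ}

theorem diagonal_allSome_prodVec {X S : Type} [Fintype X] [DecidableEq X] [Fintype S]
    [DecidableEq S] {n : ℕ} (out : S → Option X) (x : Fin n → X) (φ : Fin n → Cell X S → ℂ) :
    Matrix.diagonal (fun f : Fin n → Cell X S =>
        if (allSome fun q => cellOut out (f q)) = some x then (1 : ℂ) else 0) *ᵥ prodVec φ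
      = prodVec fun q => Matrix.diagonal (fun z : Cell X S =>
        if cellOut out z = some (x q) then (1 : ℂ) else 0) *ᵥ φ q := by
  funext f
  simp only [mulVec_diagonal, prodVec, Finset.prod_mul_distrib, Finset.prod_ite_zero,
    Finset.prod_const_one, Finset.mem_univ, true_imp_iff, allSome_eq_some_iff]

theorem seqProver_agree {n : ℕ} (D : (M.power n).View) (q : Fin n) (i : ℕ) (hi : i < K.rounds) :
    (K.seqProver n).agree (Scenario.View.pub D) (q * K.rounds + i)
      = atRun q (K.runStep (Scenario.View.pub (Scenario.compView D q : M.View)) i) := by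
  have h0 : 0 < K.rounds := Nat.zero_lt_of_lt hi
  have h1 : (q * K.rounds + i) / K.rounds = q := by
    rw [Nat.mul_comm, Nat.mul_add_div h0, Nat.div_eq_of_lt hi, Nat.add_zero]
  have h2 : (q * K.rounds + i) % K.rounds = i := by
    rw [Nat.mul_comm, Nat.mul_add_mod, Nat.mod_eq_of_lt hi]
  simp only [seqProver, h1, h2, q.2, dif_pos]
  rfl

theorem seqProver_prove (D : (M.power (N + 1)).View) (x : (M.power (N + 1)).Id) (i : ℕ) :
    (K.seqProver (N + 1)).prove (Scenario.View.pub D) x i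
      = atRun (Fin.last N) (onCell fun _ => K.P.prove
        (Scenario.View.pub (Scenario.compView D (Fin.last N) : M.View)) (x (Fin.last N)) i) := by
  simp only [seqProver, Nat.add_sub_cancel, Nat.lt_succ_self, dif_pos]
  rfl

/-- The honest prover of the repeated protocol acts on the cells as the original prover. -/
theorem sqNorm_seqProver (D : Fin (N + 1) × M.Note → Option (M.Pub × M.Sec)) (c : Fin (N + 1) → K.Coins)
    (x : Fin (N + 1) → M.Id) (m : Fin (N + 1) →
      (Fin K.agreeRounds → K.Msg) × (Fin K.proveRounds → K.Msg))
    (ψ : Fin (N + 1) → K.P.S → ℂ) :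
    sqNorm (((K.sequential (N + 1)).proveOp (K.seqProver (N + 1)) D c x (K.agreeMsgs m)
        (List.ofFn (m (Fin.last N)).2) *
      (K.sequential (N + 1)).agreeOp (K.seqProver (N + 1)) D c x (K.agreeMsgs m)) *ᵥ
        (prodVec fun q => emptyCell (ψ q) : (Fin (N + 1) → Cell M.Id K.P.S) → ℂ))
    = ∏ q, sqNorm ((K.proveOp K.P (Scenario.compView D q) (c q) (x q) (List.ofFn (m q).1)
        (List.ofFn (m q).2) * K.agreeOp K.P (Scenario.compView D q) (c q) (x q)
          (List.ofFn (m q).1)) *ᵥ ψ q) := by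
  have hP : ((K.sequential (N + 1)).proveOp (K.seqProver (N + 1)) D c x (K.agreeMsgs m)
        (List.ofFn (m (Fin.last N)).2) : Matrix (Fin (N + 1) → Cell M.Id K.P.S) _ ℂ)
      = interact (fun g => K.ask (Scenario.compView D (Fin.last N)) (c (Fin.last N))
          (List.ofFn (m (Fin.last N)).1 ++ g))
        (fun i => (atRun (Fin.last N) (onCell fun _ => K.P.prove
          (Scenario.View.pub (Scenario.compView D (Fin.last N) : M.View)) (x (Fin.last N)) i :
          Matrix.unitaryGroup (Cell M.Id K.P.S × K.Msg) ℂ)).1) []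
        (List.ofFn (m (Fin.last N)).2) :=
    (K.sequential_proveOp _ D c x m).trans (interact_congr rfl _ (fun _ _ => rfl) fun i _ =>
      congrArg Subtype.val (K.seqProver_prove D x _))
  have hA : ((K.sequential (N + 1)).agreeOp (K.seqProver (N + 1)) D c x (K.agreeMsgs m) :
        Matrix (Fin (N + 1) → Cell M.Id K.P.S) _ ℂ)
      = Matrix.diagonal (fun f : Fin (N + 1) → Cell M.Id K.P.S =>
          if (allSome fun q => cellOut K.P.out (f q)) = some x then (1 : ℂ) else 0) *
        (interact (K.ask (Scenario.compView D (Fin.last N)) (c (Fin.last N)))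
          (fun i => (atRun (Fin.last N) (K.runStep
            (Scenario.View.pub (Scenario.compView D (Fin.last N) : M.View)) i)).1) []
          (List.ofFn (m (Fin.last N)).1) *
        seqOp N fun q => interact (K.ask (Scenario.compView D q.castSucc) (c q.castSucc))
          (fun i => (atRun q.castSucc (K.runStep
            (Scenario.View.pub (Scenario.compView D q.castSucc : M.View)) i)).1) []
          (joinPhases (m q.castSucc))) := by
    refine (K.sequential_agreeOp _ D c x m).trans ?_
    refine congrArg₂ (· * ·) rfl (congrArg₂ (· * ·)
      (interact_congr rfl _ (fun _ _ => rfl) fun i hi => ?_)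
      (congrArg (seqOp N) (funext fun q =>
        interact_congr rfl _ (fun _ _ => rfl) fun i hi => ?_)))
    · have hi' : i < K.agreeRounds := hi.trans_eq List.length_ofFn
      rw [List.length_nil, Nat.zero_add]
      exact congrArg Subtype.val (K.seqProver_agree D (Fin.last N) i
        (hi'.trans_le (Nat.le_add_right _ _)))
    · rw [List.length_nil, Nat.zero_add]
      exact congrArg Subtype.val (K.seqProver_agree D q.castSucc i
        (hi.trans_eq (length_joinPhases _)))
  refine (congrArg₂ (fun A B : Matrix (Fin (N + 1) → Cell M.Id K.P.S)
    (Fin (N + 1) → Cell M.Id K.P.S) ℂ => sqNorm ((A * B) *ᵥ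
      prodVec fun q => emptyCell (ψ q))) hP hA).trans ?_
  have hseq := seqOp_mulVec_prodVec N (Nat.le_succ N)
    (fun q => interact (K.ask (Scenario.compView D q.castSucc) (c q.castSucc))
      (fun i => (atRun q.castSucc (K.runStep
        (Scenario.View.pub (Scenario.compView D q.castSucc : M.View)) i)).1) []
      (joinPhases (m q.castSucc)))
    (fun q => interact (K.ask (Scenario.compView D q.castSucc) (c q.castSucc))
      (fun i => (K.runStep (Scenario.View.pub (Scenario.compView D q.castSucc : M.View)) i).1) []
      (joinPhases (m q.castSucc))) (fun q φ => interact_atRun q.castSucc _ _ _ _ φ)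
    fun q => emptyCell (ψ q)
  rw [← mulVec_mulVec, ← mulVec_mulVec, ← mulVec_mulVec, hseq,
    interact_atRun, diagonal_allSome_prodVec, interact_atRun]
  unfold prodVec
  rw [sqNorm_pi]
  refine Finset.prod_congr rfl fun q _ => ?_
  induction q using Fin.lastCases with
  -- In the last run the output is measured directly at the end of the agree phase, so its record is
  -- still empty and no deferred measurement is needed.
  | last =>
    rw [Function.update_self, Function.update_self, dif_neg (show ¬((Fin.last N : Fin (N + 1)) : ℕ) < N from
      lt_irrefl N), interact_runStep_agree, diagonal_cellOut_emptyCell, interact_onCell_emptyCell,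
      sqNorm_emptyCell, mulVec_mulVec, mulVec_mulVec, proveOp, agreeOp,
      Matrix.mul_assoc]
  | cast q =>
    have hq : q.castSucc ≠ Fin.last N := (Fin.castSucc_lt_last q).ne
    rw [Function.update_of_ne hq, Function.update_of_ne hq, dif_pos (show (q.castSucc : ℕ) < N from q.2)]
    exact K.sqNorm_run _ _ _ _ _

end Protocol

theorem tensorKraus_mulVec_tensorState {n : ℕ} {ι a ν β : Type} [Fintype ν] [DecidableEq ν]
    [Fintype β] (A : Fin n → ι → Matrix a (ν → β) ℂ) (j : Fin n → ι)
    (v : Fin n → (ν → β) → ℂ) :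
    tensorKraus A j *ᵥ tensorState v = prodVec fun q => A q (j q) *ᵥ v q := by
  funext f
  simp only [mulVec, dotProduct, prodVec, tensorState_apply, tensorKraus, Matrix.of_apply,
    ← Finset.prod_mul_distrib]
  rw [Finset.prod_univ_sum, Fintype.piFinset_univ,
    ← (Equiv.curry (Fin n) ν β).sum_comp]
  rfl

/-! ### Multiplicativity of the honest success probability -/

namespace Protocol

variable {M : Scenario} (K : Protocol M) {N : ℕ}

open Classical in
/-- The contribution to the honest success probability of given outcomes of all random choices. -/
noncomputable def honestWeight (h : M.Rand × K.Coins × M.Id ×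
    ((Fin K.agreeRounds → K.Msg) × (Fin K.proveRounds → K.Msg)) × K.I.ι) : ℝ :=
  if K.Agrees h.1 h.2.1 h.2.2.1 (List.ofFn h.2.2.2.1.1) ∧
      K.verdict (M.bank h.1) h.2.1 (List.ofFn h.2.2.2.1.1 ++ List.ofFn h.2.2.2.1.2) = true then
    (Fintype.card M.Rand : ℝ)⁻¹ * ((Fintype.card K.Coins : ℝ)⁻¹ *
      sqNorm ((K.proveOp K.P (M.bank h.1) h.2.1 h.2.2.1 (List.ofFn h.2.2.2.1.1)
        (List.ofFn h.2.2.2.1.2) * K.agreeOp K.P (M.bank h.1) h.2.1 h.2.2.1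
          (List.ofFn h.2.2.2.1.1)) *ᵥ
        (K.I.kraus (Scenario.View.pub (M.bank h.1 : M.View)) h.2.2.2.2 *ᵥ M.supply h.1)))
  else 0

theorem honestProb_eq_sum : K.honestProb = ∑ h, K.honestWeight h := by
  classical
  simp only [Fintype.sum_prod_type]
  unfold honestProb successProb
  simp only [avg_eq_sum, Finset.mul_sum]
  rw [Finset.sum_comm]
  refine Finset.sum_congr rfl fun r _ => ?_
  rw [Finset.sum_comm]
  refine Finset.sum_congr rfl fun c _ => Finset.sum_congr rfl fun x _ =>
    Finset.sum_congr rfl fun a _ => Finset.sum_congr rfl fun b _ => ?_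
  simp only [honestWeight]
  split_ifs
  · simp only [Finset.mul_sum, mulVec_mulVec]
  · simp

/-- Databases, coins and inputs of the runs are independent and the honest operators act factor by
factor, so each term of the expanded power is the weight of one family of outcomes. -/
theorem honestProb_sequential :
    (K.sequential (N + 1)).honestProb = K.honestProb ^ (N + 1) := by
  classical
  rw [K.honestProb_eq_sum, ← Fin.prod_const, Finset.prod_univ_sum, Fintype.piFinset_univ,
    sum_pi_prod]
  have hsum : ∀ r : Fin (N + 1) → M.Rand,
      ∑ h : Fin (N + 1) → K.Coins × M.Id ×
        ((Fin K.agreeRounds → K.Msg) × (Fin K.proveRounds → K.Msg)) × K.I.ι,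
        ∏ q, K.honestWeight (r q, h q)
      = ∑ c : Fin (N + 1) → K.Coins, ∑ x : Fin (N + 1) → M.Id,
        ∑ m : Fin (N + 1) → (Fin K.agreeRounds → K.Msg) × (Fin K.proveRounds → K.Msg),
        ∑ j : Fin (N + 1) → K.I.ι, ∏ q, K.honestWeight (r q, c q, x q, m q, j q) := by
    intro r
    rw [sum_pi_prod]
    refine Finset.sum_congr rfl fun c _ => ?_
    rw [sum_pi_prod]
    exact Finset.sum_congr rfl fun x _ => sum_pi_prod _
  simp only [hsum]
  unfold honestProb successProb
  refine (Finset.sum_congr rfl fun x _ => avg_eq_sum _).trans ?_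
  refine Finset.sum_comm.trans (Finset.sum_congr rfl fun r _ => ?_)
  refine (Finset.sum_congr rfl fun x _ => (congrArg _ (avg_eq_sum _)).trans
    (Finset.mul_sum _ _ _)).trans ?_
  refine Finset.sum_comm.trans (Finset.sum_congr rfl fun c _ => Finset.sum_congr rfl fun x _ => ?_)
  let F (a b : List K.Msg) : ℝ :=
    if (K.sequential (N + 1)).Agrees r c x a ∧
        (K.sequential (N + 1)).verdict ((M.power (N + 1)).bank r) c (a ++ b) = true then
      ∑ j : Fin (N + 1) → K.I.ι, sqNorm
        (((K.sequential (N + 1)).proveOp (K.seqProver (N + 1)) ((M.power (N + 1)).bank r) c x a b *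
          (K.sequential (N + 1)).agreeOp (K.seqProver (N + 1)) ((M.power (N + 1)).bank r) c x a *
        (K.seqInput (N + 1)).kraus (Scenario.View.pub
          ((M.power (N + 1)).bank r : (M.power (N + 1)).View)) j) *ᵥ (M.power (N + 1)).supply r)
    else 0
  refine (congrArg (fun z : ℝ => _ * (_ * z)) (sum_messages F K.agreeRounds
    K.proveRounds N _ rfl)).trans ?_
  rw [Finset.mul_sum, Finset.mul_sum]
  refine Finset.sum_congr rfl fun m _ => ?_
  have hW : ((K.sequential (N + 1)).Agrees r c x (K.agreeMsgs m) ∧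
        (K.sequential (N + 1)).verdict ((M.power (N + 1)).bank r) c
          (K.agreeMsgs m ++ List.ofFn (m (Fin.last N)).2) = true)
      ↔ ∀ q, K.Agrees (r q) (c q) (x q) (List.ofFn (m q).1) ∧
        K.verdict (M.bank (r q)) (c q) (List.ofFn (m q).1 ++ List.ofFn (m q).2) = true :=
    ((K.sequential_agrees r c x m).and (K.sequential_verdict r c m)).trans forall_and.symm
  simp only [honestWeight, Finset.prod_ite_zero, Finset.mem_univ, true_imp_iff]
  change _ * (_ * if (K.sequential (N + 1)).Agrees r c x (K.agreeMsgs m) ∧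
        (K.sequential (N + 1)).verdict ((M.power (N + 1)).bank r) c
          (K.agreeMsgs m ++ List.ofFn (m (Fin.last N)).2) = true then _ else _) = _
  by_cases h : ∀ q, K.Agrees (r q) (c q) (x q) (List.ofFn (m q).1) ∧
        K.verdict (M.bank (r q)) (c q) (List.ofFn (m q).1 ++ List.ofFn (m q).2) = true
  · simp only [if_pos h]
    rw [if_pos (hW.2 h), Finset.mul_sum, Finset.mul_sum]
    refine Finset.sum_congr rfl fun j _ => ?_
    simp only [Finset.prod_mul_distrib]
    refine congrArg₂ (· * ·) ?_ (congrArg₂ (· * ·) ?_ ?_)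
    · rw [Fin.prod_const, inv_pow]
      refine congrArg _ ?_
      refine (congrArg (Nat.cast (R := ℝ)) (Fintype.card_pi_const M.Rand (N + 1))).trans ?_
      push_cast
      rfl
    · rw [Fin.prod_const, inv_pow]
      refine congrArg _ ?_
      refine (congrArg (Nat.cast (R := ℝ)) (Fintype.card_pi_const K.Coins (N + 1))).trans ?_
      push_cast
      rfl
    · refine Eq.trans (congrArg sqNorm ((mulVec_mulVec _ _ _).symm.trans
        (congrArg (mulVec _) ?_))) (K.sqNorm_seqProver ((M.power (N + 1)).bank r) c x m
          fun q => K.I.kraus (Scenario.View.pub (M.bank (r q) : M.View)) (j q) *ᵥ M.supply (r q))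
      refine (congrArg (mulVec _) (M.power_supply r)).trans
        ((tensorKraus_mulVec_tensorState _ _ _).trans ?_)
      exact congrArg prodVec (funext fun q => K.inputCell_mulVec _ _ _)
  · simp only [if_neg h]
    rw [if_neg (mt hW.1 h)]
    simp

theorem honestProb_nonneg : 0 ≤ K.honestProb := by
  rw [honestProb_eq_sum]
  refine Finset.sum_nonneg fun h _ => ?_
  rw [honestWeight]
  split_ifs
  · exact mul_nonneg (by positivity) (mul_nonneg (by positivity) (sqNorm_nonneg _))
  · exact le_rfl

end Protocol

/-! ### Choice of constants and asymptotics -/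

theorem Protocol.cloningParameter_nonneg {M : Scenario} (K : Protocol M) {μ : ℝ}
    (hμ : M.HasCloningParameter μ) (hpub : K.AgreePhasePublic) [Nonempty M.Id]
    (E : K.Extractor) : 0 ≤ μ := by
  -- With an empty family of players the extraction bound reads `0 ≤ μ`.
  have := K.sum_bothExtract_le (SA := Unit) (SB := Unit) (J := Empty) hμ hpub E
    (fun j => j.elim) (fun j => j.elim) (fun j => j.elim) (fun j => j.elim)
    (fun _ j => j.elim) fun _ v => by simpa using sqNorm_nonneg v
  simpa using this

/-- The cloning error of the repeated protocol at a fixed value of the security parameter. -/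
theorem Protocol.cloneGameProb_sequential_lt {M : Scenario} (K : Protocol M) {μ κ ν ε : ℝ}
    (hμ : M.HasCloningParameter μ) (hpub : K.AgreePhasePublic) (hκ : 0 < κ) (hν : 0 < ν)
    (hε : 0 < ε) {E : K.Extractor} (hE : K.Extracts E κ fun p => (1 - p) ^ ν)
    (hgap : μ / (2 * ε * κ) < (2 - Real.sqrt 3) / 2 - (1 - κ) ^ ν) {n : ℕ} (hn : 0 < n)
    (A B : Prover (M.power n) K.Msg) (I : InputGen (M.power n) (A.S × B.S)) :
    (K.sequential n).cloneGameProb A B I < (1 + ε) ^ n * κ ^ n := by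
  obtain ⟨N, rfl⟩ := Nat.exists_eq_add_one_of_ne_zero hn.ne'
  have hεκ : 0 < ε * κ := mul_pos hε hκ
  obtain ⟨β, hβ0, hβε, hβ⟩ : ∃ β, 0 ≤ β ∧ β < ε * κ ∧ (κ < 1 → Nonempty M.Id →
      0 < 1 - 2 * (1 - κ) ^ ν ∧ μ ≤ β * (1 - 2 * (1 - κ) ^ ν)) := by
    by_cases hI : κ < 1 ∧ Nonempty M.Id
    · have := hI.2
      have hμ0 := K.cloningParameter_nonneg hμ hpub E
      -- The only property of `√3` that is needed: it puts `(2 - √3) / 2` below `1 / 2`, the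
      -- threshold at which the union bound is non-trivial.
      have h3 : (1 : ℝ) < Real.sqrt 3 := Real.lt_sqrt_of_sq_lt (by norm_num)
      have hd : 0 < 1 - 2 * (1 - κ) ^ ν := by
        have : 0 ≤ μ / (2 * ε * κ) := div_nonneg hμ0 (by positivity)
        linarith
      -- The excess over `κ` in the single-execution bound. Multiplied by `2 * ε * κ`, the gap
      -- hypothesis makes it smaller than `ε * κ`.
      refine ⟨μ / (1 - 2 * (1 - κ) ^ ν), div_nonneg hμ0 hd.le, ?_, fun _ _ =>
        ⟨hd, (div_mul_cancel₀ _ hd.ne').ge⟩⟩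
      rw [div_lt_iff₀ (by positivity)] at hgap
      rw [div_lt_iff₀ hd]
      refine hgap.trans_le ?_
      rw [show ε * κ * (1 - 2 * (1 - κ) ^ ν)
        = (1 / 2 - (1 - κ) ^ ν) * (2 * ε * κ) by ring]
      refine mul_le_mul_of_nonneg_right ?_ (by positivity)
      linarith
    -- If `κ ≥ 1` or there is no identifier, no extraction is needed and the excess is zero.
    · exact ⟨0, le_rfl, hεκ, fun h1 h2 => absurd ⟨h1, h2⟩ hI⟩
  have hδ : κ < 1 → ∀ p, κ < p → p ≤ 1 → (1 - p) ^ ν ≤ (1 - κ) ^ ν := fun _ p h1 h2 =>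
    Real.rpow_le_rpow (by linarith) (by linarith) hν.le
  have hw0 : 0 ≤ κ + β := by positivity
  refine (K.cloneGameProb_sequential_le hw0 (fun SA SB _ _ _ _ J _ A B N hN =>
    K.sum_bothAccept_le hE hμ hpub hκ hδ hβ0 hβ A B N hN) A B I).trans_lt ?_
  rw [← mul_pow]
  exact pow_lt_pow_left₀ (by linarith) hw0 (Nat.succ_ne_zero N)

theorem Negligible.polynomial_mul {η : ℕ → ℝ} (hη : Negligible η) {n : ℕ → ℕ}
    (hn : ∃ f : Polynomial ℕ, ∀ k, n k ≤ f.eval k) : Negligible fun k => n k * η k := by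
  obtain ⟨f, hf⟩ := hn
  refine (Asymptotics.SuperpolynomialDecay.polynomial_mul hη
    (f.map (Nat.castRingHom ℝ))).trans_abs_le fun k => ?_
  rw [abs_mul, abs_mul]
  refine mul_le_mul_of_nonneg_right ?_ (abs_nonneg _)
  have : (f.map (Nat.castRingHom ℝ)).eval (k : ℝ) = ((f.eval k : ℕ) : ℝ) := by
    simp
  rw [this, Nat.abs_cast, Nat.abs_cast]
  exact_mod_cast hf k

end QMoney

theorem mainTheorem3
    (M : ℕ → QMoney.Scenario) (K : ∀ k, QMoney.Protocol (M k))
    (μ : ℕ → ℝ) (hμ : ∀ k, (M k).HasCloningParameter (μ k))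
    (hpub : ∀ k, (K k).AgreePhasePublic)
    (η : ℕ → ℝ) (hη : QMoney.Negligible η)
    (κ : ℝ) (hκ : 0 < κ) (ν : ℝ) (hν : 0 < ν)
    (hsec : QMoney.IsSecure K (fun k => 1 - η k) (fun _ => κ) (fun p _ => (1 - p) ^ ν))
    (ε : ℝ) (hε : 0 < ε)
    (hgap : ∀ᶠ k in Filter.atTop,
      μ k / (2 * ε * κ) < (2 - Real.sqrt 3) / 2 - (1 - κ) ^ ν)
    (n : ℕ → ℕ) (hn : ∃ f : Polynomial ℕ, ∀ k, n k ≤ f.eval k)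
    (hn0 : ∀ᶠ k in Filter.atTop, 0 < n k) :
    ∃ η' : ℕ → ℝ, QMoney.Negligible η' ∧
      QMoney.IsMoneyVerification (fun k => (K k).sequential (n k))
        (fun k => 1 - η' k) (fun k => (1 + ε) ^ n k * κ ^ n k) := by
  obtain ⟨hc, E, hE⟩ := hsec
  -- The actual completeness defect, so that the completeness bound holds for every `k`, including
  -- those with `n k = 0`. The maximum with `0` makes its absolute value trivial to handle.
  refine ⟨fun k => max 0 (1 - ((K k).sequential (n k)).honestProb), ?_, fun k => ?_, ?_⟩
  · refine Asymptotics.SuperpolynomialDecay.trans_eventually_abs_le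
      (hη.polynomial_mul hn) (hn0.mono fun k hk => ?_)
    obtain ⟨N, hN⟩ := Nat.exists_eq_succ_of_ne_zero hk.ne'
    have h0 := (K k).honestProb_nonneg
    -- Bernoulli's inequality bounds the defect of the power by `n k * η k`, which is negligible as
    -- `n` is polynomially bounded.
    have h1 := one_add_mul_le_pow (a := (K k).honestProb - 1) (by linarith) (n k)
    have h2 : (n k : ℝ) * (1 - (K k).honestProb) ≤ n k * η k :=
      mul_le_mul_of_nonneg_left (by linarith [hc k]) (Nat.cast_nonneg _)
    have h3 : ((K k).sequential (n k)).honestProb = (K k).honestProb ^ n k := by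
      rw [hN]
      exact (K k).honestProb_sequential
    rw [add_sub_cancel] at h1
    simp only [Function.comp_apply]
    rw [abs_of_nonneg (le_max_left _ _), h3]
    exact max_le (abs_nonneg _) ((by linarith : _ ≤ n k * η k).trans (le_abs_self _))
  · linarith [le_max_right 0 (1 - ((K k).sequential (n k)).honestProb)]
  · filter_upwards [hE, hgap, hn0] with k hEk hgk hnk A B I
    exact (K k).cloneGameProb_sequential_lt (hμ k) (hpub k) hκ hν hε hEk hgk hnk A B I
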